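/- Let $p$ be a prime, $F$ a finite extension of $\mathbb{Q}_p$ of degree $d$ with ring of integers $\mathcal{O}_F$ and a uniformizer $\varpi$, and $k$ a field of characteristic $p$. In $\mathrm{GL}_2(F)$ let $U=\left(\begin{smallmatrix}1&\mathcal{O}_F\\0&1\end{smallmatrix}\right)$, $H=\left(\begin{smallmatrix}\mathcal{O}_F^\times&0\\0&1\end{smallmatrix}\right)$, $\widetilde H=HU$ and $\alpha=\left(\begin{smallmatrix}\varpi&0\\0&1\end{smallmatrix}\right)$. For a profinite group $G$ let $k[[G]]=\varprojlim_N k[G/N]$, $N$ running over the open normal subgroups of $G$. Put $A=k[[U]]\subset k[[\widetilde H]]$, and let $\phi$ denote the endomorphism of $A$, respectively of $k[[\widetilde H]]$, induced by $x\mapsto\alpha x\alpha^{-1}$. For a $k$-algebra $B$ with a $k$-linear ring endomorphism $\phi$, let $B[X]_\phi$ be the ring of polynomials $\sum_i b_iX^i$ with the multiplication determined by $Xb=\phi(b)X$; modules are left modules. For an $A[X]_\phi$-module $M$ and $i\ge 0$, the $k$-vector space $\mathrm{Tor}_i^A(k,M)$ ($k$ being an $A$-module through the augmentation) is a $k[X]$-module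 through its identification with $\mathrm{Tor}_i^{A[X]_\phi}(k[X],M)$. If $M$ is finitely presented over $A[X]_\phi$, put $$h_i(M)=\dim_{k(X)}\bigl(k(X)\otimes_{k[X]}\mathrm{Tor}_i^A(k,M)\bigr),\qquad \chi^{A,\phi}(M)=\sum_{i\ge 0}(-1)^ih_i(M).$$ Let $M$ be a $k[[\widetilde H]][X]_\phi$-module which is smooth, i.e. every finitely generated $k[[\widetilde H]]$-submodule of $M$ is artinian, and whose underlying $A[X]_\phi$-module is finitely presented. Then every $\mathrm{Tor}_i^A(k,M)$ is a finitely generated $k[X]$-module, $\mathrm{Tor}_i^A(k,M)=0$ for $i>d$ (so that $\chi^{A,\phi}(M)$ is a well-defined integer), and $$\chi^{A,\phi}(M)=0.$$ -/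

import Mathlib

open CategoryTheory
open scoped Polynomial TensorProduct

universe u v w

noncomputable section

namespace PhiModule

/-! ### Twisted polynomial rings -/

section Twisted

variable {k A B : Type*} [Field k] [Ring A] [Algebra k A] [Ring B] [Algebra k B]

/-- A copy of the ring `A`, on which `n : Multiplicative ℕ` acts through `φ ^ n`. -/
def WithEndo (_φ : A →ₐ[k] A) : Type _ := A

instance (φ : A →ₐ[k] A) : Ring (WithEndo φ) := inferInstanceAs (Ring A)

instance (φ : A →ₐ[k] A) : MulSemiringAction (Multiplicative ℕ) (WithEndo φ) where
  smul n a := (φ ^ n.toAdd) (show A from a)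
  one_smul _ := rfl
  mul_smul m n a := by
    change (φ ^ (m.toAdd + n.toAdd)) (show A from a) = _
    rw [pow_add]
    rfl
  smul_zero n := map_zero (φ ^ n.toAdd)
  smul_add n := map_add (φ ^ n.toAdd)
  smul_one n := map_one (φ ^ n.toAdd)
  smul_mul n := map_mul (φ ^ n.toAdd)

/-- The twisted polynomial ring `A[X]_φ`: its elements are the polynomials `∑ aᵢ Xⁱ`
(coefficients on the left), and `(a Xⁱ) (b Xʲ) = a φⁱ(b) Xⁱ⁺ʲ`. -/
abbrev TwistedPoly (φ : A →ₐ[k] A) : Type _ := SkewPolynomial (WithEndo φ)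

namespace TwistedPoly

/-- The inclusion `A → A[X]_φ` of the constants. -/
def C (φ : A →ₐ[k] A) : A →+* TwistedPoly φ :=
  SkewPolynomial.CRingHom (R := WithEndo φ)

/-- The variable `X` of `A[X]_φ`. -/
def X (φ : A →ₐ[k] A) : TwistedPoly φ := SkewPolynomial.X

theorem X_mul_C (φ : A →ₐ[k] A) (a : A) : X φ * C φ a = C φ (φ a) * X φ :=
  (SkewPolynomial.X_mul_monomial (R := WithEndo φ) 0 a).trans
    (SkewPolynomial.monomial_mul_X (R := WithEndo φ) 0 (φ a)).symm

theorem X_pow_mul_C (φ : A →ₐ[k] A) (n : ℕ) (a : A) :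
    X φ ^ n * C φ a = C φ ((φ ^ n) a) * X φ ^ n := by
  induction n with
  | zero => simp
  | succ n ih =>
    rw [pow_succ' (X φ), mul_assoc, ih, ← mul_assoc, X_mul_C, mul_assoc, pow_succ' φ]
    rfl

/-- The ring homomorphism `A[X]_φ → B[X]_ψ`, `∑ aᵢ Xⁱ ↦ ∑ f(aᵢ) Xⁱ`, induced by an
algebra homomorphism `f : A → B` with `f ∘ φ = ψ ∘ f`. -/
def map {φ : A →ₐ[k] A} {ψ : B →ₐ[k] B} (f : A →ₐ[k] B) (hf : ∀ a, f (φ a) = ψ (f a)) :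
    TwistedPoly φ →+* TwistedPoly ψ :=
  SkewMonoidAlgebra.liftNCRingHom (k := WithEndo φ)
    ((C ψ).comp (show WithEndo φ →+* B from (f : A →+* B))) (powersHom _ (X ψ)) (by
      intro x y
      have h : ∀ n : ℕ, f ((φ ^ n) (show A from x)) = (ψ ^ n) (f (show A from x)) := by
        intro n
        induction n with
        | zero => rfl
        | succ n ih => rw [pow_succ', pow_succ', AlgHom.mul_apply, hf, ih, AlgHom.mul_apply]
      refine Eq.trans ?_ (X_pow_mul_C ψ y.toAdd (f (show A from x))).symm
      rw [← h]
      rfl)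

theorem map_C {φ : A →ₐ[k] A} {ψ : B →ₐ[k] B} (f : A →ₐ[k] B) (hf : ∀ a, f (φ a) = ψ (f a))
    (a : A) : map f hf (C φ a) = C ψ (f a) := by
  refine (SkewMonoidAlgebra.liftNC_single (k := WithEndo φ) _ _ _ _).trans ?_
  rw [map_one, mul_one]
  rfl

theorem map_X {φ : A →ₐ[k] A} {ψ : B →ₐ[k] B} (f : A →ₐ[k] B) (hf : ∀ a, f (φ a) = ψ (f a)) :
    map f hf (X φ) = X ψ := by
  refine (SkewMonoidAlgebra.liftNC_single (k := WithEndo φ) _ _ _ _).trans ?_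
  have h : f (1 : A) = 1 := map_one f
  change C ψ (f (1 : A)) * X ψ ^ 1 = X ψ
  rw [h, map_one, one_mul, pow_one]

/-- The ring homomorphism `k[X] → A[X]_φ`, `∑ cᵢ Xⁱ ↦ ∑ cᵢ Xⁱ`
(it is one because `φ` is `k`-linear). -/
def ofPolynomial (φ : A →ₐ[k] A) : k[X] →+* TwistedPoly φ :=
  Polynomial.eval₂RingHom' ((C φ).comp (algebraMap k A)) (X φ) fun c => by
    change C φ (algebraMap k A c) * X φ = X φ * C φ (algebraMap k A c)
    rw [X_mul_C, φ.commutes]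

end TwistedPoly

/-! ### The `k[X]`-modules `Tor_i^A(k, M)` -/

section Coinvariants

variable (φ : A →ₐ[k] A) (ε : A →ₐ[k] k)

/-- For an `A[X]_φ`-module `M` and an augmentation `ε : A → k` with kernel `𝔪`, the
`A[X]_φ`-submodule of `M` generated by the products `a m` with `a ∈ 𝔪`, `m ∈ M`.
When `ε ∘ φ = ε` it is just `𝔪 M`, see `coe_augSubmodule`. -/
def augSubmodule (M : Type*) [AddCommGroup M] [Module (TwistedPoly φ) M] :
    Submodule (TwistedPoly φ) M :=
  Submodule.span (TwistedPoly φ) {x | ∃ (a : A) (m : M), ε a = 0 ∧ x = TwistedPoly.C φ a • m}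

theorem coe_augSubmodule (hε : ∀ a, ε (φ a) = ε a)
    (M : Type*) [AddCommGroup M] [Module (TwistedPoly φ) M] :
    (augSubmodule φ ε M).toAddSubgroup =
      AddSubgroup.closure {x | ∃ (a : A) (m : M), ε a = 0 ∧ x = TwistedPoly.C φ a • m} := by
  apply le_antisymm
  · intro x hx
    refine Submodule.closure_induction (p := fun x _ => x ∈ AddSubgroup.closure
      {x | ∃ (a : A) (m : M), ε a = 0 ∧ x = TwistedPoly.C φ a • m}) (zero_mem _)
      (fun _ _ _ _ h h' => add_mem h h') ?_ hx
    rintro r _ ⟨a, m, ha, rfl⟩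
    induction r using SkewPolynomial.induction with
    | h0 => rw [zero_smul]; exact zero_mem _
    | ha n b q _ _ ih =>
      rw [add_smul]
      refine add_mem (AddSubgroup.subset_closure ⟨(show A from b) * (φ ^ n) a, TwistedPoly.X φ ^ n • m, ?_, ?_⟩) ih
      · have : ∀ n : ℕ, ε ((φ ^ n) a) = 0 := by
          intro n
          induction n with
          | zero => simpa using ha
          | succ n ih => rw [pow_succ', AlgHom.mul_apply, hε, ih]
        rw [map_mul, this, mul_zero]
      · have hb : SkewPolynomial.monomial n b = TwistedPoly.C φ b * TwistedPoly.X φ ^ n :=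
          ((SkewPolynomial.C_mul_X_pow_eq_monomial (R := WithEndo φ) (a := b)) (n := n)).symm
        rw [hb, smul_smul, smul_smul, mul_assoc, TwistedPoly.X_pow_mul_C, ← mul_assoc]
        exact congrArg (fun r => (r * TwistedPoly.X φ ^ n) • m)
          (map_mul (TwistedPoly.C φ) (show A from b) ((φ ^ n) a)).symm
  · rw [AddSubgroup.closure_le]
    exact Submodule.subset_span

/-- The functor `M ↦ M / 𝔪M` on `A[X]_φ`-modules. -/
def modAug : ModuleCat.{w} (TwistedPoly φ) ⥤ ModuleCat.{w} (TwistedPoly φ) where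
  obj M := ModuleCat.of _ (M ⧸ augSubmodule φ ε M)
  map {M N} f := ModuleCat.ofHom ((augSubmodule φ ε M).mapQ (augSubmodule φ ε N) f.hom (by
    rw [augSubmodule, Submodule.span_le]
    rintro _ ⟨a, m, ha, rfl⟩
    exact Submodule.subset_span ⟨a, f.hom m, ha, map_smul f.hom _ _⟩))
  map_id M := by
    ext x
    rfl
  map_comp f g := by
    ext x
    rfl

instance : (modAug.{w} φ ε).Additive where
  map_add {M N f g} := by
    ext x
    obtain ⟨x, rfl⟩ := Submodule.Quotient.mk_surjective _ x
    rfl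

/-- The functor `k ⊗_A - = k[X] ⊗_{A[X]_φ} -` from `A[X]_φ`-modules to `k[X]`-modules,
realised as `M ↦ M / 𝔪M`, where `k` is an `A`-module through `ε`; the action of `X` on
`M / 𝔪M` is induced by that of `X` on `M`. -/
def residue : ModuleCat.{w} (TwistedPoly φ) ⥤ ModuleCat.{w} k[X] :=
  modAug.{w} φ ε ⋙ ModuleCat.restrictScalars (TwistedPoly.ofPolynomial φ)

instance : (residue.{w} φ ε).Additive :=
  inferInstanceAs (_ ⋙ _ : ModuleCat.{w} (TwistedPoly φ) ⥤ _).Additive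

end Coinvariants

section Tor

variable (φ : A →ₐ[k] A) (ε : A →ₐ[k] k) [Small.{w} (TwistedPoly φ)]

/-- The `k[X]`-module `Tor_i^A(k, M) = Tor_i^{A[X]_φ}(k[X], M)`, for an `A[X]_φ`-module `M`: the
value at `M` of the `i`-th left derived functor of `k ⊗_A - = k[X] ⊗_{A[X]_φ} -`, on the category
of `A[X]_φ`-modules. As `A[X]_φ` is free as a left `A`-module, a projective resolution of the
`A[X]_φ`-module `M` is a flat resolution of the `A`-module `M`, so that the underlying vector
space is the usual `Tor_i^A(k, M)`, and `X` acts on it through its action on `M`. -/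
def tor (i : ℕ) (M : ModuleCat.{w} (TwistedPoly φ)) : ModuleCat.{w} k[X] :=
  ((residue.{w} φ ε).leftDerived i).obj M

/-- `h_i(M) = dim_{k(X)} (k(X) ⊗_{k[X]} Tor_i^A(k, M))`. -/
def torRank (i : ℕ) (M : ModuleCat.{w} (TwistedPoly φ)) : ℕ :=
  Module.finrank (RatFunc k) (RatFunc k ⊗[k[X]] tor φ ε i M)

/-- The Euler-Poincaré characteristic `χ^{A,φ}(M) = ∑_{i ≥ 0} (-1)^i h_i(M)`. -/
def eulerChar (M : ModuleCat.{w} (TwistedPoly φ)) : ℤ :=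
  ∑ᶠ i : ℕ, (-1) ^ i * (torRank φ ε i M : ℤ)

end Tor

/-- A module is locally artinian if all its finitely generated submodules are artinian. -/
def IsLocallyArtinian (R M : Type*) [Ring R] [AddCommGroup M] [Module R M] : Prop :=
  ∀ N : Submodule R M, N.FG → IsArtinian R N

/-- An `A[X]_φ`-module is smooth if the underlying `A`-module is locally artinian. -/
def IsSmooth (φ : A →ₐ[k] A) (M : ModuleCat.{w} (TwistedPoly φ)) : Prop :=
  IsLocallyArtinian A ((ModuleCat.restrictScalars (TwistedPoly.C φ)).obj M)

end Twisted

/-! ### Completed group algebras -/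

section Iwasawa

variable (k : Type*) [Field k]
variable {G G' G'' : Type*} [Group G] [TopologicalSpace G] [Group G'] [TopologicalSpace G']
  [Group G''] [TopologicalSpace G'']

/-- The completed group algebra `k[[G]]` of a profinite group `G`: the inverse limit of the group
algebras `k[G / N]`, where `N` runs over the open normal subgroups of `G`. -/
def IwasawaAlgebra (G : Type*) [Group G] [TopologicalSpace G] : Subalgebra k
    (∀ N : OpenNormalSubgroup G, MonoidAlgebra k (G ⧸ N.toSubgroup)) where
  carrier := {x | ∀ (N N' : OpenNormalSubgroup G) (h : N.toSubgroup ≤ N'.toSubgroup),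
    MonoidAlgebra.mapDomainAlgHom k k
      (QuotientGroup.map N.toSubgroup N'.toSubgroup (MonoidHom.id G) h) (x N) = x N'}
  mul_mem' hx hy N N' h := by simp only [Pi.mul_apply, map_mul, hx N N' h, hy N N' h]
  add_mem' hx hy N N' h := by simp only [Pi.add_apply, map_add, hx N N' h, hy N N' h]
  algebraMap_mem' c N N' h := AlgHom.commutes _ c

/-- The inverse image of an open normal subgroup under a continuous homomorphism. -/
def comapOpenNormal (f : G →ₜ* G') (N : OpenNormalSubgroup G') : OpenNormalSubgroup G where
  toOpenSubgroup := N.toOpenSubgroup.comap (f : G →* G') f.continuous_toFun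
  isNormal' := inferInstanceAs (N.toSubgroup.comap (f : G →* G')).Normal

namespace IwasawaAlgebra

/-- The homomorphism `k[[G]] → k[[G']]` induced by a continuous homomorphism `G → G'`. -/
def map (f : G →ₜ* G') : IwasawaAlgebra k G →ₐ[k] IwasawaAlgebra k G' :=
  AlgHom.codRestrict
    ((AlgHom.pi fun N' : OpenNormalSubgroup G' =>
      (MonoidAlgebra.mapDomainAlgHom k k (QuotientGroup.map (comapOpenNormal f N').toSubgroup
        N'.toSubgroup (f : G →* G') le_rfl)).comp (Pi.evalAlgHom k _ (comapOpenNormal f N'))).comp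
      (IwasawaAlgebra k G).val) (IwasawaAlgebra k G') (by
    intro x N N' h
    have hx := x.2 (comapOpenNormal f N) (comapOpenNormal f N') (Subgroup.comap_mono h)
    change MonoidAlgebra.mapDomainAlgHom k k _ (MonoidAlgebra.mapDomainAlgHom k k _ (x.1 _))
      = MonoidAlgebra.mapDomainAlgHom k k _ (x.1 _)
    rw [← hx]
    simp only [← AlgHom.comp_apply, ← MonoidAlgebra.mapDomainAlgHom_comp]
    congr 2
    ext g
    rfl)

theorem map_apply (f : G →ₜ* G') (x : IwasawaAlgebra k G) (N : OpenNormalSubgroup G') :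
    (map k f x).1 N = MonoidAlgebra.mapDomainAlgHom k k (QuotientGroup.map
      (comapOpenNormal f N).toSubgroup N.toSubgroup (f : G →* G') le_rfl)
      (x.1 (comapOpenNormal f N)) := rfl

theorem map_map (f : G →ₜ* G') (g : G' →ₜ* G'') (x : IwasawaAlgebra k G) :
    map k g (map k f x) = map k (g.comp f) x := by
  ext1
  funext N
  rw [map_apply, map_apply, map_apply]
  simp only [← AlgHom.comp_apply, ← MonoidAlgebra.mapDomainAlgHom_comp]
  refine DFunLike.congr_fun (congrArg (MonoidAlgebra.mapDomainAlgHom k k) ?_)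
    (x.1 (comapOpenNormal (g.comp f) N))
  ext a
  rfl

/-- The augmentation `k[[G]] → k`, which sends every element of `G` to `1`. -/
def augmentation (G : Type*) [Group G] [TopologicalSpace G] : IwasawaAlgebra k G →ₐ[k] k :=
  ((MonoidAlgebra.lift k k (G ⧸ (⊤ : Subgroup G)) 1).comp
    (Pi.evalAlgHom k _ ({ (⊤ : OpenSubgroup G) with
      isNormal' := inferInstanceAs (⊤ : Subgroup G).Normal } : OpenNormalSubgroup G))).comp
    (IwasawaAlgebra k G).val

theorem lift_one_mapDomain {Q Q' : Type*} [Group Q] [Group Q'] (h : Q →* Q')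
    (y : MonoidAlgebra k Q) : MonoidAlgebra.lift k k Q' 1 (MonoidAlgebra.mapDomainAlgHom k k h y)
      = MonoidAlgebra.lift k k Q 1 y := by
  induction y using MonoidAlgebra.induction_linear with
  | zero => simp
  | add x y hx hy => rw [map_add, map_add, map_add, hx, hy]
  | single a c => simp

theorem augmentation_map (f : G →ₜ* G') (x : IwasawaAlgebra k G) :
    augmentation k G' (map k f x) = augmentation k G x := by
  exact lift_one_mapDomain k _ _

end IwasawaAlgebra

end Iwasawa

/-! ### Subgroups of `GL₂(F)` -/

section GL2

open Matrix

variable (p : ℕ) [Fact p.Prime] (F : Type*) [NormedField F] [NormedAlgebra ℚ_[p] F]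

/-- The ring of integers `O_F` of an extension `F` of `ℚ_p`: the elements integral over `ℤ_p`. -/
def integers : Subring F where
  carrier := {x | ((algebraMap ℚ_[p] F).comp (PadicInt.Coe.ringHom (p := p))).IsIntegralElem x}
  mul_mem' hx hy := RingHom.IsIntegralElem.mul _ hx hy
  one_mem' := RingHom.isIntegralElem_one _
  add_mem' hx hy := RingHom.IsIntegralElem.add _ hx hy
  zero_mem' := RingHom.isIntegralElem_zero _
  neg_mem' hx := RingHom.IsIntegralElem.neg _ hx

/-- The group homomorphism `a ↦ (a 0; 0 1)` from `Fˣ` to `GL₂(F)`. -/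
def diagHom : Fˣ →* GL (Fin 2) F where
  toFun a := ⟨!![(a : F), 0; 0, 1], !![((a⁻¹ : Fˣ) : F), 0; 0, 1],
    by simp [one_fin_two], by simp [one_fin_two]⟩
  map_one' := by simp [Units.ext_iff, one_fin_two]
  map_mul' a b := by simp [Units.ext_iff]

/-- The group `U` of the matrices `(1 b; 0 1)` with `b ∈ O_F`. -/
def groupU : Subgroup (GL (Fin 2) F) :=
  (integers p F).toAddSubgroup.toSubgroup.map
    (GeneralLinearGroup.upperRightHom (R := F)).toMonoidHom

/-- The group `H` of the matrices `(a 0; 0 1)` with `a ∈ O_Fˣ`. -/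
def groupH : Subgroup (GL (Fin 2) F) :=
  ((diagHom F).comp (Units.map ((integers p F).subtype : integers p F →* F))).range

/-- The group `H̃ = H U`, generated by `H` and `U`. -/
def groupHU : Subgroup (GL (Fin 2) F) := groupH p F ⊔ groupU p F

variable {p F}

theorem groupU_le_groupHU : groupU p F ≤ groupHU p F := le_sup_right

/-- The matrix `α = (ϖ 0; 0 1)`. -/
def alpha (ϖ : integers p F) (hϖ : ϖ ≠ 0) : GL (Fin 2) F :=
  diagHom F (Units.mk0 (ϖ : F) (by simpa using hϖ))

variable (ϖ : integers p F) (hϖ : ϖ ≠ 0)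

theorem alpha_conj_mem_groupU {g : GL (Fin 2) F} (hg : g ∈ groupU p F) :
    alpha ϖ hϖ * g * (alpha ϖ hϖ)⁻¹ ∈ groupU p F := by
  obtain ⟨b, hb, rfl⟩ := hg
  refine ⟨Multiplicative.ofAdd ((ϖ : F) * b.toAdd), (integers p F).mul_mem ϖ.2 hb, ?_⟩
  rw [eq_mul_inv_iff_mul_eq]
  ext i j
  fin_cases i <;> fin_cases j <;> simp [alpha, diagHom]

theorem alpha_conj_mem_groupH {g : GL (Fin 2) F} (hg : g ∈ groupH p F) :
    alpha ϖ hϖ * g * (alpha ϖ hϖ)⁻¹ ∈ groupH p F := by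
  obtain ⟨a, rfl⟩ := hg
  refine ⟨a, ?_⟩
  rw [eq_mul_inv_iff_mul_eq, alpha, MonoidHom.comp_apply, ← map_mul, ← map_mul, mul_comm]

theorem alpha_conj_mem_groupHU {g : GL (Fin 2) F} (hg : g ∈ groupHU p F) :
    alpha ϖ hϖ * g * (alpha ϖ hϖ)⁻¹ ∈ groupHU p F := by
  have h : groupHU p F ≤ (groupHU p F).comap (MulAut.conj (alpha ϖ hϖ)).toMonoidHom :=
    sup_le (fun x hx => Subgroup.mem_sup_left (alpha_conj_mem_groupH ϖ hϖ hx))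
      (fun x hx => Subgroup.mem_sup_right (alpha_conj_mem_groupU ϖ hϖ hx))
  exact h hg

/-- The continuous endomorphism `x ↦ g x g⁻¹` of a subgroup `S` with `g S g⁻¹ ⊆ S`. -/
def conjHom {S : Subgroup (GL (Fin 2) F)} (g : GL (Fin 2) F)
    (h : ∀ x ∈ S, g * x * g⁻¹ ∈ S) : S →ₜ* S where
  toFun x := ⟨g * x * g⁻¹, h x x.2⟩
  map_one' := by ext1; simp
  map_mul' x y := by ext1; simp
  continuous_toFun := by fun_prop

variable (p F) in
/-- The inclusion `U → H̃`. -/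
def inclHU : groupU p F →ₜ* groupHU p F where
  toMonoidHom := Subgroup.inclusion groupU_le_groupHU
  continuous_toFun := continuous_inclusion groupU_le_groupHU

end GL2

/-! ### The rings `A = k[[U]]` and `k[[H̃]]` with their endomorphisms `φ` -/

section Phi

variable (k : Type*) [Field k] {p : ℕ} [Fact p.Prime] {F : Type*} [NormedField F]
  [NormedAlgebra ℚ_[p] F] (ϖ : integers p F) (hϖ : ϖ ≠ 0)

/-- The endomorphism `φ` of `A = k[[U]]` induced by `x ↦ α x α⁻¹`. -/
def phiU : IwasawaAlgebra k (groupU p F) →ₐ[k] IwasawaAlgebra k (groupU p F) :=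
  IwasawaAlgebra.map k (conjHom (alpha ϖ hϖ) fun _ => alpha_conj_mem_groupU ϖ hϖ)

/-- The endomorphism `φ` of `k[[H̃]]` induced by `x ↦ α x α⁻¹`. -/
def phiHU : IwasawaAlgebra k (groupHU p F) →ₐ[k] IwasawaAlgebra k (groupHU p F) :=
  IwasawaAlgebra.map k (conjHom (alpha ϖ hϖ) fun _ => alpha_conj_mem_groupHU ϖ hϖ)

theorem augmentation_phiU (x : IwasawaAlgebra k (groupU p F)) :
    IwasawaAlgebra.augmentation k _ (phiU k ϖ hϖ x) = IwasawaAlgebra.augmentation k _ x :=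
  IwasawaAlgebra.augmentation_map k _ x

variable (p F) in
/-- The homomorphism `A = k[[U]] → k[[H̃]]` induced by the inclusion `U → H̃`. -/
def inclIwasawa : IwasawaAlgebra k (groupU p F) →ₐ[k] IwasawaAlgebra k (groupHU p F) :=
  IwasawaAlgebra.map k (inclHU p F)

theorem inclIwasawa_phi (x : IwasawaAlgebra k (groupU p F)) :
    inclIwasawa k p F (phiU k ϖ hϖ x) = phiHU k ϖ hϖ (inclIwasawa k p F x) := by
  rw [inclIwasawa, phiU, phiHU, IwasawaAlgebra.map_map, IwasawaAlgebra.map_map]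
  rfl

/-- The `A[X]_φ`-module underlying a `k[[H̃]][X]_φ`-module. -/
def restrictU (M : ModuleCat.{w} (TwistedPoly (phiHU k ϖ hϖ))) :
    ModuleCat.{w} (TwistedPoly (phiU k ϖ hϖ)) :=
  (ModuleCat.restrictScalars
    (TwistedPoly.map (inclIwasawa k p F) (inclIwasawa_phi k ϖ hϖ))).obj M

end Phi

end PhiModule

end

/-!
The group `H̃` plays a role only through the smoothness of `M`. Put `A = k[[U]]`, with augmentation
ideal `𝔪`. The proof rests on the following facts.

* *The structure of `A`.* As `O_F` is free of rank `d` over `ℤ_p`, the group `U` is isomorphic to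
  `ℤ_p^d` (`nonempty_groupU_equiv`). The algebra `k[[G]]` of a profinite group is the dual of the
  space of locally constant functions `G → k` (`pairing_injective`, `pairing_surjective`), so that
  questions on it can be dualised. If `e_0, …, e_{d-1}` is a topological basis of `U`, the operator
  `f ↦ f(e_j ·) - f` is surjective on the functions invariant under `e_0, …, e_{j-1}`, because `k`
  has characteristic `p` (`exists_translate_gen_sub_eq`). Dually the elements `e_j - 1` form a
  regular sequence (`isRegularUpTo_var`), and they generate `𝔪` (`initialIdeal_var`). Cutting
  functions into their restrictions to the cosets of `α U α⁻¹` shows that `φ` is flat and finite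
  (`flat_and_finite_map`). Finally `A` is local (`isLocalRing`), since the image of `𝔪` in each
  `k[U / N]` is nilpotent.
* *Smooth modules are `𝔪`-torsion.* As `U` is a normal pro-`p` subgroup of `H̃`, the ideal `𝔪` maps
  into the Jacobson radical of `k[[H̃]]` (`map_mem_jacobson`). If `m` generates an artinian
  `k[[H̃]]`-module, then the submodules generated by the `𝔪ⁿ m` become stationary, and Nakayama's
  lemma shows that they vanish for large `n` (`exists_pow_smul_eq_zero`). Hence the finitely
  generated `A`-submodules of `M` have finite length.
* *Resolution by induced modules.* Write `Ind V = A[X]_φ ⊗_A V`. Let `M₀` be a finitely generated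
  `A`-submodule of `M` containing generators, and large enough for all the relations between its
  elements to follow from the relations `∑ aᵢ X mᵢ = m`, with `mᵢ, m ∈ M₀`. The latter are
  parametrised by an `A`-submodule `N` of `A ⊗_{φ, A} M₀`, and there is an exact sequence
  `0 → Ind N → Ind M₀ → M → 0` where `N` and `M₀` have finite length (`exists_ind_resolution`);
  injectivity is seen on the components of highest degree.
* *Induced modules have Euler characteristic zero.* The long exact sequence for `Tor` makes `χ`
  additive (`eulerChar_add`). Since `Ind` is exact, it is enough to treat `Ind k`, where
  `k = A / 𝔪`. Let `I_j` be generated by the first `j` terms of the regular sequence. The exact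
  sequences `0 → A/I_j → A/I_j → A/I_{j+1} → 0` show by induction that the `Tor` modules of
  `Ind (A/I_j)` are finitely generated, starting from `Ind A = A[X]_φ`, and that
  `χ(Ind (A/I_{j+1})) = 0` (`isTorFinite_ind_quotient`). As `d > 0`, this applies to `A/I_d = k`.

Altogether this gives `χ(M) = χ(Ind M₀) - χ(Ind N) = 0`, and the finiteness of the `Tor` modules of
`M` (`tor_and_eulerChar_of_torsion`). The vanishing of `Tor_i` for `i > d` holds for every
`A[X]_φ`-module (`subsingleton_tor`): in a projective resolution `P`, the cokernel of
`P_{i+1} → P_i` is an `i`-th syzygy of the module, on which `min(i, d)` terms of the regular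
sequence are regular; so if `i ≥ d`, an element of `P_{i+1}` whose boundary lies in `𝔪 P_i` is the
sum of a cycle and an element of `𝔪 P_{i+1}` (`exists_sub_mem_smul_top`).
-/

noncomputable section

namespace PhiModule

/-! ### The long exact sequence of left derived functors -/

section LongExact

open Limits Abelian

variable {C D : Type*} [Category* C] [Abelian C] [Category* D] [Abelian D]

/-- A functorial choice of epimorphisms `F(X) ↠ X` with `F(X)` projective, where moreover `F`
sends monomorphisms to split monomorphisms. It gives functorial projective resolutions which send a
monomorphism to a degreewise split monomorphism. -/
structure SplitResolution (C : Type*) [Category* C] [Abelian C] extends LeftResolution (𝟭 C) where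
  projective_F (X : C) : Projective (F.obj X)
  split_F {X Y : C} (f : X ⟶ Y) [Mono f] : IsSplitMono (F.map f)

namespace SplitResolution

variable (Λ : SplitResolution C)

/-- The resolution of `X` attached to `Λ`. -/
abbrev res (X : C) : ChainComplex C ℕ := Λ.toLeftResolution.chainComplex X

instance projective_res (X : C) (n : ℕ) : Projective ((Λ.res X).X n) := by
  match n with
  | 0 => exact Projective.of_iso (Λ.chainComplexXZeroIso X).symm (Λ.projective_F _)
  | 1 => exact Projective.of_iso (Λ.chainComplexXOneIso X).symm (Λ.projective_F _)
  | n + 2 => exact Projective.of_iso (Λ.chainComplexXIso X n).symm (Λ.projective_F _)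

/-- The augmentation of the resolution of `X`. -/
def resπ (X : C) : Λ.res X ⟶ (ChainComplex.single₀ C).obj X :=
  (ChainComplex.toSingle₀Equiv _ _).symm ⟨(Λ.chainComplexXZeroIso X).hom ≫ Λ.π.app X, by
    have h := Λ.map_chainComplex_d_1_0 X
    dsimp at h
    rw [h]
    simp⟩

lemma resπ_f_zero (X : C) :
    (Λ.resπ X).f 0 = (Λ.chainComplexXZeroIso X).hom ≫ Λ.π.app X := by
  simp [resπ]

lemma res_exact₀ (X : C) : (ShortComplex.mk ((Λ.res X).d 1 0)
    ((Λ.chainComplexXZeroIso X).hom ≫ Λ.π.app X) (by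
      have h := Λ.map_chainComplex_d_1_0 X
      dsimp at h
      rw [h]
      simp)).Exact := by
  have e : (ShortComplex.mk (Λ.π.app (kernel (Λ.π.app X)) ≫ kernel.ι _) (Λ.π.app X)
      (by simp)).Exact := by
    rw [ShortComplex.exact_iff_epi_kernel_lift]
    convert! Λ.epi_π_app (kernel (Λ.π.app X))
    rw [← cancel_mono (kernel.ι _), kernel.lift_ι]
  refine ShortComplex.exact_of_iso ?_ e
  refine ShortComplex.isoMk (Λ.chainComplexXOneIso X).symm (Λ.chainComplexXZeroIso X).symm
    (Iso.refl _) ?_ ?_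
  · have h := Λ.map_chainComplex_d_1_0 X
    dsimp at h ⊢
    rw [h]
    simp
  · simp

instance quasiIso_resπ (X : C) : QuasiIso (Λ.resπ X) := ⟨fun n => by
  cases n
  · rw [ChainComplex.quasiIsoAt₀_iff, ShortComplex.quasiIso_iff_of_zeros' _
      ((Λ.res X).shape 0 0 (by simp)) rfl rfl]
    refine (ShortComplex.exact_and_epi_g_iff_of_iso ?_).2
      ⟨Λ.res_exact₀ X, by dsimp; have := Λ.epi_π_app X; exact epi_comp _ _⟩
    exact ShortComplex.isoMk (Iso.refl _) (Iso.refl _) (Iso.refl _)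
      ((Category.id_comp _).trans (Category.comp_id _).symm)
      ((Category.id_comp _).trans ((Category.comp_id _).trans (Λ.resπ_f_zero X)).symm)
  · rw [quasiIsoAt_iff_exactAt']
    · exact Λ.exactAt_map_chainComplex_succ X _
    · apply ChainComplex.exactAt_succ_single_obj⟩

/-- The projective resolution of `X` attached to `Λ`. -/
def resolution (X : C) : ProjectiveResolution X where
  complex := Λ.res X
  π := Λ.resπ X

lemma split_chainComplexMap {X Y : C} (f : X ⟶ Y) [Mono f] (n : ℕ) :
    IsSplitMono ((Λ.chainComplexMap f).f n) := by
  have key : ∀ {A A' B B' : C} (a : A ≅ A') (g : A' ⟶ B') (b : B' ≅ B) (_ : IsSplitMono g),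
      IsSplitMono (a.hom ≫ g ≫ b.hom) := by
    intro A A' B B' a g b hg
    exact ⟨⟨b.inv ≫ retraction g ≫ a.inv, by simp⟩⟩
  induction n using Nat.twoStepInduction with
  | zero => exact key _ _ (Λ.chainComplexXZeroIso Y).symm (Λ.split_F f)
  | one =>
    refine key _ _ (Λ.chainComplexXOneIso Y).symm ?_
    have : Mono (kernel.map (Λ.π.app X) (Λ.π.app Y) ((𝟭 C).map (Λ.F.map f)) f
      (Λ.π.naturality f).symm) := by
      have := Λ.split_F f
      have : Mono ((𝟭 C).map (Λ.F.map f)) := inferInstanceAs (Mono (Λ.F.map f))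
      infer_instance
    exact Λ.split_F _
  | more n h0 h1 =>
    rw [LeftResolution.chainComplexMap_f_succ_succ]
    refine key _ _ (Λ.chainComplexXIso Y n).symm ?_
    have : Mono ((𝟭 C).map ((Λ.chainComplexMap f).f (n + 1))) :=
      inferInstanceAs (Mono ((Λ.chainComplexMap f).f (n + 1)))
    exact Λ.split_F _

lemma resπ_naturality {X Y : C} (f : X ⟶ Y) :
    Λ.chainComplexMap f ≫ Λ.resπ Y = Λ.resπ X ≫ (ChainComplex.single₀ C).map f := by
  refine HomologicalComplex.to_single_hom_ext ?_
  have h0 : (Λ.chainComplexMap f ≫ Λ.resπ Y).f 0 = (Λ.chainComplexMap f).f 0 ≫ (Λ.resπ Y).f 0 := rfl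
  have h1 : (Λ.resπ X ≫ (ChainComplex.single₀ C).map f).f 0 =
      (Λ.resπ X).f 0 ≫ ((ChainComplex.single₀ C).map f).f 0 := rfl
  refine h0.trans (Eq.trans ?_ h1.symm)
  rw [ChainComplex.single₀_map_f_zero, resπ_f_zero, resπ_f_zero, LeftResolution.chainComplexMap_f_0]
  have h : Λ.F.map f ≫ Λ.π.app Y = Λ.π.app X ≫ f := Λ.π.naturality f
  have key : ∀ {A A' B B' : C} (a : A ≅ A') (g : A' ⟶ B') (b : B ≅ B') (c : B' ⟶ Y)
      (c' : A' ⟶ X), g ≫ c = c' ≫ f → (a.hom ≫ g ≫ b.inv) ≫ b.hom ≫ c = (a.hom ≫ c') ≫ f := by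
    intro A A' B B' a g b c c' h
    simp [h]
  exact key _ _ _ _ _ h

/-- A short exact sequence of objects has a degreewise split short exact sequence of projective
resolutions. -/
lemma exists_resolution (Λ : SplitResolution C) {S : ShortComplex C} (hS : S.ShortExact) :
    ∃ (P₁ : ProjectiveResolution S.X₁) (P₂ : ProjectiveResolution S.X₂)
      (P₃ : ProjectiveResolution S.X₃) (f : P₁.complex ⟶ P₂.complex) (g : P₂.complex ⟶ P₃.complex)
      (h : f ≫ g = 0), ∀ n, Nonempty ((ShortComplex.mk f g h).map
        (HomologicalComplex.eval C _ n)).Splitting := by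
  have := hS.mono_f
  have := hS.epi_g
  let φ := Λ.chainComplexMap S.f
  have hφ : ∀ n, IsSplitMono (φ.f n) := Λ.split_chainComplexMap S.f
  have : Mono φ := HomologicalComplex.mono_of_mono_f _ fun n => (hφ n).mono
  let T : ShortComplex (ChainComplex C ℕ) := ShortComplex.mk φ (cokernel.π φ) (cokernel.condition φ)
  have hT : T.ShortExact := { exact := ShortComplex.exact_cokernel φ }
  have hs : ∀ n, Nonempty (T.map (HomologicalComplex.eval C _ n)).Splitting := fun n => by
    have h := (HomologicalComplex.shortExact_iff_degreewise_shortExact T).1 hT n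
    have := h.epi_g
    obtain ⟨⟨r, hr⟩⟩ := hφ n
    exact ⟨ShortComplex.Splitting.ofExactOfRetraction _ h.exact r hr h.epi_g⟩
  let T₀ : ShortComplex (ChainComplex C ℕ) := S.map (ChainComplex.single₀ C)
  have hT₀ : T₀.ShortExact := by
    rw [HomologicalComplex.shortExact_iff_degreewise_shortExact]
    intro n
    cases n with
    | zero =>
      refine ShortComplex.shortExact_of_iso ?_ hS
      exact ShortComplex.isoMk (Iso.refl _) (Iso.refl _) (Iso.refl _)
        ((Category.id_comp _).trans
          ((ChainComplex.single₀_map_f_zero S.f).trans (Category.comp_id _).symm))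
        ((Category.id_comp _).trans
          ((ChainComplex.single₀_map_f_zero S.g).trans (Category.comp_id _).symm))
    | succ n =>
      have z : ∀ X : C, IsZero (((ChainComplex.single₀ C).obj X).X (n + 1)) :=
        fun X => HomologicalComplex.isZero_single_obj_X _ _ _ _ (by simp)
      exact { exact := ShortComplex.exact_of_isZero_X₂ _ (z S.X₂)
              mono_f := ⟨fun _ _ _ => (z S.X₁).eq_of_tgt _ _⟩
              epi_g := ⟨fun _ _ _ => (z S.X₃).eq_of_src _ _⟩ }
  have hz : Λ.chainComplexMap S.f ≫ Λ.resπ S.X₂ ≫ (ChainComplex.single₀ C).map S.g = 0 := by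
    rw [← Category.assoc, resπ_naturality, Category.assoc, ← Functor.map_comp, S.zero,
      Functor.map_zero, comp_zero]
  let π₃ : T.X₃ ⟶ T₀.X₃ := cokernel.desc φ (Λ.resπ S.X₂ ≫ (ChainComplex.single₀ C).map S.g) hz
  let ψ : T ⟶ T₀ :=
    { τ₁ := Λ.resπ S.X₁
      τ₂ := Λ.resπ S.X₂
      τ₃ := π₃
      comm₁₂ := (Λ.resπ_naturality S.f).symm
      comm₂₃ := (cokernel.π_desc _ _ _).symm }
  -- The five lemma, for the long exact homology sequences: the cokernel complex resolves `S.X₃`.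
  have hq : QuasiIso π₃ := HomologicalComplex.HomologySequence.quasiIso_τ₃ ψ hT hT₀
    (Λ.quasiIso_resπ _) (Λ.quasiIso_resπ _)
  -- Its terms are direct summands of projective objects.
  have hp : ∀ n, Projective (T.X₃.X n) := fun n => by
    obtain ⟨s⟩ := hs n
    have : Projective ((T.map (HomologicalComplex.eval C _ n)).X₂) := Λ.projective_res S.X₂ n
    exact Retract.projective ⟨s.s, (T.map (HomologicalComplex.eval C _ n)).g, s.s_g⟩
  exact ⟨Λ.resolution _, Λ.resolution _,
    { complex := T.X₃, projective := hp, π := π₃, quasiIso := hq },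
    φ, cokernel.π φ, cokernel.condition φ, hs⟩

/-- The long exact sequence of left derived functors. -/
lemma exists_longExact_leftDerived (Λ : SplitResolution C) [HasProjectiveResolutions C]
    (F : C ⥤ D) [F.Additive] {S : ShortComplex C} (hS : S.ShortExact) :
    ∃ (f : ∀ n, (F.leftDerived n).obj S.X₁ ⟶ (F.leftDerived n).obj S.X₂)
      (g : ∀ n, (F.leftDerived n).obj S.X₂ ⟶ (F.leftDerived n).obj S.X₃)
      (δ : ∀ n, (F.leftDerived (n + 1)).obj S.X₃ ⟶ (F.leftDerived n).obj S.X₁),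
      (∀ n, ∃ h : f n ≫ g n = 0, (ShortComplex.mk _ _ h).Exact) ∧
      (∀ n, ∃ h : g (n + 1) ≫ δ n = 0, (ShortComplex.mk _ _ h).Exact) ∧
      (∀ n, ∃ h : δ n ≫ f n = 0, (ShortComplex.mk _ _ h).Exact) ∧ Epi (g 0) := by
  obtain ⟨P₁, P₂, P₃, f, g, h, hs⟩ := Λ.exists_resolution hS
  let T := (ShortComplex.mk f g h).map (F.mapHomologicalComplex _)
  have hT : T.ShortExact := by
    rw [HomologicalComplex.shortExact_iff_degreewise_shortExact]
    intro n
    obtain ⟨s⟩ := hs n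
    exact (s.map F).shortExact
  let e₁ : ∀ n, (F.leftDerived n).obj S.X₁ ≅ T.X₁.homology n := P₁.isoLeftDerivedObj F
  let e₂ : ∀ n, (F.leftDerived n).obj S.X₂ ≅ T.X₂.homology n := P₂.isoLeftDerivedObj F
  let e₃ : ∀ n, (F.leftDerived n).obj S.X₃ ≅ T.X₃.homology n := P₃.isoLeftDerivedObj F
  have key : ∀ {A B C A' B' C' : D} (a : A' ≅ A) (b : B' ≅ B) (c : C' ≅ C)
      (f : A ⟶ B) (g : B ⟶ C) (h : f ≫ g = 0), (ShortComplex.mk f g h).Exact →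
      ∃ h : (a.hom ≫ f ≫ b.inv) ≫ (b.hom ≫ g ≫ c.inv) = 0, (ShortComplex.mk _ _ h).Exact := by
    intro A B C A' B' C' a b c f g h hex
    refine ⟨by simp [reassoc_of% h], ShortComplex.exact_of_iso ?_ hex⟩
    exact ShortComplex.isoMk a.symm b.symm c.symm (by simp) (by simp)
  refine ⟨fun n => (e₁ n).hom ≫ HomologicalComplex.homologyMap T.f n ≫ (e₂ n).inv,
    fun n => (e₂ n).hom ≫ HomologicalComplex.homologyMap T.g n ≫ (e₃ n).inv,
    fun n => (e₃ (n + 1)).hom ≫ hT.δ (n + 1) n rfl ≫ (e₁ n).inv,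
    fun n => key _ _ _ _ _ _ (hT.homology_exact₂ n),
    fun n => key _ _ _ _ _ _ (hT.homology_exact₃ (n + 1) n rfl),
    fun n => key _ _ _ _ _ _ (hT.homology_exact₁ (n + 1) n rfl), ?_⟩
  have := hT.epi_g
  have : Epi (HomologicalComplex.homologyMap T.g 0) :=
    HomologicalComplex.epi_homologyMap_of_epi_of_not_rel _ _ (by simp)
  infer_instance

end SplitResolution

/-- The resolution of an `R`-module by the free modules on the underlying sets of modules. -/
def freeResolution (R : Type w) [Ring R] : SplitResolution (ModuleCat.{w} R) where
  F := forget (ModuleCat.{w} R) ⋙ ModuleCat.free R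
  π := (ModuleCat.adj R).counit
  projective_F X := ModuleCat.projective_of_free (ι := X)
    (Finsupp.basisSingleOne (R := R) (ι := X))
  split_F {X Y} f _ := by
    have : Function.Injective f := (ModuleCat.mono_iff_injective f).1 inferInstance
    have hs : IsSplitMono ((forget (ModuleCat.{w} R)).map f) :=
      ⟨⟨TypeCat.ofHom (Function.invFun f), by ext x; exact Function.leftInverse_invFun this x⟩⟩
    exact inferInstanceAs (IsSplitMono ((ModuleCat.free R).map ((forget _).map f)))
  epi_π_app X := inferInstance

end LongExact

/-! ### Euler characteristics along long exact sequences -/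

section LongExactRank

variable {S : Type*} [CommRing S]
  {T₁ T₂ T₃ : ℕ → Type*} [∀ i, AddCommGroup (T₁ i)] [∀ i, Module S (T₁ i)]
  [∀ i, AddCommGroup (T₂ i)] [∀ i, Module S (T₂ i)] [∀ i, AddCommGroup (T₃ i)]
  [∀ i, Module S (T₃ i)]

lemma finite_of_exact [IsNoetherianRing S] {M N P : Type*} [AddCommGroup M]
    [Module S M] [AddCommGroup N] [Module S N] [AddCommGroup P] [Module S P]
    {f : M →ₗ[S] N} {g : N →ₗ[S] P} (h : Function.Exact f g)
    [Module.Finite S M] [Module.Finite S P] : Module.Finite S N := by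
  have : IsNoetherian S N := isNoetherian_of_range_eq_ker f g h.linearMap_ker_eq.symm
  infer_instance

lemma subsingleton_of_exact {M N P : Type*} [AddCommGroup M] [Module S M] [AddCommGroup N]
    [Module S N] [AddCommGroup P] [Module S P] {f : M →ₗ[S] N} {g : N →ₗ[S] P}
    (h : Function.Exact f g) (hM : Subsingleton M) (hP : Subsingleton P) : Subsingleton N := by
  refine ⟨fun a b => ?_⟩
  have key : ∀ n : N, n = 0 := fun n => by
    obtain ⟨m, rfl⟩ := (h n).1 (Subsingleton.elim _ _)
    rw [Subsingleton.elim m 0, map_zero]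
  rw [key a, key b]

lemma finrank_eq_of_exact [IsDomain S] {M N P : Type*} [AddCommGroup M] [Module S M]
    [AddCommGroup N] [Module S N] [AddCommGroup P] [Module S P] {f : M →ₗ[S] N} {g : N →ₗ[S] P}
    (h : Function.Exact f g) [Module.Finite S N] :
    Module.finrank S N = Module.finrank S f.range + Module.finrank S g.range := by
  rw [← h.linearMap_ker_eq, ← g.quotKerEquivRange.finrank_eq, add_comm]
  exact (Submodule.finrank_quotient_add_finrank _).symm

/-- In a long exact sequence of finite modules which vanish in large degrees, the Euler
characteristics are additive. -/
lemma sum_finrank_of_longExact [IsDomain S] (f : ∀ i, T₁ i →ₗ[S] T₂ i) (g : ∀ i, T₂ i →ₗ[S] T₃ i)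
    (δ : ∀ i, T₃ (i + 1) →ₗ[S] T₁ i) (hfg : ∀ i, Function.Exact (f i) (g i))
    (hgδ : ∀ i, Function.Exact (g (i + 1)) (δ i)) (hδf : ∀ i, Function.Exact (δ i) (f i))
    (h0 : Function.Surjective (g 0)) [∀ i, Module.Finite S (T₁ i)] [∀ i, Module.Finite S (T₂ i)]
    [∀ i, Module.Finite S (T₃ i)] (n : ℕ) (hn : Subsingleton (T₃ (n + 1))) :
    ∑ i ∈ Finset.range (n + 1), (-1 : ℤ) ^ i * Module.finrank S (T₂ i) =
      ∑ i ∈ Finset.range (n + 1), (-1 : ℤ) ^ i * Module.finrank S (T₁ i) +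
      ∑ i ∈ Finset.range (n + 1), (-1 : ℤ) ^ i * Module.finrank S (T₃ i) := by
  have key : ∀ m : ℕ, ∑ i ∈ Finset.range (m + 1), (-1 : ℤ) ^ i * Module.finrank S (T₂ i) +
      (-1 : ℤ) ^ m * Module.finrank S (δ m).range =
      ∑ i ∈ Finset.range (m + 1), (-1 : ℤ) ^ i * Module.finrank S (T₁ i) +
      ∑ i ∈ Finset.range (m + 1), (-1 : ℤ) ^ i * Module.finrank S (T₃ i) := by
    intro m
    induction m with
    | zero =>
      have h3 : Module.finrank S (T₃ 0) = Module.finrank S (g 0).range := by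
        rw [LinearMap.range_eq_top.2 h0, finrank_top]
      simp only [zero_add, Finset.sum_range_one, h3, finrank_eq_of_exact (hfg 0),
        finrank_eq_of_exact (hδf 0)]
      push_cast
      ring
    | succ m ih =>
      rw [Finset.sum_range_succ, Finset.sum_range_succ (n := m + 1),
        Finset.sum_range_succ (n := m + 1), finrank_eq_of_exact (hfg (m + 1)),
        finrank_eq_of_exact (hgδ m), finrank_eq_of_exact (hδf (m + 1))]
      push_cast
      linear_combination ih
  have h := key n
  have hz : Module.finrank S (δ n).range = 0 := by
    have : Subsingleton (δ n).range := by
      exact (δ n).surjective_rangeRestrict.subsingleton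
    exact Module.finrank_zero_of_subsingleton
  rw [hz] at h
  simpa using h

end LongExactRank

section Twisted

variable {k A : Type*} [Field k] [Ring A] [Algebra k A] (φ : A →ₐ[k] A)

lemma TwistedPoly.monomial_eq (n : ℕ) (a : A) :
    SkewPolynomial.monomial (R := WithEndo φ) n a = TwistedPoly.C φ a * TwistedPoly.X φ ^ n :=
  (SkewPolynomial.C_mul_X_pow_eq_monomial (R := WithEndo φ) (a := a) (n := n)).symm

variable {φ} in
@[elab_as_elim]
lemma TwistedPoly.induction {P : TwistedPoly φ → Prop} (r : TwistedPoly φ) (zero : P 0)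
    (add : ∀ r s, P r → P s → P (r + s)) (C_mul_X_pow : ∀ n a, P (C φ a * X φ ^ n)) : P r := by
  induction r using SkewPolynomial.induction with
  | h0 => exact zero
  | ha n b p _ _ ih => exact add _ _ (monomial_eq φ n b ▸ C_mul_X_pow n b) ih

lemma TwistedPoly.ofPolynomial_monomial (n : ℕ) (c : k) :
    ofPolynomial φ (Polynomial.monomial n c) = C φ (algebraMap k A c) * X φ ^ n :=
  Polynomial.eval₂_monomial _ _

end Twisted

section GoodModules

variable {k : Type v} {A : Type w} [Field k] [Ring A] [Algebra k A] (φ : A →ₐ[k] A) (ε : A →ₐ[k] k)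

/-- The finiteness conditions which make the Euler characteristic of `M` meaningful: the modules
`Tor_i^A(k, M)` are finitely generated over `k[X]` and vanish for large `i`. -/
structure IsTorFinite (M : ModuleCat.{w} (TwistedPoly φ)) : Prop where
  finite (i : ℕ) : Module.Finite k[X] (tor φ ε i M)
  bounded : ∃ n, ∀ i, n < i → Subsingleton (tor φ ε i M)

lemma torRank_eq_finrank (i : ℕ) (M : ModuleCat.{w} (TwistedPoly φ)) :
    torRank φ ε i M = Module.finrank k[X] (tor φ ε i M) :=
  (TensorProduct.isBaseChange k[X] (tor φ ε i M) (RatFunc k)).finrank_eq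

variable {φ ε}

lemma eulerChar_eq_sum {M : ModuleCat.{w} (TwistedPoly φ)} {n : ℕ}
    (hn : ∀ i, n < i → Subsingleton (tor φ ε i M)) :
    eulerChar φ ε M =
      ∑ i ∈ Finset.range (n + 1), (-1 : ℤ) ^ i * Module.finrank k[X] (tor φ ε i M) := by
  rw [eulerChar]
  simp only [torRank_eq_finrank]
  refine finsum_eq_sum_of_support_subset _ fun i hi => ?_
  by_contra h
  have := hn i (by simpa [Nat.lt_succ_iff] using h)
  exact hi (by simp [Module.finrank_zero_of_subsingleton])

/-- The long exact sequence of the modules `Tor_i^A(k, -)`. -/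
lemma exists_tor_longExact {S : ShortComplex (ModuleCat.{w} (TwistedPoly φ))}
    (hS : S.ShortExact) :
    ∃ (f : ∀ i, tor φ ε i S.X₁ →ₗ[k[X]] tor φ ε i S.X₂)
      (g : ∀ i, tor φ ε i S.X₂ →ₗ[k[X]] tor φ ε i S.X₃)
      (δ : ∀ i, tor φ ε (i + 1) S.X₃ →ₗ[k[X]] tor φ ε i S.X₁),
      (∀ i, Function.Exact (f i) (g i)) ∧ (∀ i, Function.Exact (g (i + 1)) (δ i)) ∧
        (∀ i, Function.Exact (δ i) (f i)) ∧ Function.Surjective (g 0) := by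
  obtain ⟨f, g, δ, h₁, h₂, h₃, h₄⟩ :=
    (freeResolution (TwistedPoly φ)).exists_longExact_leftDerived (residue.{w} φ ε) hS
  refine ⟨fun n => (f n).hom, fun n => (g n).hom, fun n => (δ n).hom, fun n => ?_, fun n => ?_,
    fun n => ?_, (ModuleCat.epi_iff_surjective _).1 h₄⟩
  · obtain ⟨_, h⟩ := h₁ n
    exact (ShortComplex.ShortExact.moduleCat_exact_iff_function_exact _).1 h
  · obtain ⟨_, h⟩ := h₂ n
    exact (ShortComplex.ShortExact.moduleCat_exact_iff_function_exact _).1 h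
  · obtain ⟨_, h⟩ := h₃ n
    exact (ShortComplex.ShortExact.moduleCat_exact_iff_function_exact _).1 h

variable {M₁ M₂ M₃ : Type w} [AddCommGroup M₁] [AddCommGroup M₂] [AddCommGroup M₃]
  [Module (TwistedPoly φ) M₁] [Module (TwistedPoly φ) M₂] [Module (TwistedPoly φ) M₃]
  {f : M₁ →ₗ[TwistedPoly φ] M₂} {g : M₂ →ₗ[TwistedPoly φ] M₃}

/-- In a short exact sequence `0 → M₁ → M₂ → M₃ → 0`, if the middle term is Tor-finite and the first
one is, so is the third one. -/
lemma IsTorFinite.third (hf : Function.Injective f) (hg : Function.Surjective g)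
    (hfg : Function.Exact f g) (h₁ : IsTorFinite φ ε (ModuleCat.of _ M₁))
    (h₂ : IsTorFinite φ ε (ModuleCat.of _ M₂)) : IsTorFinite φ ε (ModuleCat.of _ M₃) := by
  obtain ⟨F, G, δ, hFG, hGδ, hδF, hG⟩ := exists_tor_longExact (ε := ε)
    (ModuleCat.shortComplex_shortExact (ShortComplex.mk (ModuleCat.ofHom f) (ModuleCat.ofHom g)
      (by ext x; exact hfg.apply_apply_eq_zero x)) hfg hf hg)
  obtain ⟨n₁, hn₁⟩ := h₁.bounded
  obtain ⟨n₂, hn₂⟩ := h₂.bounded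
  have := h₁.finite
  have := h₂.finite
  refine ⟨fun i => ?_, n₁ + n₂ + 1, fun i hi => ?_⟩
  · cases i with
    | zero => exact Module.Finite.of_surjective (G 0) hG
    | succ i => exact finite_of_exact (hGδ i)
  · obtain ⟨i, rfl⟩ : ∃ j, i = j + 1 := ⟨i - 1, by omega⟩
    exact subsingleton_of_exact (hGδ i) (hn₂ _ (by omega)) (hn₁ _ (by omega))

lemma IsTorFinite.second (hf : Function.Injective f) (hg : Function.Surjective g)
    (hfg : Function.Exact f g) (h₁ : IsTorFinite φ ε (ModuleCat.of _ M₁))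
    (h₃ : IsTorFinite φ ε (ModuleCat.of _ M₃)) : IsTorFinite φ ε (ModuleCat.of _ M₂) := by
  obtain ⟨F, G, δ, hFG, hGδ, hδF, hG⟩ := exists_tor_longExact (ε := ε)
    (ModuleCat.shortComplex_shortExact (ShortComplex.mk (ModuleCat.ofHom f) (ModuleCat.ofHom g)
      (by ext x; exact hfg.apply_apply_eq_zero x)) hfg hf hg)
  obtain ⟨n₁, hn₁⟩ := h₁.bounded
  obtain ⟨n₃, hn₃⟩ := h₃.bounded
  have := h₁.finite
  have := h₃.finite
  exact ⟨fun i => finite_of_exact (hFG i), n₁ + n₃, fun i hi =>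
    subsingleton_of_exact (hFG i) (hn₁ _ (by omega)) (hn₃ _ (by omega))⟩

lemma eulerChar_add (hf : Function.Injective f) (hg : Function.Surjective g)
    (hfg : Function.Exact f g) (h₁ : IsTorFinite φ ε (ModuleCat.of _ M₁))
    (h₂ : IsTorFinite φ ε (ModuleCat.of _ M₂)) (h₃ : IsTorFinite φ ε (ModuleCat.of _ M₃)) :
    eulerChar φ ε (ModuleCat.of _ M₂) =
      eulerChar φ ε (ModuleCat.of _ M₁) + eulerChar φ ε (ModuleCat.of _ M₃) := by
  obtain ⟨F, G, δ, hFG, hGδ, hδF, hG⟩ := exists_tor_longExact (ε := ε)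
    (ModuleCat.shortComplex_shortExact (ShortComplex.mk (ModuleCat.ofHom f) (ModuleCat.ofHom g)
      (by ext x; exact hfg.apply_apply_eq_zero x)) hfg hf hg)
  obtain ⟨n₁, hn₁⟩ := h₁.bounded
  obtain ⟨n₂, hn₂⟩ := h₂.bounded
  obtain ⟨n₃, hn₃⟩ := h₃.bounded
  have := h₁.finite
  have := h₂.finite
  have := h₃.finite
  rw [eulerChar_eq_sum (n := n₁ + n₂ + n₃) (fun i hi => hn₁ i (by omega)),
    eulerChar_eq_sum (n := n₁ + n₂ + n₃) (fun i hi => hn₂ i (by omega)),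
    eulerChar_eq_sum (n := n₁ + n₂ + n₃) (fun i hi => hn₃ i (by omega))]
  exact sum_finrank_of_longExact F G δ hFG hGδ hδF hG _ (hn₃ _ (by omega))

lemma IsTorFinite.of_iso {M N : ModuleCat.{w} (TwistedPoly φ)} (e : M ≅ N)
    (h : IsTorFinite φ ε M) : IsTorFinite φ ε N := by
  have e' : ∀ i, tor φ ε i M ≃ₗ[k[X]] tor φ ε i N := fun i =>
    (((residue.{w} φ ε).leftDerived i).mapIso e).toLinearEquiv
  have := h.finite
  obtain ⟨n, hn⟩ := h.bounded
  exact ⟨fun i => Module.Finite.equiv (e' i), n, fun i hi =>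
    have := hn i hi; (e' i).symm.injective.subsingleton⟩

lemma eulerChar_of_iso {M N : ModuleCat.{w} (TwistedPoly φ)} (e : M ≅ N) :
    eulerChar φ ε M = eulerChar φ ε N := by
  have e' : ∀ i, tor φ ε i M ≃ₗ[k[X]] tor φ ε i N := fun i =>
    (((residue.{w} φ ε).leftDerived i).mapIso e).toLinearEquiv
  simp only [eulerChar, torRank_eq_finrank, fun i => (e' i).finrank_eq]

variable (φ ε) in
lemma finite_residue_self :
    Module.Finite k[X] ((residue.{w} φ ε).obj (ModuleCat.of _ (TwistedPoly φ))) := by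
  let N := augSubmodule φ ε (TwistedPoly φ)
  let Q : ModuleCat k[X] := (ModuleCat.restrictScalars (TwistedPoly.ofPolynomial φ)).obj
    (ModuleCat.of (TwistedPoly φ) (TwistedPoly φ ⧸ N))
  let q : TwistedPoly φ → Q := fun r => N.mkQ r
  have hq : ∀ r s, q (r + s) = q r + q s := fun r s => map_add N.mkQ r s
  suffices h : (⊤ : Submodule k[X] Q) ≤ Submodule.span k[X] {q 1} from
    (⟨⟨{q 1}, by rw [Finset.coe_singleton]; exact eq_top_iff.2 h⟩⟩ : Module.Finite k[X] Q)
  rintro x -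
  obtain ⟨r, rfl⟩ : ∃ r, q r = x := N.mkQ_surjective x
  induction r using TwistedPoly.induction with
  | zero =>
    have h : q 0 = 0 := map_zero N.mkQ
    exact h ▸ zero_mem (Submodule.span k[X] {q 1})
  | add r s hr hs => exact hq r s ▸ add_mem hr hs
  | C_mul_X_pow n a =>
    -- `a Xⁿ` and `ε(a) Xⁿ` are congruent modulo `𝔪 A[X]_φ`.
    refine Submodule.mem_span_singleton.2 ⟨Polynomial.monomial n (ε a), ?_⟩
    change N.mkQ (TwistedPoly.ofPolynomial φ (Polynomial.monomial n (ε a)) • 1) = N.mkQ _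
    rw [eq_comm, ← sub_eq_zero, ← map_sub, ← LinearMap.mem_ker, Submodule.ker_mkQ,
      TwistedPoly.ofPolynomial_monomial, smul_eq_mul, mul_one, ← sub_mul, ← map_sub]
    exact Submodule.subset_span ⟨_, TwistedPoly.X φ ^ n, by simp, rfl⟩

/-- The ring `A[X]_φ` itself is Tor-finite. -/
lemma isTorFinite_self : IsTorFinite φ ε (ModuleCat.of _ (TwistedPoly φ)) := by
  have hp : Projective (ModuleCat.of (TwistedPoly φ) (TwistedPoly φ)) :=
    ModuleCat.projective_of_free (Module.Basis.singleton Unit (TwistedPoly φ))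
  have hz : ∀ i, Subsingleton (tor φ ε (i + 1) (ModuleCat.of _ (TwistedPoly φ))) := fun i =>
    ModuleCat.subsingleton_of_isZero (Functor.isZero_leftDerived_obj_projective_succ _ i _)
  refine ⟨fun i => ?_, 0, fun i hi => ?_⟩
  · cases i with
    | succ i => have := hz i; infer_instance
    | zero =>
      have := finite_residue_self φ ε
      exact Module.Finite.equiv (asIso ((residue.{w} φ ε).fromLeftDerivedZero.app
        (ModuleCat.of _ (TwistedPoly φ)))).toLinearEquiv.symm
  · obtain ⟨i, rfl⟩ : ∃ j, i = j + 1 := ⟨i - 1, by omega⟩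
    exact hz i

end GoodModules

/-! ### Induction from `A`-modules to `A[X]_φ`-modules -/

section Induction

variable {k A : Type*} [Field k] [CommRing A] [Algebra k A] (φ : A →ₐ[k] A)

/-- The ring `A[X]_φ` as a bimodule: `A[X]_φ` acts by multiplication on the left, and the
commutative ring `A` by multiplication on the right. -/
def RightPoly : Type _ := TwistedPoly φ

namespace RightPoly

instance : AddCommGroup (RightPoly φ) := inferInstanceAs (AddCommGroup (TwistedPoly φ))

instance : Module (TwistedPoly φ) (RightPoly φ) :=
  inferInstanceAs (Module (TwistedPoly φ) (TwistedPoly φ))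

/-- The identity map from the ring `A[X]_φ` to the bimodule. -/
def of : TwistedPoly φ ≃ₗ[TwistedPoly φ] RightPoly φ := LinearEquiv.refl _ (TwistedPoly φ)

instance : Module A (RightPoly φ) where
  smul a r := of φ ((of φ).symm r * TwistedPoly.C φ a)
  one_smul r := congrArg (of φ) (by rw [map_one, mul_one]; rfl)
  mul_smul a b r := congrArg (of φ) (by
    rw [mul_comm a b, map_mul, ← mul_assoc]
    rfl)
  smul_zero a := congrArg (of φ) (zero_mul _)
  smul_add a r s := congrArg (of φ) (add_mul _ _ _)
  add_smul a b r := congrArg (of φ) (by rw [map_add, mul_add]; rfl)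
  zero_smul r := congrArg (of φ) (by rw [map_zero, mul_zero]; rfl)

variable {φ}

lemma smul_of (a : A) (r : TwistedPoly φ) : a • of φ r = of φ (r * TwistedPoly.C φ a) := rfl

instance : SMulCommClass A (TwistedPoly φ) (RightPoly φ) where
  smul_comm a s r := congrArg (of φ) (mul_assoc s ((of φ).symm r) (TwistedPoly.C φ a))

end RightPoly

open RightPoly

variable {φ}

variable (φ) in
/-- The coefficient of `Xⁿ`, as an element of `A`. -/
def TwistedPoly.coeffHom (n : ℕ) : TwistedPoly φ →+ A :=
  AddMonoidHom.mk' (fun r => SkewPolynomial.coeff (R := WithEndo φ) r n)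
    fun r s => SkewPolynomial.coeff_add r s n

lemma TwistedPoly.coeffHom_C_mul_X_pow (n m : ℕ) (a : A) :
    coeffHom φ m (C φ a * X φ ^ n) = if n = m then a else 0 := by
  rw [← TwistedPoly.monomial_eq]
  exact SkewPolynomial.coeff_monomial

lemma TwistedPoly.coeffHom_mul_C (n : ℕ) (r : TwistedPoly φ) (a : A) :
    coeffHom φ n (r * C φ a) = coeffHom φ n r * (φ ^ n) a := by
  induction r using TwistedPoly.induction with
  | zero => rw [zero_mul, map_zero, zero_mul]
  | add r s hr hs => rw [add_mul, map_add, map_add, hr, hs, add_mul]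
  | C_mul_X_pow m b =>
    rw [mul_assoc, X_pow_mul_C, ← mul_assoc, ← map_mul, coeffHom_C_mul_X_pow, coeffHom_C_mul_X_pow]
    split_ifs with h
    · rw [h]
    · rw [zero_mul]

lemma TwistedPoly.coeffHom_C_mul (n : ℕ) (r : TwistedPoly φ) (a : A) :
    coeffHom φ n (C φ a * r) = a * coeffHom φ n r := by
  induction r using TwistedPoly.induction with
  | zero => rw [mul_zero, map_zero, mul_zero]
  | add r s hr hs => rw [mul_add, map_add, map_add, hr, hs, mul_add]
  | C_mul_X_pow m b =>
    rw [← mul_assoc, ← map_mul, coeffHom_C_mul_X_pow, coeffHom_C_mul_X_pow]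
    split_ifs with h
    · rfl
    · rw [mul_zero]

lemma TwistedPoly.coeffHom_succ_mul_X (n : ℕ) (r : TwistedPoly φ) :
    coeffHom φ (n + 1) (r * X φ) = coeffHom φ n r := by
  induction r using TwistedPoly.induction with
  | zero => rw [zero_mul, map_zero, map_zero]
  | add r s hr hs => rw [add_mul, map_add, map_add, hr, hs]
  | C_mul_X_pow m b =>
    rw [mul_assoc, ← pow_succ, coeffHom_C_mul_X_pow, coeffHom_C_mul_X_pow]
    simp

lemma TwistedPoly.exists_coeffHom_eq_zero (r : TwistedPoly φ) :
    ∃ N, ∀ n, N ≤ n → coeffHom φ n r = 0 := by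
  induction r using TwistedPoly.induction with
  | zero => exact ⟨0, fun n _ => map_zero _⟩
  | add r s hr hs =>
    obtain ⟨N, hN⟩ := hr
    obtain ⟨N', hN'⟩ := hs
    exact ⟨N + N', fun n hn => by rw [map_add, hN n (by omega), hN' n (by omega), add_zero]⟩
  | C_mul_X_pow m b =>
    exact ⟨m + 1, fun n hn => by rw [coeffHom_C_mul_X_pow, if_neg (by omega)]⟩

lemma TwistedPoly.sum_coeffHom {r : TwistedPoly φ} {N : ℕ}
    (hN : ∀ n, N ≤ n → coeffHom φ n r = 0) :
    r = ∑ n ∈ Finset.range N, C φ (coeffHom φ n r) * X φ ^ n := by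
  refine SkewPolynomial.ext fun m => ?_
  change coeffHom φ m r = coeffHom φ m _
  rw [map_sum]
  simp only [coeffHom_C_mul_X_pow, Finset.sum_ite_eq', Finset.mem_range]
  split_ifs with h
  · rfl
  · exact hN m (by omega)

variable (φ) in
/-- The homogeneous part of degree `n` of a polynomial, as an endomorphism of the right
`A`-module `A[X]_φ`. -/
def homogeneousPart (n : ℕ) : RightPoly φ →ₗ[A] RightPoly φ where
  toFun r := of φ (TwistedPoly.C φ (TwistedPoly.coeffHom φ n ((of φ).symm r)) * TwistedPoly.X φ ^ n)
  map_add' r s := by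
    rw [map_add (of φ).symm, map_add, map_add, add_mul, map_add]
  map_smul' a r := by
    obtain ⟨r, rfl⟩ := (of φ).surjective r
    rw [smul_of, RingHom.id_apply, smul_of, LinearEquiv.symm_apply_apply,
      LinearEquiv.symm_apply_apply, TwistedPoly.coeffHom_mul_C, mul_assoc,
      TwistedPoly.X_pow_mul_C, map_mul (TwistedPoly.C φ), mul_assoc]

/-- A copy of `A`, seen as an `A`-module through `φⁿ`. The right `A`-module `A[X]_φ` is the direct
sum of these modules. -/
def Twist (_φ : A →ₐ[k] A) (_n : ℕ) : Type _ := A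

instance (n : ℕ) : AddCommGroup (Twist φ n) := inferInstanceAs (AddCommGroup A)

instance (n : ℕ) : Module A (Twist φ n) :=
  Module.compHom A ((φ ^ n : A →ₐ[k] A) : A →+* A)

lemma flat_twist (h : (φ : A →+* A).Flat) (n : ℕ) : Module.Flat A (Twist φ n) := by
  have h' : ((φ ^ n : A →ₐ[k] A) : A →+* A).Flat := by
    induction n with
    | zero => exact RingHom.Flat.id A
    | succ n ih =>
      rw [pow_succ]
      exact RingHom.Flat.comp h ih
  exact h'

variable (φ) in
/-- The inclusion of the monomials of degree `n`. -/
def monomialHom (n : ℕ) : Twist φ n →ₗ[A] RightPoly φ where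
  toFun a := of φ (TwistedPoly.C φ (show A from a) * TwistedPoly.X φ ^ n)
  map_add' a b := by
    rw [← map_add, ← add_mul, ← map_add]
    rfl
  map_smul' a b := by
    rw [RingHom.id_apply, smul_of, mul_assoc, TwistedPoly.X_pow_mul_C, ← mul_assoc, ← map_mul,
      mul_comm]
    rfl

/-- If `φ` is flat, so are the direct summands `Twist φ n` of the right `A`-module `A[X]_φ`, and
hence that module. -/
lemma flat_rightPoly (h : (φ : A →+* A).Flat) : Module.Flat A (RightPoly φ) := by
  have := flat_twist h
  let e : DirectSum ℕ (fun n => Twist φ n) →ₗ[A] RightPoly φ :=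
    DirectSum.toModule A ℕ _ (monomialHom φ)
  refine Module.Flat.of_linearEquiv (LinearEquiv.ofBijective e ⟨?_, ?_⟩).symm
  · have key : ∀ x n, TwistedPoly.coeffHom φ n ((of φ).symm (e x)) = x n := by
      intro x n
      induction x using DirectSum.induction_on with
      | zero => rw [map_zero, map_zero, map_zero]; rfl
      | add x y hx hy => rw [map_add, map_add, map_add, hx, hy]; rfl
      | of m a =>
        have : e (DirectSum.of _ m a) = monomialHom φ m a := DirectSum.toModule_lof A m a
        rw [this]
        refine (TwistedPoly.coeffHom_C_mul_X_pow m n (show A from a)).trans ?_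
        by_cases h : m = n
        · subst h
          rw [if_pos rfl]
          exact (DirectSum.of_eq_same (β := Twist φ) m a).symm
        · rw [if_neg h]
          exact (DirectSum.of_eq_of_ne (β := Twist φ) m n a (Ne.symm h)).symm
    intro x y hxy
    refine DFinsupp.ext fun n => ?_
    exact (key x n).symm.trans ((congrArg _ (congrArg _ hxy)).trans (key y n))
  · intro r
    obtain ⟨r, rfl⟩ := (of φ).surjective r
    induction r using TwistedPoly.induction with
    | zero => exact ⟨0, by rw [map_zero, map_zero]⟩
    | add r s hr hs =>
      obtain ⟨x, hx⟩ := hr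
      obtain ⟨y, hy⟩ := hs
      exact ⟨x + y, by rw [map_add, map_add, hx, hy]⟩
    | C_mul_X_pow n a =>
      exact ⟨DirectSum.lof A ℕ (Twist φ) n (show Twist φ n from a),
        DirectSum.toModule_lof A n _⟩

variable (φ) in
/-- The `A[X]_φ`-module `A[X]_φ ⊗_A V` induced by an `A`-module `V`. -/
abbrev Ind (V : Type*) [AddCommGroup V] [Module A V] : Type _ := RightPoly φ ⊗[A] V

namespace Ind

variable {V W Z : Type*} [AddCommGroup V] [Module A V] [AddCommGroup W] [Module A W]
  [AddCommGroup Z] [Module A Z]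
  {M : Type*} [AddCommGroup M] [Module (TwistedPoly φ) M]

variable (φ) in
/-- The map `V → A[X]_φ ⊗_A V`, `v ↦ 1 ⊗ v`. -/
def unit : V →+ Ind φ V :=
  (TensorProduct.mk A (RightPoly φ) V (of φ 1)).toAddMonoidHom

lemma tmul_eq (r : TwistedPoly φ) (v : V) : (of φ r ⊗ₜ[A] v : Ind φ V) = r • unit φ v := by
  change _ = r • (of φ 1 ⊗ₜ[A] v)
  rw [TensorProduct.smul_tmul', ← map_smul, smul_eq_mul, mul_one]

lemma unit_smul (a : A) (v : V) : unit φ (a • v) = TwistedPoly.C φ a • unit φ v := by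
  rw [← tmul_eq]
  change of φ 1 ⊗ₜ[A] (a • v) = _
  rw [← TensorProduct.smul_tmul, smul_of, one_mul]

@[elab_as_elim]
lemma induction_on {P : Ind φ V → Prop} (x : Ind φ V) (zero : P 0)
    (add : ∀ x y, P x → P y → P (x + y))
    (smul_unit : ∀ (r : TwistedPoly φ) (v : V), P (r • unit φ v)) : P x := by
  induction x using TensorProduct.induction_on with
  | zero => exact zero
  | add x y hx hy => exact add x y hx hy
  | tmul r v =>
    obtain ⟨r, rfl⟩ := (of φ).surjective r
    exact tmul_eq r v ▸ smul_unit r v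

/-- The additive map underlying `Ind.lift`. -/
def liftHom (f : V →+ M) (hf : ∀ (a : A) v, f (a • v) = TwistedPoly.C φ a • f v) :
    Ind φ V →+ M :=
  TensorProduct.liftAddHom (R := A)
    (((smulAddHom (TwistedPoly φ) M).flip.comp f).flip.comp (of φ).symm.toAddMonoidHom)
    (fun a r v => by
      obtain ⟨r, rfl⟩ := (of φ).surjective r
      change (of φ).symm (a • of φ r) • f v = (of φ).symm (of φ r) • f (a • v)
      rw [smul_of, LinearEquiv.symm_apply_apply, LinearEquiv.symm_apply_apply, hf, mul_smul])

lemma liftHom_smul_unit (f : V →+ M) (hf : ∀ (a : A) v, f (a • v) = TwistedPoly.C φ a • f v)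
    (r : TwistedPoly φ) (v : V) : liftHom f hf (r • unit φ v) = r • f v := by
  rw [← tmul_eq]
  rfl

/-- The `A[X]_φ`-linear map `A[X]_φ ⊗_A V → M` extending an `A`-linear map `V → M`. -/
def lift (f : V →+ M) (hf : ∀ (a : A) v, f (a • v) = TwistedPoly.C φ a • f v) :
    Ind φ V →ₗ[TwistedPoly φ] M :=
  { liftHom f hf with
    map_smul' := fun s x => by
      change liftHom f hf (s • x) = s • liftHom f hf x
      induction x using induction_on with
      | zero => rw [smul_zero, map_zero, smul_zero]
      | add x y hx hy => rw [smul_add, map_add, map_add, hx, hy, smul_add]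
      | smul_unit r v => rw [smul_smul, liftHom_smul_unit, liftHom_smul_unit, mul_smul] }

@[simp]
lemma lift_unit (f : V →+ M) (hf : ∀ (a : A) v, f (a • v) = TwistedPoly.C φ a • f v) (v : V) :
    lift f hf (unit φ v) = f v :=
  (congrArg (liftHom f hf) (one_smul (TwistedPoly φ) (unit φ v)).symm).trans
    ((liftHom_smul_unit f hf 1 v).trans (one_smul _ _))

lemma hom_ext {f g : Ind φ V →ₗ[TwistedPoly φ] M} (h : ∀ v, f (unit φ v) = g (unit φ v)) :
    f = g := by
  ext x
  induction x using induction_on with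
  | zero => rw [map_zero, map_zero]
  | add x y hx hy => rw [map_add, map_add, hx, hy]
  | smul_unit r v => rw [map_smul, map_smul, h]

variable (φ) in
/-- The functoriality of `V ↦ A[X]_φ ⊗_A V`. -/
def map (f : V →ₗ[A] W) : Ind φ V →ₗ[TwistedPoly φ] Ind φ W :=
  lift ((unit φ).comp f.toAddMonoidHom) fun a v => by
    change unit φ (f (a • v)) = _
    rw [map_smul, unit_smul]
    rfl

lemma map_eq_lTensor (f : V →ₗ[A] W) (x : Ind φ V) :
    map φ f x = LinearMap.lTensor (RightPoly φ) f x := by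
  induction x using TensorProduct.induction_on with
  | zero => rw [map_zero, map_zero]
  | add x y hx hy => rw [map_add, map_add, hx, hy]
  | tmul r v =>
    obtain ⟨r, rfl⟩ := (of φ).surjective r
    rw [tmul_eq, map_smul, ← tmul_eq, LinearMap.lTensor_tmul, tmul_eq]
    exact congrArg (r • ·) (lift_unit _ _ v)

lemma map_surjective {f : V →ₗ[A] W} (hf : Function.Surjective f) :
    Function.Surjective (map φ f) := fun x => by
  obtain ⟨y, rfl⟩ := LinearMap.lTensor_surjective (RightPoly φ) hf x
  exact ⟨y, map_eq_lTensor f y⟩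

lemma map_injective (h : (φ : A →+* A).Flat) {f : V →ₗ[A] W} (hf : Function.Injective f) :
    Function.Injective (map φ f) := fun x y hxy => by
  have := flat_rightPoly h
  rw [map_eq_lTensor, map_eq_lTensor] at hxy
  exact Module.Flat.lTensor_preserves_injective_linearMap f hf hxy

lemma map_exact {f : V →ₗ[A] W} {g : W →ₗ[A] Z} (hfg : Function.Exact f g)
    (hg : Function.Surjective g) : Function.Exact (map φ f) (map φ g) := fun x => by
  rw [map_eq_lTensor, lTensor_exact (RightPoly φ) hfg hg x]
  simp only [Set.mem_range, map_eq_lTensor]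

variable (φ) in
/-- The induction of `A` is the module `A[X]_φ`. -/
def selfEquiv : Ind φ A ≃ₗ[TwistedPoly φ] TwistedPoly φ :=
  LinearEquiv.ofLinearMap
    (lift (TwistedPoly.C φ).toAddMonoidHom fun a v => map_mul (TwistedPoly.C φ) a v)
    (LinearMap.toSpanSingleton _ _ (unit φ (1 : A)))
    (LinearMap.ext_ring (by
      rw [LinearMap.comp_apply, LinearMap.toSpanSingleton_apply, one_smul, lift_unit]
      exact map_one (TwistedPoly.C φ)))
    (hom_ext fun a => by
      rw [LinearMap.comp_apply, lift_unit]
      change TwistedPoly.C φ a • unit φ (1 : A) = unit φ a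
      rw [← unit_smul, smul_eq_mul, mul_one])

end Ind

end Induction

/-! ### The Euler characteristic of modules induced from modules of finite length -/

section FiniteLength

variable {k : Type v} {A : Type w} [Field k] [CommRing A] [Algebra k A] {φ : A →ₐ[k] A}
  {ε : A →ₐ[k] k}

/-- The ideal generated by the first `j` members of a sequence. -/
def initialIdeal (x : ℕ → A) (j : ℕ) : Ideal A := Ideal.span (x '' Set.Iio j)

lemma initialIdeal_mono (x : ℕ → A) : Monotone (initialIdeal x) := fun _ _ h =>
  Ideal.span_mono (Set.image_mono (Set.Iio_subset_Iio h))

lemma mem_initialIdeal (x : ℕ → A) {i j : ℕ} (h : i < j) : x i ∈ initialIdeal x j :=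
  Ideal.subset_span ⟨i, h, rfl⟩

lemma initialIdeal_zero (x : ℕ → A) : initialIdeal x 0 = ⊥ := by
  rw [initialIdeal, Ideal.span_eq_bot]
  rintro _ ⟨i, hi, rfl⟩
  exact absurd hi (Nat.not_lt_zero i)

lemma initialIdeal_succ (x : ℕ → A) (j : ℕ) :
    initialIdeal x (j + 1) = initialIdeal x j ⊔ Ideal.span {x j} := by
  rw [initialIdeal, initialIdeal, ← Ideal.span_union]
  congr 1
  ext a
  constructor
  · rintro ⟨i, hi, rfl⟩
    rcases (Nat.lt_succ_iff_lt_or_eq.1 hi) with h | rfl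
    · exact Or.inl ⟨i, h, rfl⟩
    · exact Or.inr rfl
  · rintro (⟨i, hi, rfl⟩ | rfl)
    · exact ⟨i, Nat.lt_succ_of_lt hi, rfl⟩
    · exact ⟨j, Nat.lt_succ_self j, rfl⟩

/-- The sequence `x₀, …, x_{d-1}` is weakly regular. -/
def IsRegularUpTo (x : ℕ → A) (d : ℕ) : Prop :=
  ∀ j < d, ∀ a, x j * a ∈ initialIdeal x j → a ∈ initialIdeal x j

lemma isTorFinite_of_subsingleton (M : Type w) [AddCommGroup M] [Module (TwistedPoly φ) M]
    [Subsingleton M] : IsTorFinite φ ε (ModuleCat.of _ M) ∧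
      eulerChar φ ε (ModuleCat.of (TwistedPoly φ) M) = 0 := by
  have hz := ModuleCat.isZero_of_subsingleton (ModuleCat.of (TwistedPoly φ) M)
  have hp : Projective (ModuleCat.of (TwistedPoly φ) M) := hz.projective
  have h : ∀ i, Subsingleton (tor φ ε i (ModuleCat.of (TwistedPoly φ) M)) := fun i => by
    refine ModuleCat.subsingleton_of_isZero ?_
    cases i with
    | zero =>
      have e := asIso ((residue.{w} φ ε).fromLeftDerivedZero.app (ModuleCat.of (TwistedPoly φ) M))
      exact ((residue.{w} φ ε).map_isZero hz).of_iso e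
    | succ i => exact Functor.isZero_leftDerived_obj_projective_succ _ i _
  refine ⟨⟨fun i => have := h i; inferInstance, 0, fun i _ => h i⟩, ?_⟩
  rw [eulerChar_eq_sum (n := 0) fun i _ => h i]
  simp [Module.finrank_zero_of_subsingleton]

/-- Multiplication by `x_j` gives a short exact sequence
`0 → A/(x_i)_{i<j} → A/(x_i)_{i<j} → A/(x_i)_{i≤j} → 0`, which stays exact after induction. Its
first two terms being the same, the Euler characteristic of the third one vanishes. -/
lemma isTorFinite_ind_quotient (hφ : (φ : A →+* A).Flat) {x : ℕ → A} {d : ℕ}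
    (hx : IsRegularUpTo x d) (j : ℕ) (hj : j ≤ d) :
    IsTorFinite φ ε (ModuleCat.of _ (Ind φ (A ⧸ initialIdeal x j))) ∧
      (0 < j → eulerChar φ ε (ModuleCat.of _ (Ind φ (A ⧸ initialIdeal x j))) = 0) := by
  induction j with
  | zero =>
    refine ⟨isTorFinite_self.of_iso (LinearEquiv.toModuleIso ?_), fun h => absurd h (lt_irrefl 0)⟩
    have e : A ≃ₗ[A] A ⧸ initialIdeal x 0 :=
      (Submodule.quotEquivOfEqBot _ (initialIdeal_zero x)).symm
    refine (Ind.selfEquiv φ).symm.trans (LinearEquiv.ofBijective (Ind.map φ e.toLinearMap)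
      ⟨Ind.map_injective hφ e.injective, Ind.map_surjective e.surjective⟩)
  | succ j ih =>
    have ih := (ih (by omega)).1
    let m : (A ⧸ initialIdeal x j) →ₗ[A] A ⧸ initialIdeal x j := LinearMap.lsmul A _ (x j)
    let q : (A ⧸ initialIdeal x j) →ₗ[A] A ⧸ initialIdeal x (j + 1) :=
      Submodule.factor (initialIdeal_mono x (Nat.le_succ j))
    have hm : Function.Injective m := by
      rw [injective_iff_map_eq_zero]
      intro a ha
      obtain ⟨a, rfl⟩ := Submodule.Quotient.mk_surjective _ a
      rw [Submodule.Quotient.mk_eq_zero]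
      exact hx j (by omega) a ((Submodule.Quotient.mk_eq_zero _).1 ha)
    have hq : Function.Surjective q := Submodule.factor_surjective _
    have hmq : Function.Exact m q := by
      intro a
      obtain ⟨a, rfl⟩ := Submodule.Quotient.mk_surjective _ a
      constructor
      · intro h
        have h : a ∈ initialIdeal x (j + 1) := (Submodule.Quotient.mk_eq_zero _).1 h
        rw [initialIdeal_succ, Submodule.mem_sup] at h
        obtain ⟨b, hb, c, hc, rfl⟩ := h
        obtain ⟨c, rfl⟩ := Ideal.mem_span_singleton'.1 hc
        refine ⟨Submodule.Quotient.mk c, ?_⟩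
        refine (Submodule.Quotient.eq _).2 ?_
        rw [show x j • c - (b + c * x j) = -b by rw [smul_eq_mul]; ring]
        exact neg_mem hb
      · rintro ⟨b, hb⟩
        obtain ⟨b, rfl⟩ := Submodule.Quotient.mk_surjective _ b
        rw [← hb]
        exact (Submodule.Quotient.mk_eq_zero _).2
          (Ideal.mul_mem_right _ _ (mem_initialIdeal x (Nat.lt_succ_self j)))
    have h3 := IsTorFinite.third (Ind.map_injective hφ hm) (Ind.map_surjective hq)
      (Ind.map_exact hmq hq) ih ih
    refine ⟨h3, fun _ => ?_⟩
    have := eulerChar_add (Ind.map_injective hφ hm) (Ind.map_surjective hq)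
      (Ind.map_exact hmq hq) ih ih h3
    omega

/-- If the maximal ideal of the local ring `A` is generated by a nonempty regular sequence, modules
induced from `A`-modules of finite length have vanishing Euler characteristic. -/
lemma isTorFinite_ind_of_isFiniteLength [IsLocalRing A] (hφ : (φ : A →+* A).Flat) {x : ℕ → A}
    {d : ℕ} (hd : 0 < d) (hx : IsRegularUpTo x d) (hm : initialIdeal x d = RingHom.ker ε)
    {V : Type w} [AddCommGroup V] [Module A V] (hV : IsFiniteLength A V) :
    IsTorFinite φ ε (ModuleCat.of _ (Ind φ V)) ∧
      eulerChar φ ε (ModuleCat.of _ (Ind φ V)) = 0 := by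
  induction hV with
  | @of_subsingleton M _ _ _ =>
    have : Subsingleton (Ind φ M) := by
      refine ⟨fun a b => ?_⟩
      have key : ∀ c : Ind φ M, c = 0 := fun c => by
        induction c using TensorProduct.induction_on with
        | zero => rfl
        | add x y hx hy => rw [hx, hy, add_zero]
        | tmul r v => rw [Subsingleton.elim v 0, TensorProduct.tmul_zero]
      rw [key a, key b]
    exact isTorFinite_of_subsingleton _
  | @of_simple_quotient M _ _ N _ _ ih =>
    have hfg : Function.Exact N.subtype N.mkQ := LinearMap.exact_subtype_mkQ N
    -- The augmentation ideal is the only maximal ideal, so `M ⧸ N` is isomorphic to `A ⧸ ker ε`.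
    have key : Nonempty ((M ⧸ N) ≃ₗ[A] A ⧸ initialIdeal x d) := by
      obtain ⟨I, hI, ⟨e⟩⟩ := (isSimpleModule_iff_quot_maximal (R := A) (M := M ⧸ N)).1 inferInstance
      have hmax : (RingHom.ker ε).IsMaximal :=
        RingHom.ker_isMaximal_of_surjective _ fun c => ⟨algebraMap k A c, by simp⟩
      rw [hm, IsLocalRing.eq_maximalIdeal hmax, ← IsLocalRing.eq_maximalIdeal hI]
      exact ⟨e⟩
    obtain ⟨e⟩ := key
    have e' := LinearEquiv.ofBijective (Ind.map φ e.symm.toLinearMap)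
      ⟨Ind.map_injective hφ e.symm.injective, Ind.map_surjective e.symm.surjective⟩
    obtain ⟨h₃, h₃'⟩ := isTorFinite_ind_quotient (ε := ε) hφ hx d le_rfl
    replace h₃' := (eulerChar_of_iso (ε := ε) e'.toModuleIso).symm.trans (h₃' hd)
    replace h₃ := h₃.of_iso e'.toModuleIso
    have i1 := Ind.map_injective hφ N.injective_subtype
    have i2 := Ind.map_surjective (φ := φ) N.mkQ_surjective
    have i3 := Ind.map_exact (φ := φ) hfg N.mkQ_surjective
    have h₂ := IsTorFinite.second i1 i2 i3 ih.1 h₃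
    exact ⟨h₂, by rw [eulerChar_add i1 i2 i3 ih.1 h₂ h₃, ih.2, h₃', add_zero]⟩

end FiniteLength

/-! ### Resolutions of finitely presented modules by induced modules -/

section Frobenius

open RightPoly

variable {k A : Type*} [Field k] [CommRing A] [Algebra k A] (φ : A →ₐ[k] A)

/-- A copy of the ring `A`, over which `A` is an algebra through `φ`. -/
def FrobBase (_φ : A →ₐ[k] A) : Type _ := A

instance : CommRing (FrobBase φ) := inferInstanceAs (CommRing A)

instance : Algebra (FrobBase φ) A := (φ : A →+* A).toAlgebra

/-- A copy of the `A`-module `V`, seen as a module over the copy `FrobBase φ` of `A`. -/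
def FrobMod (_φ : A →ₐ[k] A) (V : Type*) : Type _ := V

variable (V : Type*) [AddCommGroup V] [Module A V]

instance : AddCommGroup (FrobMod φ V) := inferInstanceAs (AddCommGroup V)

instance : Module (FrobBase φ) (FrobMod φ V) := inferInstanceAs (Module A V)

/-- The `A`-module `A ⊗_{φ, A} V`. -/
abbrev Frob : Type _ := A ⊗[FrobBase φ] FrobMod φ V

variable {V} in
/-- The element `a ⊗ v` of `A ⊗_{φ, A} V`. -/
def Frob.tmul (a : A) (v : V) : Frob φ V := a ⊗ₜ[FrobBase φ] (show FrobMod φ V from v)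

variable {φ V}

lemma Frob.tmul_smul (a b : A) (v : V) : Frob.tmul φ a (b • v) = Frob.tmul φ (a * φ b) v :=
  (TensorProduct.smul_tmul (show FrobBase φ from b) a (show FrobMod φ V from v)).symm.trans
    (congrArg (Frob.tmul φ · v) (mul_comm (φ b) a))

@[elab_as_elim]
lemma Frob.induction_on {P : Frob φ V → Prop} (x : Frob φ V) (zero : P 0)
    (add : ∀ x y, P x → P y → P (x + y)) (tmul : ∀ (a : A) (v : V), P (Frob.tmul φ a v)) : P x :=
  TensorProduct.induction_on x zero tmul add

lemma isFiniteLength_frob (hφ : (φ : A →+* A).Finite) (hV : IsFiniteLength A V) :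
    IsFiniteLength A (Frob φ V) := by
  have hfin : Module.Finite (FrobBase φ) A := hφ
  have hV' : IsFiniteLength (FrobBase φ) (FrobMod φ V) := hV
  rw [isFiniteLength_iff_isNoetherian_isArtinian] at hV' ⊢
  obtain ⟨h₁, h₂⟩ := hV'
  obtain ⟨n, s, hs⟩ := Module.Finite.exists_fin (R := FrobBase φ) (M := A)
  let F : (Fin n → FrobMod φ V) →ₗ[FrobBase φ] Frob φ V :=
    ∑ i, (TensorProduct.mk (FrobBase φ) A (FrobMod φ V) (s i)).comp (LinearMap.proj i)
  have hF : Function.Surjective F := by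
    rw [← LinearMap.range_eq_top, eq_top_iff, ← TensorProduct.span_tmul_eq_top, Submodule.span_le]
    rintro _ ⟨a, v, rfl⟩
    have ha : a ∈ Submodule.span (FrobBase φ) (Set.range s) := hs ▸ Submodule.mem_top
    obtain ⟨c, rfl⟩ := (Submodule.mem_span_range_iff_exists_fun _).1 ha
    refine ⟨fun i => c i • v, ?_⟩
    simp only [F, LinearMap.sum_apply, LinearMap.comp_apply, LinearMap.proj_apply,
      TensorProduct.mk_apply, TensorProduct.sum_tmul, TensorProduct.smul_tmul]
  have : IsNoetherian (FrobBase φ) (Frob φ V) :=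
    isNoetherian_of_surjective F (LinearMap.range_eq_top.2 hF)
  have : IsArtinian (FrobBase φ) (Frob φ V) := isArtinian_of_surjective _ F hF
  exact ⟨isNoetherian_of_tower (FrobBase φ) inferInstance,
    isArtinian_of_tower (FrobBase φ) inferInstance⟩

variable (φ V) in
/-- The inclusion of `A ⊗_{φ, A} V` as the homogeneous part of degree one of the induced module:
`a ⊗ v ↦ aX ⊗ v`. -/
def Frob.incl : Frob φ V →+ Ind φ V :=
  TensorProduct.liftAddHom (R := FrobBase φ)
    (((smulAddHom (TwistedPoly φ) (Ind φ V)).flip.comp (Ind.unit φ)).flip.comp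
      ((AddMonoidHom.mulRight (TwistedPoly.X φ)).comp (TwistedPoly.C φ).toAddMonoidHom))
    (fun a b v => by
      change (TwistedPoly.C φ (φ (show A from a) * b) * TwistedPoly.X φ) •
        Ind.unit φ (show V from v)
        = (TwistedPoly.C φ b * TwistedPoly.X φ) • Ind.unit φ ((show A from a) • (show V from v))
      rw [Ind.unit_smul, smul_smul, mul_assoc (TwistedPoly.C φ b), TwistedPoly.X_mul_C, ← mul_assoc,
        ← map_mul, mul_comm])

lemma Frob.incl_tmul (a : A) (v : V) : Frob.incl φ V (Frob.tmul φ a v) =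
    (TwistedPoly.C φ a * TwistedPoly.X φ) • Ind.unit φ v := rfl

lemma Frob.smul_tmul (a b : A) (v : V) : a • Frob.tmul φ b v = Frob.tmul φ (a * b) v := rfl

lemma Frob.incl_smul (a : A) (x : Frob φ V) :
    Frob.incl φ V (a • x) = TwistedPoly.C φ a • Frob.incl φ V x := by
  induction x using Frob.induction_on with
  | zero => rw [smul_zero, map_zero, smul_zero]
  | add x y hx hy => rw [smul_add, map_add, map_add, hx, hy, smul_add]
  | tmul b v => rw [smul_tmul, incl_tmul, incl_tmul, map_mul, mul_assoc, smul_smul]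

variable (φ) in
/-- The left inverse of right multiplication by `X`, which drops the constant coefficient. -/
def TwistedPoly.divX : TwistedPoly φ →+ TwistedPoly φ :=
  AddMonoidHom.mk' (fun r => SkewPolynomial.sum (R := WithEndo φ) r fun n a =>
      if n = 0 then 0 else SkewPolynomial.monomial (n - 1) a)
    fun r s => SkewPolynomial.sum_add_index r s _ (fun i => by split_ifs <;> simp)
      (fun i a b => by split_ifs <;> simp)

lemma TwistedPoly.divX_C_mul_X_pow (n : ℕ) (a : A) :
    divX φ (C φ a * X φ ^ n) = if n = 0 then 0 else C φ a * X φ ^ (n - 1) := by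
  rw [← monomial_eq, ← monomial_eq]
  exact SkewPolynomial.sum_monomial_index
    (h := fun n a => if n = 0 then 0 else SkewPolynomial.monomial (n - 1) a) (by split_ifs <;> simp)

lemma TwistedPoly.divX_mul_X (r : TwistedPoly φ) : divX φ (r * X φ) = r := by
  induction r using TwistedPoly.induction with
  | zero => rw [zero_mul, map_zero]
  | add r s hr hs => rw [add_mul, map_add, hr, hs]
  | C_mul_X_pow n a =>
    rw [mul_assoc, ← pow_succ, divX_C_mul_X_pow, if_neg (Nat.succ_ne_zero n), Nat.add_sub_cancel]

lemma TwistedPoly.divX_mul_C (r : TwistedPoly φ) (a : A) :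
    divX φ (r * C φ a) = divX φ r * C φ (φ a) := by
  induction r using TwistedPoly.induction with
  | zero => rw [zero_mul, map_zero, zero_mul]
  | add r s hr hs => rw [add_mul, map_add, map_add, hr, hs, add_mul]
  | C_mul_X_pow n b =>
    rw [mul_assoc, X_pow_mul_C, ← mul_assoc, ← map_mul, divX_C_mul_X_pow, divX_C_mul_X_pow]
    split_ifs with h
    · rw [zero_mul]
    · obtain ⟨m, rfl⟩ := Nat.exists_eq_succ_of_ne_zero h
      rw [Nat.succ_sub_one, mul_assoc, X_pow_mul_C, ← mul_assoc, ← map_mul, pow_succ]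
      rfl

variable (φ V) in
/-- The map `A[X]_φ ⊗_A (A ⊗_{φ, A} V) → A[X]_φ ⊗_A V` extending the inclusion of the homogeneous
part of degree one. -/
def Frob.indIncl : Ind φ (Frob φ V) →ₗ[TwistedPoly φ] Ind φ V :=
  Ind.lift (Frob.incl φ V) Frob.incl_smul

lemma Frob.indIncl_injective : Function.Injective (Frob.indIncl φ V) := by
  -- A left inverse: `r ⊗ v ↦ r' ⊗ (1 ⊗ v)`, where `r'` is the polynomial `r` with its constant term
  -- dropped and the others divided by `X` on the right.
  let ρ : Ind φ V →+ Ind φ (Frob φ V) := TensorProduct.liftAddHom (R := A)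
    (((smulAddHom (TwistedPoly φ) (Ind φ (Frob φ V))).flip.comp ((Ind.unit φ).comp
      (TensorProduct.mk (FrobBase φ) A (FrobMod φ V) 1).toAddMonoidHom)).flip.comp
        ((TwistedPoly.divX φ).comp (of φ).symm.toAddMonoidHom))
    (fun a r v => by
      obtain ⟨r, rfl⟩ := (of φ).surjective r
      change TwistedPoly.divX φ ((of φ).symm (a • of φ r)) • Ind.unit φ (Frob.tmul φ 1 v) =
        TwistedPoly.divX φ ((of φ).symm (of φ r)) • Ind.unit φ (Frob.tmul φ 1 (a • v))
      rw [smul_of, LinearEquiv.symm_apply_apply, LinearEquiv.symm_apply_apply,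
        TwistedPoly.divX_mul_C, Frob.tmul_smul, mul_smul, ← Ind.unit_smul, Frob.smul_tmul,
        mul_comm])
  have hρ : ∀ (r : TwistedPoly φ) (v : V),
      ρ (r • Ind.unit φ v) = TwistedPoly.divX φ r • Ind.unit φ (Frob.tmul φ 1 v) := by
    intro r v
    rw [← Ind.tmul_eq]
    rfl
  refine Function.LeftInverse.injective (g := ρ) fun x => ?_
  induction x using Ind.induction_on with
  | zero => rw [map_zero, map_zero]
  | add x y hx hy => rw [map_add, map_add, hx, hy]
  | smul_unit r x =>
    rw [map_smul, Frob.indIncl, Ind.lift_unit]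
    induction x using Frob.induction_on with
    | zero => rw [map_zero, map_zero, smul_zero, smul_zero, map_zero]
    | add x y hx hy => rw [map_add, smul_add, map_add, hx, hy, ← smul_add, ← map_add]
    | tmul a v =>
      rw [Frob.incl_tmul, smul_smul, ← mul_assoc, hρ, TwistedPoly.divX_mul_X, mul_smul,
        ← Ind.unit_smul, Frob.smul_tmul, mul_one]

end Frobenius

section Grading

open RightPoly

variable {k A : Type*} [Field k] [CommRing A] [Algebra k A] {φ : A →ₐ[k] A}
  {V W : Type*} [AddCommGroup V] [Module A V] [AddCommGroup W] [Module A W]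

variable (φ V) in
/-- The projection of an induced module onto its homogeneous part of degree `n`. -/
def Ind.part (n : ℕ) : Ind φ V →+ Ind φ V :=
  (LinearMap.rTensor V (homogeneousPart φ n)).toAddMonoidHom

lemma Ind.part_smul_unit (n : ℕ) (r : TwistedPoly φ) (v : V) : Ind.part φ V n (r • Ind.unit φ v) =
    (TwistedPoly.C φ (TwistedPoly.coeffHom φ n r) * TwistedPoly.X φ ^ n) • Ind.unit φ v := by
  rw [← Ind.tmul_eq, ← Ind.tmul_eq]
  rfl

lemma Ind.part_map (n : ℕ) (f : V →ₗ[A] W) (x : Ind φ V) :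
    Ind.part φ W n (Ind.map φ f x) = Ind.map φ f (Ind.part φ V n x) := by
  induction x using Ind.induction_on with
  | zero => simp only [map_zero]
  | add x y hx hy => simp only [map_add, hx, hy]
  | smul_unit r v =>
    have h : Ind.map φ f (Ind.unit φ v) = Ind.unit φ (f v) := Ind.lift_unit _ _ v
    rw [Ind.part_smul_unit, map_smul (Ind.map φ f), map_smul (Ind.map φ f), h, Ind.part_smul_unit]

lemma Ind.part_succ_indIncl (n : ℕ) (x : Ind φ (Frob φ V)) :
    Ind.part φ V (n + 1) (Frob.indIncl φ V x) =
      Frob.indIncl φ V (Ind.part φ (Frob φ V) n x) := by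
  induction x using Ind.induction_on with
  | zero => simp only [map_zero]
  | add x y hx hy => simp only [map_add, hx, hy]
  | smul_unit r x =>
    rw [Ind.part_smul_unit, map_smul (Frob.indIncl φ V), map_smul (Frob.indIncl φ V),
      Frob.indIncl, Ind.lift_unit]
    induction x using Frob.induction_on with
    | zero => simp only [map_zero, smul_zero]
    | add x y hx hy => simp only [map_add, smul_add, hx, hy]
    | tmul a v =>
      rw [Frob.incl_tmul, smul_smul, smul_smul, ← mul_assoc, Ind.part_smul_unit,
        TwistedPoly.coeffHom_succ_mul_X, TwistedPoly.coeffHom_mul_C, map_mul, pow_succ,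
        mul_assoc (TwistedPoly.C φ _) (TwistedPoly.X φ ^ n), ← mul_assoc (TwistedPoly.X φ ^ n),
        TwistedPoly.X_pow_mul_C]
      simp only [mul_assoc]

/-- An element of an induced module is the sum of its homogeneous parts, almost all of which
vanish. -/
lemma Ind.exists_eq_sum_part (x : Ind φ V) : ∃ N, (∀ n, N ≤ n → Ind.part φ V n x = 0) ∧
    x = ∑ n ∈ Finset.range N, Ind.part φ V n x := by
  have h : ∃ N, (∀ n, N ≤ n → Ind.part φ V n x = 0) ∧
      ∀ m, N ≤ m → x = ∑ n ∈ Finset.range m, Ind.part φ V n x := by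
    induction x using Ind.induction_on with
    | zero => exact ⟨0, by simp⟩
    | add x y hx hy =>
      obtain ⟨N, h₁, h₂⟩ := hx
      obtain ⟨N', h₁', h₂'⟩ := hy
      refine ⟨N + N', fun n hn => ?_, fun m hm => ?_⟩
      · rw [map_add, h₁ n (by omega), h₁' n (by omega), add_zero]
      · simp only [map_add, Finset.sum_add_distrib]
        rw [← h₂ m (by omega), ← h₂' m (by omega)]
    | smul_unit r v =>
      obtain ⟨N, hN⟩ := TwistedPoly.exists_coeffHom_eq_zero r
      refine ⟨N, fun n hn => ?_, fun m hm => ?_⟩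
      · rw [Ind.part_smul_unit, hN n hn, map_zero, zero_mul, zero_smul]
      · simp only [Ind.part_smul_unit]
        rw [← Finset.sum_smul, ← TwistedPoly.sum_coeffHom fun n hn => hN n (hm.trans hn)]
  obtain ⟨N, h₁, h₂⟩ := h
  exact ⟨N, h₁, h₂ N le_rfl⟩

/-- A map of induced modules which is the difference of an injective homogeneous map of degree one
and a homogeneous map of degree zero is injective: look at the component of highest degree. -/
lemma Ind.injective_of_part {γ δ : Ind φ V →ₗ[TwistedPoly φ] Ind φ W} (hγ : Function.Injective γ)
    (h₁ : ∀ n x, Ind.part φ W (n + 1) (γ x) = γ (Ind.part φ V n x))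
    (h₀ : ∀ n x, Ind.part φ W n (δ x) = δ (Ind.part φ V n x)) : Function.Injective (γ - δ) := by
  rw [injective_iff_map_eq_zero]
  intro x hx
  rw [LinearMap.sub_apply, sub_eq_zero] at hx
  obtain ⟨N, hN, hsum⟩ := Ind.exists_eq_sum_part x
  -- Descending induction on the degree.
  have key : ∀ m, m ≤ N → ∀ n, N ≤ n + m → Ind.part φ V n x = 0 := by
    intro m
    induction m with
    | zero => exact fun _ n hn => hN n hn
    | succ m ih =>
      intro hm n hn
      refine hγ ?_
      rw [← h₁, hx, h₀, ih (by omega) (n + 1) (by omega), map_zero, map_zero]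
  rw [hsum]
  exact Finset.sum_eq_zero fun n _ => key N le_rfl n (by omega)

end Grading

section Presentation

variable {k A : Type*} [Field k] [CommRing A] [Algebra k A] {φ : A →ₐ[k] A}
  {M : Type*} [AddCommGroup M] [Module A M] [Module (TwistedPoly φ) M]
  (hM : ∀ (a : A) (m : M), TwistedPoly.C φ a • m = a • m)

/-- The map `A[X]_φ ⊗_A M₀ → M` attached to an `A`-submodule `M₀` of an `A[X]_φ`-module `M`. -/
def Ind.act (M₀ : Submodule A M) : Ind φ M₀ →ₗ[TwistedPoly φ] M :=
  Ind.lift M₀.subtype.toAddMonoidHom fun a m => (hM a m).symm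

lemma Ind.act_unit (M₀ : Submodule A M) (m : M₀) : Ind.act hM M₀ (Ind.unit φ m) = m :=
  Ind.lift_unit _ _ m

/-- The `A`-submodule of `A ⊗_{φ, A} M₀` of the elements `∑ aᵢ ⊗ mᵢ` such that `∑ aᵢ X mᵢ ∈ M₀`. -/
def relations (M₀ : Submodule A M) : Submodule A (Frob φ M₀) where
  carrier := {x | Ind.act hM M₀ (Frob.incl φ M₀ x) ∈ M₀}
  add_mem' hx hy := by
    simp only [Set.mem_ofPred_eq, map_add] at hx hy ⊢
    exact M₀.add_mem hx hy
  zero_mem' := by simp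
  smul_mem' a x hx := by
    simp only [Set.mem_ofPred_eq, Frob.incl_smul, map_smul] at hx ⊢
    rw [hM]
    exact M₀.smul_mem a hx

/-- The map `∑ aᵢ ⊗ mᵢ ↦ ∑ aᵢ X mᵢ` from `relations hM M₀` to `M₀`. -/
def relationsMap (M₀ : Submodule A M) : relations hM M₀ →ₗ[A] M₀ where
  toFun x := ⟨Ind.act hM M₀ (Frob.incl φ M₀ x), x.2⟩
  map_add' x y := Subtype.ext (by simp)
  map_smul' a x := Subtype.ext (by
    change Ind.act hM M₀ (Frob.incl φ M₀ (a • x.1)) = a • Ind.act hM M₀ (Frob.incl φ M₀ x.1)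
    rw [Frob.incl_smul, map_smul, hM])

/-- The map of induced modules `r ⊗ ∑ aᵢ ⊗ mᵢ ↦ ∑ r aᵢ X ⊗ mᵢ - r ⊗ ∑ aᵢ X mᵢ`, whose image consists
of the relations of degree one between the elements of `M₀`. -/
def relationsInd (M₀ : Submodule A M) : Ind φ (relations hM M₀) →ₗ[TwistedPoly φ] Ind φ M₀ :=
  (Frob.indIncl φ M₀).comp (Ind.map φ (relations hM M₀).subtype) -
    Ind.map φ (relationsMap hM M₀)

lemma relationsInd_unit (M₀ : Submodule A M) (x : relations hM M₀) :
    relationsInd hM M₀ (Ind.unit φ x) =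
      Frob.incl φ M₀ x - Ind.unit φ (relationsMap hM M₀ x) := by
  have h₁ : Ind.map φ (relations hM M₀).subtype (Ind.unit φ x) = Ind.unit φ (x : Frob φ M₀) :=
    Ind.lift_unit _ _ x
  have h₂ : Ind.map φ (relationsMap hM M₀) (Ind.unit φ x) = Ind.unit φ (relationsMap hM M₀ x) :=
    Ind.lift_unit _ _ x
  rw [relationsInd, LinearMap.sub_apply, LinearMap.comp_apply, h₁, h₂, Frob.indIncl,
    Ind.lift_unit]

lemma relationsInd_injective (hφ : (φ : A →+* A).Flat) (M₀ : Submodule A M) :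
    Function.Injective (relationsInd hM M₀) := by
  refine Ind.injective_of_part (Frob.indIncl_injective.comp
    (Ind.map_injective hφ (relations hM M₀).injective_subtype)) (fun n x => ?_)
    fun n x => Ind.part_map n _ x
  rw [LinearMap.comp_apply, LinearMap.comp_apply, Ind.part_succ_indIncl, Ind.part_map]

lemma act_relationsInd (M₀ : Submodule A M) (x : Ind φ (relations hM M₀)) :
    Ind.act hM M₀ (relationsInd hM M₀ x) = 0 := by
  induction x using Ind.induction_on with
  | zero => simp
  | add x y hx hy => rw [map_add, map_add, hx, hy, add_zero]
  | smul_unit r x =>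
    rw [map_smul, map_smul, relationsInd_unit, map_sub, Ind.act_unit, relationsMap]
    simp

/-- The elements `∑_{i ≤ n} aᵢ Xⁱ ⊗ mᵢ` of degree at most `n` of an induced module. -/
def Ind.degreeLE (φ : A →ₐ[k] A) (V : Type*) [AddCommGroup V] [Module A V] (n : ℕ) :
    AddSubgroup (Ind φ V) :=
  AddSubgroup.closure {z | ∃ (a : A) (i : ℕ) (v : V), i ≤ n ∧
    z = (TwistedPoly.C φ a * TwistedPoly.X φ ^ i) • Ind.unit φ v}

lemma Ind.degreeLE_mono (V : Type*) [AddCommGroup V] [Module A V] :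
    Monotone (Ind.degreeLE φ V) := fun _ _ h =>
  AddSubgroup.closure_mono fun _ ⟨a, i, v, hi, hz⟩ => ⟨a, i, v, hi.trans h, hz⟩

lemma Ind.exists_mem_degreeLE {V : Type*} [AddCommGroup V] [Module A V] (x : Ind φ V) :
    ∃ n, x ∈ Ind.degreeLE φ V n := by
  induction x using Ind.induction_on with
  | zero => exact ⟨0, zero_mem _⟩
  | add x y hx hy =>
    obtain ⟨m, hm⟩ := hx
    obtain ⟨n, hn⟩ := hy
    exact ⟨m + n, add_mem (Ind.degreeLE_mono V (Nat.le_add_right m n) hm)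
      (Ind.degreeLE_mono V (Nat.le_add_left n m) hn)⟩
  | smul_unit r v =>
    induction r using TwistedPoly.induction with
    | zero => exact ⟨0, by rw [zero_smul]; exact zero_mem _⟩
    | add r s hr hs =>
      obtain ⟨m, hm⟩ := hr
      obtain ⟨n, hn⟩ := hs
      refine ⟨m + n, ?_⟩
      rw [add_smul]
      exact add_mem (Ind.degreeLE_mono V (Nat.le_add_right m n) hm)
        (Ind.degreeLE_mono V (Nat.le_add_left n m) hn)
    | C_mul_X_pow n a => exact ⟨n, AddSubgroup.subset_closure ⟨a, n, v, le_rfl, rfl⟩⟩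

/-- Let `M'` be an `A`-submodule which generates `M` over `A[X]_φ`, such that the kernel of
`A[X]_φ ⊗_A M' → M` is generated in degrees at most `n`. If `M₀` is the `A`-submodule generated by
the `Xⁱ M'` for `i ≤ n`, then all relations between the elements of `M₀` follow from the linear
ones. -/
lemma exact_relationsInd {M' M₀ : Submodule A M} {n : ℕ} {S : Set (Ind φ M')}
    (hS : S ⊆ Ind.degreeLE φ M' n)
    (hker : LinearMap.ker (Ind.act hM M') = Submodule.span (TwistedPoly φ) S)
    (hM₀ : M₀ = Submodule.span A {m | ∃ i ≤ n, ∃ m' ∈ M', m = TwistedPoly.X φ ^ i • m'}) :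
    Function.Exact (relationsInd hM M₀) (Ind.act hM M₀) := by
  have hmem : ∀ i ≤ n, ∀ m ∈ M', TwistedPoly.X φ ^ i • m ∈ M₀ := fun i hi m hm =>
    hM₀ ▸ Submodule.subset_span ⟨i, hi, m, hm, rfl⟩
  have hle : M' ≤ M₀ := fun m hm => by simpa using hmem 0 (Nat.zero_le n) m hm
  let N := LinearMap.range (relationsInd hM M₀)
  let c : M₀ →+ (Ind φ M₀ ⧸ N) := N.mkQ.toAddMonoidHom.comp (Ind.unit φ)
  have hca : ∀ (a : A) (m : M₀), c (a • m) = TwistedPoly.C φ a • c m := fun a m => by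
    change N.mkQ _ = TwistedPoly.C φ a • N.mkQ _
    rw [Ind.unit_smul, map_smul]
  -- The relation `X ⊗ m = 1 ⊗ Xm` holds in the quotient as soon as it makes sense.
  have hX : ∀ (m : M₀) (h : TwistedPoly.X φ • (m : M) ∈ M₀),
      TwistedPoly.X φ • c m = c ⟨_, h⟩ := by
    intro m h
    have hincl : Frob.incl φ M₀ (Frob.tmul φ 1 m) = TwistedPoly.X φ • Ind.unit φ m := by
      rw [Frob.incl_tmul, map_one, one_mul]
    have hact : Ind.act hM M₀ (Frob.incl φ M₀ (Frob.tmul φ 1 m)) = TwistedPoly.X φ • (m : M) := by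
      rw [hincl, map_smul, Ind.act_unit]
    let x : relations hM M₀ := ⟨Frob.tmul φ 1 m, by
      change Ind.act hM M₀ _ ∈ M₀
      rwa [hact]⟩
    have hx : relationsMap hM M₀ x = ⟨_, h⟩ := Subtype.ext hact
    have : TwistedPoly.X φ • Ind.unit φ m - Ind.unit φ (⟨_, h⟩ : M₀) ∈ N :=
      ⟨Ind.unit φ x, by rw [relationsInd_unit, hx, ← hincl]⟩
    have := (Submodule.Quotient.eq N).2 this
    exact this
  have hXi : ∀ i (hi : i ≤ n) (m : M) (hm : m ∈ M'),
      TwistedPoly.X φ ^ i • c ⟨m, hle hm⟩ = c ⟨_, hmem i hi m hm⟩ := by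
    intro i
    induction i with
    | zero => intro _ m hm; simp
    | succ i ih =>
      intro hi m hm
      have e : TwistedPoly.X φ • TwistedPoly.X φ ^ i • m = TwistedPoly.X φ ^ (i + 1) • m := by
        rw [← mul_smul, ← pow_succ']
      have e' : TwistedPoly.X φ ^ (i + 1) • c ⟨m, hle hm⟩ =
          TwistedPoly.X φ • c ⟨_, hmem i (by omega) m hm⟩ := by
        rw [← ih (by omega) m hm, ← mul_smul, ← pow_succ']
      rw [e']
      exact (hX _ (e ▸ hmem (i + 1) hi m hm)).trans (congrArg c (Subtype.ext e))
  let g : Ind φ M' →ₗ[TwistedPoly φ] (Ind φ M₀ ⧸ N) :=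
    N.mkQ.comp (Ind.map φ (Submodule.inclusion hle))
  have hgu : ∀ m : M', g (Ind.unit φ m) = c ⟨m, hle m.2⟩ := fun m =>
    congrArg N.mkQ (Ind.lift_unit _ _ m)
  -- In degrees at most `n`, the map `g` factors through the map to `M₀`.
  have hdeg : ∀ z ∈ Ind.degreeLE φ M' n, ∃ m₀ : M₀, g z = c m₀ ∧ Ind.act hM M' z = m₀ := by
    intro z hz
    induction hz using AddSubgroup.closure_induction with
    | mem z hz =>
      obtain ⟨a, i, m, hi, rfl⟩ := hz
      refine ⟨a • ⟨_, hmem i hi m m.2⟩, ?_, ?_⟩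
      · rw [map_smul, hgu, mul_smul, hXi i hi m m.2, hca]
      · rw [map_smul, Ind.act_unit, mul_smul, hM]
        rfl
    | zero => exact ⟨0, by simp, by simp⟩
    | add x y _ _ hx hy =>
      obtain ⟨m, h₁, h₂⟩ := hx
      obtain ⟨m', h₁', h₂'⟩ := hy
      exact ⟨m + m', by rw [map_add, map_add, h₁, h₁'], by rw [map_add, h₂, h₂']; rfl⟩
    | neg x _ hx =>
      obtain ⟨m, h₁, h₂⟩ := hx
      exact ⟨-m, by rw [map_neg, map_neg, h₁], by rw [map_neg, h₂]; rfl⟩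
  have hgker : LinearMap.ker (Ind.act hM M') ≤ LinearMap.ker g := by
    rw [hker, Submodule.span_le]
    intro z hz
    obtain ⟨m₀, h₁, h₂⟩ := hdeg z (hS hz)
    have hz' : Ind.act hM M' z = 0 := by
      have : z ∈ LinearMap.ker (Ind.act hM M') := hker ▸ Submodule.subset_span hz
      exact this
    have : m₀ = 0 := Subtype.ext (h₂.symm.trans hz')
    change g z = 0
    rw [h₁, this, map_zero]
  have hgsurj : Function.Surjective g := by
    have hc : ∀ m : M₀, c m ∈ LinearMap.range g := by
      have : ∀ (m : M) (hm : m ∈ Submodule.span A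
          {m | ∃ i ≤ n, ∃ m' ∈ M', m = TwistedPoly.X φ ^ i • m'}) (h : m ∈ M₀),
          c ⟨m, h⟩ ∈ LinearMap.range g := by
        intro m hm
        induction hm using Submodule.span_induction with
        | mem m hm =>
          obtain ⟨i, hi, m', hm', rfl⟩ := hm
          intro h
          rw [← hXi i hi m' hm', ← hgu ⟨m', hm'⟩]
          exact Submodule.smul_mem _ _ ⟨_, rfl⟩
        | zero =>
          intro h
          exact (map_zero c : c ⟨0, h⟩ = 0) ▸ zero_mem _
        | add x y hx hy ihx ihy =>
          intro h
          have e : c ⟨x + y, h⟩ = c ⟨x, hM₀ ▸ hx⟩ + c ⟨y, hM₀ ▸ hy⟩ := (map_add c _ _).symm ▸ rfl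
          rw [e]
          exact add_mem (ihx _) (ihy _)
        | smul a x hx ih =>
          intro h
          have e : c ⟨a • x, h⟩ = TwistedPoly.C φ a • c ⟨x, hM₀ ▸ hx⟩ := (hca a _).symm ▸ rfl
          rw [e]
          exact Submodule.smul_mem _ _ (ih _)
      intro m
      exact this m (hM₀ ▸ m.2) m.2
    intro x
    obtain ⟨x, rfl⟩ := N.mkQ_surjective x
    induction x using Ind.induction_on with
    | zero => exact ⟨0, by simp⟩
    | add x y hx hy =>
      obtain ⟨a, ha⟩ := hx
      obtain ⟨b, hb⟩ := hy
      exact ⟨a + b, by rw [map_add, map_add, ha, hb]⟩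
    | smul_unit r m =>
      obtain ⟨z, hz⟩ := hc m
      exact ⟨r • z, by rw [map_smul, map_smul, hz]; rfl⟩
  intro y
  constructor
  · intro hy
    obtain ⟨z, hz⟩ := hgsurj (N.mkQ y)
    have hd : Ind.map φ (Submodule.inclusion hle) z - y ∈ N := (Submodule.Quotient.eq N).1 hz
    have h0 : Ind.act hM M₀ (Ind.map φ (Submodule.inclusion hle) z - y) = 0 := by
      obtain ⟨t, ht⟩ := hd
      rw [← ht, act_relationsInd]
    have h1 : Ind.act hM M₀ ∘ₗ Ind.map φ (Submodule.inclusion hle) = Ind.act hM M' :=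
      Ind.hom_ext fun m => by
        have : Ind.map φ (Submodule.inclusion hle) (Ind.unit φ m) = _ := Ind.lift_unit _ _ m
        rw [LinearMap.comp_apply, this, Ind.act_unit]
        exact Ind.act_unit hM M₀ _
    have h2 : Ind.act hM M' z = 0 := by
      rw [map_sub, hy, sub_zero] at h0
      rw [← h1]
      exact h0
    have h3 : N.mkQ y = 0 := hz ▸ hgker h2
    rw [← LinearMap.mem_ker, Submodule.ker_mkQ] at h3
    exact h3
  · rintro ⟨x, rfl⟩
    exact act_relationsInd hM M₀ x

include hM in
/-- A finitely presented `A[X]_φ`-module all of whose finitely generated `A`-submodules have finite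
length is the cokernel of an injection between modules induced from `A`-modules of finite length. -/
theorem exists_ind_resolution (hφ : (φ : A →+* A).Flat) (hφ' : (φ : A →+* A).Finite)
    [Module.FinitePresentation (TwistedPoly φ) M]
    (hlen : ∀ N : Submodule A M, N.FG → IsFiniteLength A N) :
    ∃ (M₀ : Submodule A M) (N : Submodule A (Frob φ M₀)) (f : Ind φ N →ₗ[TwistedPoly φ] Ind φ M₀)
      (g : Ind φ M₀ →ₗ[TwistedPoly φ] M), IsFiniteLength A M₀ ∧ IsFiniteLength A N ∧
        Function.Injective f ∧ Function.Surjective g ∧ Function.Exact f g := by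
  classical
  -- `M'` is generated over `A` by generators `s` of the `A[X]_φ`-module `M`, the relations between
  -- which are generated in degrees at most `n`.
  obtain ⟨s, hs⟩ : (⊤ : Submodule (TwistedPoly φ) M).FG := Module.Finite.fg_top
  let M' : Submodule A M := Submodule.span A (s : Set M)
  have hsurj : ∀ M₁ : Submodule A M, (s : Set M) ⊆ M₁ → Function.Surjective (Ind.act hM M₁) := by
    intro M₁ h
    rw [← LinearMap.range_eq_top, eq_top_iff, ← hs, Submodule.span_le]
    exact fun m hm => ⟨Ind.unit φ ⟨m, h hm⟩, Ind.act_unit hM M₁ _⟩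
  have hfin : Module.Finite (TwistedPoly φ) (Ind φ M') := by
    refine ⟨⟨s.attach.image fun m => Ind.unit φ ⟨m.1, Submodule.subset_span m.2⟩, ?_⟩⟩
    rw [eq_top_iff]
    rintro x -
    have key : ∀ (m : M) (hm : m ∈ M'), Ind.unit φ (⟨m, hm⟩ : M') ∈ Submodule.span (TwistedPoly φ)
        ((s.attach.image fun m => Ind.unit φ (⟨m.1, Submodule.subset_span m.2⟩ : M') :
          Finset (Ind φ M')) : Set (Ind φ M')) := by
      intro m hm
      induction hm using Submodule.span_induction with
      | mem m hm =>
        exact Submodule.subset_span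
          (by simp only [Finset.coe_image]; exact ⟨⟨m, hm⟩, by simp, rfl⟩)
      | zero => exact (map_zero (Ind.unit φ) : Ind.unit φ (0 : M') = 0) ▸ zero_mem _
      | add x y hx hy ihx ihy =>
        have e : Ind.unit φ (⟨x + y, add_mem hx hy⟩ : M') =
          Ind.unit φ (⟨x, hx⟩ : M') + Ind.unit φ (⟨y, hy⟩ : M') :=
            map_add (Ind.unit φ) (⟨x, hx⟩ : M') ⟨y, hy⟩
        rw [e]
        exact add_mem ihx ihy
      | smul a x hx ih =>
        have e : Ind.unit φ (⟨a • x, Submodule.smul_mem _ a hx⟩ : M') =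
          TwistedPoly.C φ a • Ind.unit φ (⟨x, hx⟩ : M') :=
            Ind.unit_smul a (⟨x, hx⟩ : M')
        rw [e]
        exact Submodule.smul_mem _ _ ih
    induction x using Ind.induction_on with
    | zero => exact zero_mem _
    | add x y hx hy => exact add_mem hx hy
    | smul_unit r m => exact Submodule.smul_mem _ _ (key m m.2)
  obtain ⟨S, hS⟩ :=
    Module.FinitePresentation.fg_ker (Ind.act hM M') (hsurj M' Submodule.subset_span)
  obtain ⟨n, hn⟩ : ∃ n, (S : Set (Ind φ M')) ⊆ Ind.degreeLE φ M' n := by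
    choose d hd using fun x : Ind φ M' => Ind.exists_mem_degreeLE x
    exact ⟨S.sup d, fun x hx => Ind.degreeLE_mono _ (Finset.le_sup hx) (hd x)⟩
  let M₀ : Submodule A M :=
    Submodule.span A {m | ∃ i ≤ n, ∃ m' ∈ M', m = TwistedPoly.X φ ^ i • m'}
  have hXC : ∀ (i : ℕ) (a : A) (m : M),
      TwistedPoly.X φ ^ i • a • m = (φ ^ i) a • TwistedPoly.X φ ^ i • m := fun i a m => by
    rw [← hM, ← hM, smul_smul, smul_smul, TwistedPoly.X_pow_mul_C]
  have hfg : M₀.FG := by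
    refine ⟨(Finset.range (n + 1) ×ˢ s).image fun q => TwistedPoly.X φ ^ q.1 • q.2,
      le_antisymm (Submodule.span_le.2 ?_) (Submodule.span_le.2 ?_)⟩
    · intro x hx
      simp only [Finset.coe_image, Set.mem_image, Finset.mem_coe, Finset.mem_product,
        Finset.mem_range] at hx
      obtain ⟨⟨i, m⟩, ⟨hi, hm⟩, rfl⟩ := hx
      exact Submodule.subset_span ⟨i, by omega, m, Submodule.subset_span hm, rfl⟩
    · rintro _ ⟨i, hi, m, hm, rfl⟩
      induction hm using Submodule.span_induction with
      | mem m hm =>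
        refine Submodule.subset_span ?_
        simp only [Finset.coe_image, Set.mem_image, Finset.mem_coe, Finset.mem_product,
          Finset.mem_range]
        exact ⟨(i, m), ⟨by omega, hm⟩, rfl⟩
      | zero => rw [smul_zero]; exact zero_mem _
      | add x y _ _ hx hy => rw [smul_add]; exact add_mem hx hy
      | smul a x _ hx => rw [hXC]; exact Submodule.smul_mem _ _ hx
  have h₀ := hlen M₀ hfg
  have hle : M' ≤ M₀ := fun m hm => Submodule.subset_span ⟨0, Nat.zero_le n, m, hm, by simp⟩
  refine ⟨M₀, relations hM M₀, relationsInd hM M₀, Ind.act hM M₀, h₀, ?_,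
    relationsInd_injective hM hφ M₀, hsurj M₀ (Submodule.subset_span.trans hle),
    exact_relationsInd hM hn hS.symm rfl⟩
  exact (isFiniteLength_frob hφ' h₀).of_injective (relations hM M₀).injective_subtype

end Presentation

/-! ### Vanishing of the higher `Tor` modules -/

section Depth

variable {A : Type*} [CommRing A] (x : ℕ → A) {P P' : Type*} [AddCommGroup P] [Module A P]
  [AddCommGroup P'] [Module A P']

/-- The first `r` terms of `x` form a weakly regular sequence on the module `P ⧸ K`. -/
def IsQuotientRegular (r : ℕ) (K : Submodule A P) : Prop :=
  ∀ j < r, ∀ z : P, x j • z ∈ initialIdeal x j • (⊤ : Submodule A P) ⊔ K →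
    z ∈ initialIdeal x j • (⊤ : Submodule A P) ⊔ K

variable {x}

/-- If `x` is regular on `P ⧸ K`, and `I` is generated by some of its first terms, then
`K ∩ I P` is contained in `I K`. -/
lemma IsQuotientRegular.inf_smul_top_le {r : ℕ} {K : Submodule A P}
    (hK : IsQuotientRegular x r K) {j : ℕ} (hj : j ≤ r) :
    K ⊓ initialIdeal x j • (⊤ : Submodule A P) ≤ initialIdeal x j • K := by
  induction j with
  | zero =>
    rw [initialIdeal_zero, Submodule.bot_smul]
    exact inf_le_right.trans bot_le
  | succ j ih =>
    rintro y ⟨hy, hy'⟩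
    rw [initialIdeal_succ, Submodule.sup_smul] at hy'
    obtain ⟨w, hw, v, hv, rfl⟩ := Submodule.mem_sup.1 hy'
    rw [Submodule.ideal_span_singleton_smul] at hv
    obtain ⟨z, -, rfl⟩ := (Submodule.mem_smul_pointwise_iff_exists v (x j) ⊤).1 hv
    have hz : z ∈ initialIdeal x j • (⊤ : Submodule A P) ⊔ K :=
      hK j (by omega) z (Submodule.mem_sup.2 ⟨-w, neg_mem hw, _, hy, by simp⟩)
    obtain ⟨z', hz', n, hn, rfl⟩ := Submodule.mem_sup.1 hz
    have h₁ : w + x j • z' ∈ initialIdeal x j • K := by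
      refine ih (by omega) ⟨?_, add_mem hw (Submodule.smul_mem _ _ hz')⟩
      have : w + x j • z' = w + x j • (z' + n) - x j • n := by rw [smul_add]; abel
      exact this ▸ sub_mem hy (Submodule.smul_mem _ _ hn)
    have : w + x j • (z' + n) = (w + x j • z') + x j • n := by rw [smul_add]; abel
    rw [this]
    exact add_mem (Submodule.smul_mono_left (initialIdeal_mono x (Nat.le_succ j)) h₁)
      (Submodule.smul_mem_smul (mem_initialIdeal x (Nat.lt_succ_self j)) hn)

/-- An element which `f` sends into `I P'` is congruent modulo `I P` to an element of `ker f`, as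
soon as the first terms of `x` which generate `I` form a regular sequence on the cokernel of `f`. -/
lemma IsQuotientRegular.mem_sup_ker {r : ℕ} {f : P →ₗ[A] P'}
    (hf : IsQuotientRegular x r f.range)
    {j : ℕ} (hj : j ≤ r) {z : P} (hz : f z ∈ initialIdeal x j • (⊤ : Submodule A P')) :
    z ∈ initialIdeal x j • (⊤ : Submodule A P) ⊔ f.ker := by
  have h : f z ∈ initialIdeal x j • f.range :=
    inf_smul_top_le hf hj ⟨⟨z, rfl⟩, hz⟩
  rw [LinearMap.range_eq_map, ← Submodule.map_smul''] at h
  obtain ⟨y, hy, hyz⟩ := h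
  exact Submodule.mem_sup.2 ⟨y, hy, z - y, by simp [hyz], by simp⟩

/-- If the first `d` terms of `x` are regular on `P'` and the first `r` ones on the cokernel of
`f : P → P'`, then one more is regular on `P ⧸ ker f`, which is the image of `f`, as
long as this does not exceed `d`. -/
lemma IsQuotientRegular.ker {d r : ℕ} {f : P →ₗ[A] P'}
    (hP : IsQuotientRegular x d (⊥ : Submodule A P')) (hf : IsQuotientRegular x r f.range) :
    IsQuotientRegular x (min (r + 1) d) f.ker := by
  intro j hj z hz
  refine mem_sup_ker hf (by omega) ?_
  have h : f (x j • z) ∈ initialIdeal x j • (⊤ : Submodule A P') := by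
    obtain ⟨y, hy, n, hn, h⟩ := Submodule.mem_sup.1 hz
    rw [← h, map_add, LinearMap.mem_ker.1 hn, add_zero]
    have := Submodule.mem_map_of_mem (f := f) hy
    rw [Submodule.map_smul''] at this
    exact Submodule.smul_mono le_rfl le_top this
  have := hP j (by omega) (f z)
  rw [sup_bot_eq] at this
  exact this (by rwa [← map_smul])

/-- In an exact complex of modules on which `x` is regular up to `d`, the boundaries in degree at
least `d` which are divisible by the ideal generated by `x 0, …, x (d - 1)` come from chains
divisible by that ideal, up to cycles. -/
lemma exists_sub_mem_smul_top {K : ℕ → Type*} [∀ n, AddCommGroup (K n)] [∀ n, Module A (K n)]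
    (D : ∀ n, K (n + 1) →ₗ[A] K n) (hD : ∀ n, Function.Exact (D (n + 1)) (D n)) {d : ℕ}
    (hK : ∀ n, IsQuotientRegular x d (⊥ : Submodule A (K n))) {i : ℕ} (hi : d ≤ i)
    {z : K (i + 1)} (hz : D i z ∈ initialIdeal x d • (⊤ : Submodule A (K i))) :
    ∃ t, D (i + 1) t - z ∈ initialIdeal x d • (⊤ : Submodule A (K (i + 1))) := by
  have hreg : ∀ n, IsQuotientRegular x (min n d) (D n).range := by
    intro n
    induction n with
    | zero => exact fun j hj => absurd hj (by simp)
    | succ n ih =>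
      have h := IsQuotientRegular.ker (f := D n) (hK n) ih
      rw [(hD n).linearMap_ker_eq] at h
      exact fun j hj => h j (lt_of_lt_of_le hj (by omega))
  obtain ⟨y, hy, n, hn, rfl⟩ := Submodule.mem_sup.1
    ((hreg i).mem_sup_ker (j := d) (by simp [hi]) hz)
  obtain ⟨t, rfl⟩ := (hD i n).1 hn
  refine ⟨t, ?_⟩
  rw [sub_add_cancel_right]
  exact neg_mem hy

end Depth

section Vanishing

/-- A projective `A[X]_φ`-module is projective over `A`, hence a regular sequence of `A` is regular
on it. -/
lemma isQuotientRegular_of_projective {k A : Type*} [Field k] [CommRing A] [Algebra k A]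
    {φ : A →ₐ[k] A} {P : Type*} [AddCommGroup P] [Module A P] [Module (TwistedPoly φ) P]
    (hP : ∀ (a : A) (m : P), TwistedPoly.C φ a • m = a • m) [Module.Projective (TwistedPoly φ) P]
    {x : ℕ → A} {d : ℕ} (hx : IsRegularUpTo x d) : IsQuotientRegular x d (⊥ : Submodule A P) := by
  obtain ⟨s, hs⟩ := (Module.projective_def (R := TwistedPoly φ) (P := P)).1 inferInstance
  -- Membership in `I P` can be read off from the coefficients in a free module which has `P` as a
  -- direct summand.
  have key : ∀ (I : Ideal A) (z : P), z ∈ I • (⊤ : Submodule A P) ↔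
      ∀ p n, TwistedPoly.coeffHom φ n (s z p) ∈ I := by
    intro I z
    constructor
    · intro hz p n
      refine Submodule.smul_induction_on hz (fun a ha m _ => ?_) fun y z hy hz => ?_
      · rw [← hP, map_smul, Finsupp.smul_apply, smul_eq_mul, TwistedPoly.coeffHom_C_mul]
        exact I.mul_mem_right _ ha
      · rw [map_add, Finsupp.add_apply, map_add]
        exact I.add_mem hy hz
    · intro h
      rw [← hs z, Finsupp.linearCombination_apply, Finsupp.sum]
      refine sum_mem fun p _ => ?_
      obtain ⟨N, hN⟩ := TwistedPoly.exists_coeffHom_eq_zero (s z p)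
      rw [TwistedPoly.sum_coeffHom hN, Finset.sum_smul]
      refine sum_mem fun n _ => ?_
      rw [mul_smul, hP]
      exact Submodule.smul_mem_smul (h p n) trivial
  intro j hj z hz
  rw [sup_bot_eq, key] at hz ⊢
  intro p n
  refine hx j hj _ ?_
  rw [← TwistedPoly.coeffHom_C_mul, ← smul_eq_mul, ← Finsupp.smul_apply, ← map_smul, hP]
  exact hz p n

variable {k : Type v} {A : Type w} [Field k] [CommRing A] [Algebra k A] {φ : A →ₐ[k] A}
  {ε : A →ₐ[k] k}

lemma mem_augSubmodule_iff (hε : ∀ a, ε (φ a) = ε a) {M : Type*} [AddCommGroup M] [Module A M]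
    [Module (TwistedPoly φ) M] (hM : ∀ (a : A) (m : M), TwistedPoly.C φ a • m = a • m) (z : M) :
    z ∈ augSubmodule φ ε M ↔ z ∈ RingHom.ker ε • (⊤ : Submodule A M) := by
  rw [← Submodule.mem_toAddSubgroup, coe_augSubmodule φ ε hε]
  constructor
  · intro hz
    induction hz using AddSubgroup.closure_induction with
    | mem z hz =>
      obtain ⟨a, m, ha, rfl⟩ := hz
      rw [hM]
      exact Submodule.smul_mem_smul ha trivial
    | zero => exact zero_mem _
    | add _ _ _ _ h₁ h₂ => exact add_mem h₁ h₂
    | neg _ _ h₁ => exact neg_mem h₁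
  · intro hz
    exact Submodule.smul_induction_on hz
      (fun a ha m _ => AddSubgroup.subset_closure ⟨a, m, ha, (hM a m).symm⟩)
      fun _ _ h₁ h₂ => add_mem h₁ h₂

/-- A criterion for the exactness of `M₁ / 𝔪M₁ → M₂ / 𝔪M₂ → M₃ / 𝔪M₃` at the middle term. -/
lemma residue_map_exact {M₁ M₂ M₃ : ModuleCat.{w} (TwistedPoly φ)} (f : M₁ ⟶ M₂) (g : M₂ ⟶ M₃)
    (hfg : f ≫ g = 0) (h : ∀ z : M₂, g z ∈ augSubmodule φ ε M₃ →
      ∃ t : M₁, f t - z ∈ augSubmodule φ ε M₂) :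
    (ShortComplex.mk ((residue.{w} φ ε).map f) ((residue.{w} φ ε).map g)
      (by rw [← Functor.map_comp, hfg, Functor.map_zero])).Exact := by
  rw [ShortComplex.moduleCat_exact_iff]
  intro z hz
  obtain ⟨z, rfl⟩ : ∃ z', (augSubmodule φ ε M₂).mkQ z' = z :=
    (augSubmodule φ ε M₂).mkQ_surjective z
  obtain ⟨t, ht⟩ := h z ((Submodule.Quotient.mk_eq_zero (augSubmodule φ ε M₃)).1 hz)
  exact ⟨(augSubmodule φ ε M₁).mkQ t, (Submodule.Quotient.eq (augSubmodule φ ε M₂)).2 ht⟩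

/-- If the augmentation ideal of `A` is generated by a regular sequence of length `d`, then
`Tor_i^A(k, -)` vanishes for `i > d`. -/
theorem subsingleton_tor (hε : ∀ a, ε (φ a) = ε a) {x : ℕ → A} {d : ℕ} (hx : IsRegularUpTo x d)
    (hm : initialIdeal x d = RingHom.ker ε) (M : ModuleCat.{w} (TwistedPoly φ)) {i : ℕ}
    (hi : d < i) : Subsingleton (tor φ ε i M) := by
  obtain ⟨i, rfl⟩ : ∃ j, i = j + 1 := ⟨i - 1, by omega⟩
  let P : ProjectiveResolution M := ProjectiveResolution.of M
  let K := P.complex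
  have hex : ∀ n, Function.Exact (K.d (n + 2) (n + 1)).hom (K.d (n + 1) n).hom := fun n => by
    have := P.complex_exactAt_succ n
    rw [HomologicalComplex.exactAt_iff' _ (n + 2) (n + 1) n (by simp) (by simp)] at this
    exact (ShortComplex.ShortExact.moduleCat_exact_iff_function_exact _).1 this
  let : ∀ n, Module A (K.X n) := fun n => Module.compHom _ (TwistedPoly.C φ)
  have hK : ∀ n (a : A) (m : K.X n), TwistedPoly.C φ a • m = a • m := fun _ _ _ => rfl
  let D : ∀ n, K.X (n + 1) →ₗ[A] K.X n := fun n =>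
    { (K.d (n + 1) n).hom.toAddMonoidHom with
      map_smul' := fun a m => map_smul (K.d (n + 1) n).hom (TwistedPoly.C φ a) m }
  have hreg : ∀ n, IsQuotientRegular x d (⊥ : Submodule A (K.X n)) := fun n => by
    have := (IsProjective.iff_projective (K.X n)).2 (P.projective n)
    exact isQuotientRegular_of_projective (hK n) hx
  have hz : (((residue.{w} φ ε).mapHomologicalComplex _).obj K).ExactAt (i + 1) := by
    rw [HomologicalComplex.exactAt_iff' _ (i + 2) (i + 1) i (by simp) (by simp)]
    refine residue_map_exact (K.d (i + 2) (i + 1)) (K.d (i + 1) i) (K.d_comp_d _ _ _) fun z h₁ => ?_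
    change D i z ∈ augSubmodule φ ε (K.X i) at h₁
    rw [mem_augSubmodule_iff hε (hK i), ← hm] at h₁
    obtain ⟨t, ht⟩ := exists_sub_mem_smul_top D hex hreg (by omega) h₁
    rw [hm, ← mem_augSubmodule_iff hε (hK (i + 1))] at ht
    exact ⟨t, ht⟩
  have := ModuleCat.subsingleton_of_isZero
    ((HomologicalComplex.exactAt_iff_isZero_homology _ _).1 hz)
  exact (P.isoLeftDerivedObj (residue.{w} φ ε) (i + 1)).toLinearEquiv.injective.subsingleton
    (β := (((residue.{w} φ ε).mapHomologicalComplex _).obj K).homology (i + 1))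

end Vanishing

/-! ### Finitely presented modules which are torsion for the augmentation ideal -/

section Torsion

variable {k : Type v} {A : Type w} [Field k] [CommRing A] [Algebra k A] {φ : A →ₐ[k] A}
  {ε : A →ₐ[k] k}

/-- A finitely generated `A`-module killed by a power of the augmentation ideal is finite
dimensional over `k`. -/
lemma fg_restrictScalars_of_pow_smul_eq_bot (hε : (RingHom.ker ε).FG) {M : Type*} [AddCommGroup M]
    [Module A M] [Module k M] [IsScalarTower k A M] (n : ℕ) {N : Submodule A M} (hN : N.FG)
    (h : RingHom.ker ε ^ n • N = ⊥) : (N.restrictScalars k).FG := by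
  induction n generalizing N with
  | zero =>
    rw [pow_zero, Ideal.one_eq_top, Submodule.top_smul] at h
    rw [h]
    exact ⟨∅, by simp⟩
  | succ n ih =>
    have h₁ : ((RingHom.ker ε • N).restrictScalars k).FG :=
      ih (Submodule.FG.smul hε hN) (by rwa [← Submodule.mul_smul, ← pow_succ])
    obtain ⟨s, rfl⟩ := hN
    have h₂ : (Submodule.span A (s : Set M)).restrictScalars k =
        Submodule.span k (s : Set M) ⊔
          (RingHom.ker ε • Submodule.span A (s : Set M)).restrictScalars k := by
      refine le_antisymm ?_ (sup_le (Submodule.span_le_restrictScalars k A _) ?_)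
      · have key : ∀ z ∈ Submodule.span A (s : Set M), z ∈ Submodule.span k (s : Set M) ⊔
            (RingHom.ker ε • Submodule.span A (s : Set M)).restrictScalars k := by
          intro z hz
          induction hz using Submodule.span_induction with
          | mem z hz => exact Submodule.mem_sup_left (Submodule.subset_span hz)
          | zero => exact zero_mem _
          | add _ _ _ _ h₁ h₂ => exact add_mem h₁ h₂
          | smul a z hz ih =>
            have e : a • z = ε a • z + (a - algebraMap k A (ε a)) • z := by
              rw [sub_smul, algebraMap_smul, add_sub_cancel]
            have ha : a - algebraMap k A (ε a) ∈ RingHom.ker ε := by simp [RingHom.mem_ker]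
            have haz : (a - algebraMap k A (ε a)) • z ∈
                RingHom.ker ε • Submodule.span A (s : Set M) := Submodule.smul_mem_smul ha hz
            rw [e]
            refine add_mem (Submodule.smul_mem _ _ ih) (Submodule.mem_sup_right ?_)
            rwa [Submodule.restrictScalars_mem]
        exact key
      · have hle : RingHom.ker ε • Submodule.span A (s : Set M) ≤ Submodule.span A (s : Set M) :=
          Submodule.smul_le_right
        intro z hz
        rw [Submodule.restrictScalars_mem] at hz ⊢
        exact hle hz
    rw [h₂]
    exact (Submodule.fg_span s.finite_toSet).sup h₁

/-- Let `M` be a module all of whose elements are killed by a power of the augmentation ideal. Then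
its finitely generated submodules have finite length. -/
lemma isFiniteLength_of_forall_pow_smul (hε : (RingHom.ker ε).FG) {M : Type*} [AddCommGroup M]
    [Module A M] (hM : ∀ m : M, ∃ n, ∀ a ∈ RingHom.ker ε ^ n, a • m = 0) (N : Submodule A M)
    (hN : N.FG) : IsFiniteLength A N := by
  let : Module k M := Module.compHom M (algebraMap k A)
  have : IsScalarTower k A M := IsScalarTower.of_algebraMap_smul fun _ _ => rfl
  obtain ⟨s, hs⟩ := hN
  choose n hn using hM
  have h : RingHom.ker ε ^ (s.sup n) • N = ⊥ := by
    rw [eq_bot_iff, ← hs, Submodule.smul_le]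
    intro a ha z hz
    induction hz using Submodule.span_induction with
    | mem z hz => exact hn z a (Ideal.pow_le_pow_right (Finset.le_sup hz) ha)
    | zero => exact (smul_zero a : a • (0 : M) = 0)
    | add y z _ _ hy hz => rw [smul_add]; exact add_mem hy hz
    | smul b z _ hz => rw [smul_comm]; exact Submodule.smul_mem _ _ hz
  have := fg_restrictScalars_of_pow_smul_eq_bot hε _ ⟨s, hs⟩ h
  have : Module.Finite k N := Module.Finite.iff_fg.2 this
  rw [isFiniteLength_iff_isNoetherian_isArtinian]
  exact ⟨isNoetherian_of_tower k inferInstance, isArtinian_of_tower k inferInstance⟩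

/-- Over a local ring `A` whose augmentation ideal is generated by a regular sequence of positive
length `d`, with an endomorphism `φ` which is finite and flat, every finitely presented
`A[X]_φ`-module which is torsion for the augmentation ideal has Euler characteristic zero. -/
theorem tor_and_eulerChar_of_torsion [IsLocalRing A] (hφ : (φ : A →+* A).Flat)
    (hφ' : (φ : A →+* A).Finite) (hε : ∀ a, ε (φ a) = ε a) {x : ℕ → A} {d : ℕ} (hd : 0 < d)
    (hx : IsRegularUpTo x d) (hm : initialIdeal x d = RingHom.ker ε)
    (M : ModuleCat.{w} (TwistedPoly φ)) [Module.FinitePresentation (TwistedPoly φ) M]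
    (hM : ∀ m : M, ∃ n, ∀ a ∈ RingHom.ker ε ^ n, TwistedPoly.C φ a • m = 0) :
    (∀ i, Module.Finite k[X] (tor φ ε i M)) ∧ (∀ i, d < i → Subsingleton (tor φ ε i M)) ∧
      eulerChar φ ε M = 0 := by
  let : Module A M := Module.compHom M (TwistedPoly.C φ)
  have hfg : (RingHom.ker ε).FG := by
    rw [← hm]
    exact Submodule.fg_span ((Set.finite_Iio d).image x)
  obtain ⟨M₀, N, f, g, hM₀, hN, hf, hg, hfg⟩ := exists_ind_resolution (M := M) (fun _ _ => rfl)
    hφ hφ' (isFiniteLength_of_forall_pow_smul hfg hM)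
  obtain ⟨h₁, e₁⟩ := isTorFinite_ind_of_isFiniteLength (ε := ε) hφ hd hx hm hN
  obtain ⟨h₂, e₂⟩ := isTorFinite_ind_of_isFiniteLength (ε := ε) hφ hd hx hm hM₀
  have h₃ := IsTorFinite.third hf hg hfg h₁ h₂
  refine ⟨h₃.finite, fun i hi => subsingleton_tor hε hx hm M hi, ?_⟩
  have := eulerChar_add hf hg hfg h₁ h₂ h₃
  rw [e₁, e₂, zero_add] at this
  exact this.symm

end Torsion

/-! ### Completed group algebras as duals of spaces of locally constant functions -/

namespace IwasawaAlgebra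

section Invariant

variable {G : Type*} [Group G] [TopologicalSpace G]

variable (G) in
/-- The whole group, as an open normal subgroup. -/
def topNormal : OpenNormalSubgroup G :=
  { (⊤ : OpenSubgroup G) with isNormal' := inferInstanceAs (⊤ : Subgroup G).Normal }

/-- The functions on `G` which are constant on the cosets `g N`. -/
def IsInvariant {α : Type*} (N : OpenNormalSubgroup G) (f : G → α) : Prop :=
  ∀ g, ∀ n ∈ N, f (g * n) = f g

lemma IsInvariant.mono {α : Type*} {N N' : OpenNormalSubgroup G} (h : N ≤ N') {f : G → α}
    (hf : IsInvariant N' f) : IsInvariant N f := fun g n hn => hf g n (h hn)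

lemma IsInvariant.out_eq {α : Type*} {N : OpenNormalSubgroup G} {f : G → α}
    (hf : IsInvariant N f) (g : G) :
    f (QuotientGroup.mk' N.toSubgroup g).out = f g := by
  obtain ⟨n, hn⟩ := QuotientGroup.mk_out_eq_mul N.toSubgroup g
  exact (congrArg f hn).trans (hf g n n.2)

lemma isInvariant_comp_mk (N : OpenNormalSubgroup G) {α : Type*}
    (f : G ⧸ N.toSubgroup → α) : IsInvariant N fun g => f (QuotientGroup.mk' N.toSubgroup g) :=
  fun g n hn => by
  have : QuotientGroup.mk' N.toSubgroup (g * n) = QuotientGroup.mk' N.toSubgroup g := by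
    rw [map_mul]
    exact mul_eq_left.2 ((QuotientGroup.eq_one_iff n).2 hn)
  exact congrArg f this

end Invariant

variable {k : Type*} [Field k] {G G' : Type*} [Group G] [TopologicalSpace G] [Group G']
  [TopologicalSpace G']

lemma ext_apply {x y : IwasawaAlgebra k G} (h : ∀ N, x.1 N = y.1 N) : x = y :=
  Subtype.ext (funext h)

lemma map_apply_of_le (f : G →ₜ* G') (x : IwasawaAlgebra k G) (N : OpenNormalSubgroup G')
    (N₁ : OpenNormalSubgroup G) (h : N₁.toSubgroup ≤ N.toSubgroup.comap (f : G →* G')) :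
    (map k f x).1 N = MonoidAlgebra.mapDomainAlgHom k k
      (QuotientGroup.map N₁.toSubgroup N.toSubgroup (f : G →* G') h) (x.1 N₁) := by
  rw [map_apply, ← x.2 N₁ (comapOpenNormal f N) h, ← AlgHom.comp_apply,
    ← MonoidAlgebra.mapDomainAlgHom_comp]
  congr 2
  ext g
  rfl

/-- An element of `k[[G]]` is invertible if its images in all the algebras `k[G / N]` are. -/
lemma isUnit_of_forall {x : IwasawaAlgebra k G} (h : ∀ N, IsUnit (x.1 N)) : IsUnit x := by
  choose y hy using h
  let z : IwasawaAlgebra k G := ⟨fun N => ((y N)⁻¹ : _ˣ), fun N N' hN => by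
    have h₁ : Units.map (MonoidAlgebra.mapDomainAlgHom k k (QuotientGroup.map N.toSubgroup
        N'.toSubgroup (MonoidHom.id G) hN) : _ →* _) (y N) = y N' := by
      ext1
      rw [Units.coe_map, hy N', ← x.2 N N' hN, ← hy N]
      rfl
    exact congrArg (fun u : (MonoidAlgebra k (G ⧸ N'.toSubgroup))ˣ => ((u⁻¹ : _ˣ) :
      MonoidAlgebra k (G ⧸ N'.toSubgroup))) h₁⟩
  refine ⟨⟨x, z, ext_apply fun N => ?_, ext_apply fun N => ?_⟩, rfl⟩
  · change x.1 N * ((y N)⁻¹ : _ˣ) = 1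
    rw [← hy N, Units.mul_inv]
  · change ((y N)⁻¹ : _ˣ) * x.1 N = 1
    rw [← hy N, Units.inv_mul]

variable (k) in
/-- The group element `g`, as an element of `k[[G]]`. -/
def of (g : G) : IwasawaAlgebra k G :=
  ⟨fun N => MonoidAlgebra.single (QuotientGroup.mk' N.toSubgroup g) 1, fun N N' h => by
    rw [MonoidAlgebra.mapDomainAlgHom_apply, MonoidAlgebra.mapDomain_single]
    rfl⟩

lemma of_apply (g : G) (N : OpenNormalSubgroup G) :
    (of k g).1 N = MonoidAlgebra.single (QuotientGroup.mk' N.toSubgroup g) 1 := rfl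

lemma of_mul (g h : G) : of k (g * h) = of k g * of k h := ext_apply fun N => by
  change _ = (of k g).1 N * (of k h).1 N
  rw [of_apply, of_apply, of_apply, MonoidAlgebra.single_mul_single, mul_one, map_mul]

lemma of_one : of k (1 : G) = 1 := ext_apply fun N => by
  rw [of_apply, map_one]
  rfl

lemma map_of (f : G →ₜ* G') (g : G) : map k f (of k g) = of k (f g) := ext_apply fun N => by
  rw [map_apply, of_apply, of_apply, MonoidAlgebra.mapDomainAlgHom_apply,
    MonoidAlgebra.mapDomain_single]
  rfl

/-- If `h f(g) = f'(g) h` for all `g`, then `h f(y) = f'(y) h` for all `y ∈ k[[G]]`. -/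
lemma of_mul_map (f f' : G →ₜ* G') (h : G') (hf : ∀ g, h * f g = f' g * h)
    (y : IwasawaAlgebra k G) : of k h * map k f y = map k f' y * of k h := ext_apply fun N => by
  have hle : (comapOpenNormal f N).toSubgroup ≤ N.toSubgroup.comap (f' : G →* G') := by
    intro g hg
    have hg : f g ∈ N.toSubgroup := hg
    have : f' g = h * f g * h⁻¹ := by rw [hf, mul_inv_cancel_right]
    change f' g ∈ N.toSubgroup
    rw [this]
    exact N.isNormal'.conj_mem _ hg h
  change (of k h).1 N * (map k f y).1 N = (map k f' y).1 N * (of k h).1 N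
  rw [map_apply_of_le f' y N _ hle, map_apply, of_apply]
  generalize y.1 (comapOpenNormal f N) = z
  induction z using MonoidAlgebra.induction_linear with
  | zero => simp
  | add x y hx hy => rw [map_add, mul_add, hx, hy, map_add, add_mul]
  | single q c =>
    obtain ⟨g, rfl⟩ := QuotientGroup.mk'_surjective _ q
    simp only [MonoidAlgebra.mapDomainAlgHom_apply, MonoidAlgebra.mapDomain_single,
      MonoidAlgebra.single_mul_single, one_mul, mul_one]
    congr 1
    exact congrArg (QuotientGroup.mk' N.toSubgroup) (hf g)

variable (k G) in
/-- The space of the functions `G → k` which are constant on the cosets of some open normal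
subgroup. -/
def locConst : Submodule k (G → k) where
  carrier := {f | ∃ N, IsInvariant N f}
  add_mem' := by
    rintro f f' ⟨N, hN⟩ ⟨N', hN'⟩
    exact ⟨N ⊓ N', fun g n hn => congrArg₂ (· + ·) (hN g n (inf_le_left (a := N) hn))
      (hN' g n (inf_le_right (a := N) hn))⟩
  zero_mem' := ⟨topNormal G, fun _ _ _ => rfl⟩
  smul_mem' c f := by
    rintro ⟨N, hN⟩
    exact ⟨N, fun g n hn => congrArg (c • ·) (hN g n hn)⟩

/-- The linear form `∑ c_q q ↦ ∑ c_q f(q)` on `k[G / N]`, where `f` is evaluated at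
representatives. -/
def integrate (N : OpenNormalSubgroup G) (f : G → k) :
    MonoidAlgebra k (G ⧸ N.toSubgroup) →ₗ[k] k :=
  (Finsupp.linearCombination k fun q : G ⧸ N.toSubgroup => f q.out).comp
    (MonoidAlgebra.coeffLinearEquiv k).toLinearMap

lemma integrate_single (N : OpenNormalSubgroup G) (f : G → k) (q : G ⧸ N.toSubgroup) (c : k) :
    integrate N f (MonoidAlgebra.single q c) = c * f q.out :=
  Finsupp.linearCombination_single k c q

lemma integrate_single_mk {N : OpenNormalSubgroup G} {f : G → k} (hf : IsInvariant N f) (g : G)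
    (c : k) : integrate N f (MonoidAlgebra.single (QuotientGroup.mk' N.toSubgroup g) c) =
      c * f g := by
  rw [integrate_single, hf.out_eq]

lemma integrate_eq_of_le {N N' : OpenNormalSubgroup G} (h : N ≤ N') {f : G → k}
    (hf : IsInvariant N' f) (a : IwasawaAlgebra k G) :
    integrate N f (a.1 N) = integrate N' f (a.1 N') := by
  rw [← a.2 N N' h]
  generalize a.1 N = z
  induction z using MonoidAlgebra.induction_linear with
  | zero => simp
  | add x y hx hy => rw [map_add, map_add, map_add, hx, hy]
  | single q c =>
    obtain ⟨g, rfl⟩ := QuotientGroup.mk'_surjective _ q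
    rw [integrate_single_mk (hf.mono h), MonoidAlgebra.mapDomainAlgHom_apply,
      MonoidAlgebra.mapDomain_single]
    exact (integrate_single_mk hf g c).symm

lemma integrate_eq {N N' : OpenNormalSubgroup G} {f : G → k} (hf : IsInvariant N f)
    (hf' : IsInvariant N' f) (a : IwasawaAlgebra k G) :
    integrate N f (a.1 N) = integrate N' f (a.1 N') :=
  (integrate_eq_of_le inf_le_left hf a).symm.trans (integrate_eq_of_le inf_le_right hf' a)

/-- The pairing `⟨a, f⟩ = ∫ f da` between `k[[G]]` and the locally constant functions on `G`. -/
def pairing : IwasawaAlgebra k G →ₗ[k] Module.Dual k (locConst k G) :=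
  LinearMap.mk₂ k (fun a f => integrate f.2.choose f.1 (a.1 f.2.choose))
    (fun a b f => map_add _ _ _)
    (fun c a f => map_smul (integrate f.2.choose f.1) c (a.1 f.2.choose))
    (fun a f f' => by
      have h := f.2.choose_spec
      have h' := f'.2.choose_spec
      rw [integrate_eq (f + f').2.choose_spec (N' := f.2.choose ⊓ f'.2.choose)
          (fun g n hn => congrArg₂ (· + ·) (h g n (inf_le_left (a := f.2.choose) hn))
            (h' g n (inf_le_right (a := f.2.choose) hn))),
        integrate_eq h (h.mono (inf_le_left : f.2.choose ⊓ f'.2.choose ≤ _)),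
        integrate_eq h' (h'.mono (inf_le_right : f.2.choose ⊓ f'.2.choose ≤ _))]
      generalize a.1 _ = z
      induction z using MonoidAlgebra.induction_linear with
      | zero => simp
      | add x y hx hy => rw [map_add, map_add, map_add, hx, hy]; abel
      | single q c =>
        rw [integrate_single, integrate_single, integrate_single]
        exact mul_add _ _ _)
    (fun c a f => by
      have h := f.2.choose_spec
      rw [integrate_eq (c • f).2.choose_spec (N' := f.2.choose)
          (fun g n hn => congrArg (c • ·) (h g n hn))]
      generalize a.1 _ = z
      induction z using MonoidAlgebra.induction_linear with
      | zero => simp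
      | add x y hx hy => rw [map_add, map_add, hx, hy, smul_add]
      | single q b => rw [integrate_single, integrate_single]; exact mul_left_comm b c _)

lemma pairing_apply (a : IwasawaAlgebra k G) (f : locConst k G) {N : OpenNormalSubgroup G}
    (hf : IsInvariant N f.1) : pairing a f = integrate N f.1 (a.1 N) :=
  integrate_eq f.2.choose_spec hf a

/-- The function `h ↦ f(g h)`. -/
def translate (g : G) : locConst k G →ₗ[k] locConst k G where
  toFun f := ⟨fun h => f.1 (g * h), f.2.choose, fun h n hn => by
    change f.1 (g * (h * n)) = _
    rw [← mul_assoc]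
    exact f.2.choose_spec _ n hn⟩
  map_add' _ _ := rfl
  map_smul' _ _ := rfl

lemma translate_apply (g : G) (f : locConst k G) (h : G) : (translate g f).1 h = f.1 (g * h) := rfl

/-- Multiplication by `g ∈ G` is dual to the translation of functions. -/
lemma pairing_of_mul (g : G) (a : IwasawaAlgebra k G) (f : locConst k G) :
    pairing (of k g * a) f = pairing a (translate g f) := by
  obtain ⟨N, hN⟩ := f.2
  have hN' : IsInvariant N (translate g f).1 := fun h n hn => by
    rw [translate_apply, translate_apply, ← mul_assoc]
    exact hN _ n hn
  rw [pairing_apply _ _ hN, pairing_apply _ _ hN']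
  change integrate N f.1 ((of k g).1 N * a.1 N) = _
  rw [of_apply]
  generalize a.1 N = z
  induction z using MonoidAlgebra.induction_linear with
  | zero => simp
  | add x y hx hy => rw [mul_add, map_add, map_add, hx, hy]
  | single q c =>
    obtain ⟨h, rfl⟩ := QuotientGroup.mk'_surjective _ q
    rw [MonoidAlgebra.single_mul_single, one_mul, ← map_mul, integrate_single_mk hN,
      integrate_single_mk hN', translate_apply]

/-- The function `f ∘ σ`. -/
def pullback (σ : G →ₜ* G') : locConst k G' →ₗ[k] locConst k G where
  toFun f := ⟨fun h => f.1 (σ h), comapOpenNormal σ f.2.choose, fun h n hn => by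
    change f.1 (σ (h * n)) = _
    rw [map_mul]
    exact f.2.choose_spec _ _ hn⟩
  map_add' _ _ := rfl
  map_smul' _ _ := rfl

lemma pullback_apply (σ : G →ₜ* G') (f : locConst k G') (h : G) :
    (pullback σ f).1 h = f.1 (σ h) := rfl

/-- The map `k[[G]] → k[[G']]` is dual to the pullback of functions. -/
lemma pairing_map (σ : G →ₜ* G') (a : IwasawaAlgebra k G) (f : locConst k G') :
    pairing (map k σ a) f = pairing a (pullback σ f) := by
  obtain ⟨N, hN⟩ := f.2
  have hN' : IsInvariant (comapOpenNormal σ N) (pullback σ f).1 := fun h n hn => by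
    rw [pullback_apply, pullback_apply, map_mul]
    exact hN _ _ hn
  rw [pairing_apply _ _ hN, pairing_apply _ _ hN', map_apply]
  generalize a.1 _ = z
  induction z using MonoidAlgebra.induction_linear with
  | zero => simp
  | add x y hx hy => rw [map_add, map_add, map_add, hx, hy]
  | single q c =>
    obtain ⟨h, rfl⟩ := QuotientGroup.mk'_surjective _ q
    rw [integrate_single_mk hN', MonoidAlgebra.mapDomainAlgHom_apply,
      MonoidAlgebra.mapDomain_single, pullback_apply]
    exact integrate_single_mk hN (σ h) c

lemma pairing_const (a : IwasawaAlgebra k G) (f : locConst k G) (c : k) (hf : ∀ g, f.1 g = c) :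
    pairing a f = augmentation k G a * c := by
  rw [pairing_apply a f (N := topNormal G) (fun g n _ => by rw [hf, hf])]
  change _ = MonoidAlgebra.lift k k (G ⧸ (topNormal G).toSubgroup) 1 (a.1 (topNormal G)) * c
  generalize a.1 _ = z
  induction z using MonoidAlgebra.induction_linear with
  | zero => simp
  | add x y hx hy => rw [map_add, map_add, hx, hy, add_mul]
  | single q b => rw [integrate_single, hf]; simp

/-- The characteristic function of a coset. -/
def indicator (N : OpenNormalSubgroup G) (q : G ⧸ N.toSubgroup) : locConst k G :=
  ⟨fun g => (Finsupp.single q 1 : _ →₀ k) (QuotientGroup.mk' N.toSubgroup g), N,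
    isInvariant_comp_mk N _⟩

lemma pairing_indicator (a : IwasawaAlgebra k G) (N : OpenNormalSubgroup G)
    (q : G ⧸ N.toSubgroup) : pairing a (indicator N q) = (a.1 N).coeff q := by
  classical
  have hN : IsInvariant N (indicator (k := k) N q).1 :=
    isInvariant_comp_mk N fun r => (Finsupp.single q 1 : _ →₀ k) r
  rw [pairing_apply _ _ hN]
  generalize a.1 N = z
  induction z using MonoidAlgebra.induction_linear with
  | zero => simp
  | add x y hx hy => rw [map_add, hx, hy]; rfl
  | single r c =>
    obtain ⟨g, rfl⟩ := QuotientGroup.mk'_surjective _ r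
    rw [integrate_single_mk hN]
    change c * (Finsupp.single q 1 : _ →₀ k) _ = (Finsupp.single _ c : _ →₀ k) q
    simp [Finsupp.single_apply, eq_comm]

lemma pairing_injective : Function.Injective (pairing : IwasawaAlgebra k G →ₗ[k] _) := by
  intro a b h
  refine ext_apply fun N => MonoidAlgebra.ext (Finsupp.ext fun q => ?_)
  rw [← pairing_indicator, h, pairing_indicator]

/-- For profinite `G` the algebra `k[[G]]` is the full dual of the space of locally constant
functions. -/
lemma pairing_surjective [∀ N : OpenNormalSubgroup G, Finite (G ⧸ N.toSubgroup)] :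
    Function.Surjective (pairing : IwasawaAlgebra k G →ₗ[k] _) := by
  classical
  intro l
  have hfin : ∀ N : OpenNormalSubgroup G, Fintype (G ⧸ N.toSubgroup) := fun N => Fintype.ofFinite _
  let a : IwasawaAlgebra k G :=
    ⟨fun N => ∑ q, MonoidAlgebra.single q (l (indicator N q)), fun N N' h => by
      rw [map_sum]
      simp only [MonoidAlgebra.mapDomainAlgHom_apply, MonoidAlgebra.mapDomain_single]
      refine MonoidAlgebra.ext (Finsupp.ext fun r => ?_)
      simp only [MonoidAlgebra.coeff_sum, MonoidAlgebra.coeff_single, Finsupp.finsetSum_apply,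
        Finsupp.single_apply, Finset.sum_ite_eq', Finset.mem_univ, if_true]
      rw [← Finset.sum_filter, ← map_sum]
      congr 1
      refine Subtype.ext (funext fun g => ?_)
      rw [AddSubmonoidClass.coe_finsetSum, Finset.sum_apply]
      change ∑ c ∈ _, (Finsupp.single c 1 : _ →₀ k) _ = (Finsupp.single r 1 : _ →₀ k) _
      simp only [Finsupp.single_apply, Finset.sum_ite_eq', Finset.mem_filter, Finset.mem_univ,
        true_and]
      exact if_congr eq_comm rfl rfl⟩
  refine ⟨a, LinearMap.ext fun f => ?_⟩
  obtain ⟨N, hN⟩ := f.2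
  have hf : f = ∑ q : G ⧸ N.toSubgroup, f.1 q.out • indicator N q := by
    refine Subtype.ext (funext fun g => ?_)
    rw [AddSubmonoidClass.coe_finsetSum, Finset.sum_apply]
    change f.1 g = ∑ c : G ⧸ N.toSubgroup, f.1 c.out * (Finsupp.single c 1 : _ →₀ k) _
    simp [Finsupp.single_apply]
    exact (hN.out_eq g).symm
  have ha : ∀ q : G ⧸ N.toSubgroup, pairing a (indicator N q) = l (indicator N q) := fun q => by
    rw [pairing_indicator]
    change (∑ q, MonoidAlgebra.single q (l (indicator N q))).coeff q = _
    simp [Finsupp.single_apply]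
  rw [hf, map_sum, map_sum]
  exact Finset.sum_congr rfl fun q _ => by rw [map_smul, map_smul, ha]

/-- The completed group algebra of a commutative group is commutative. -/
abbrev commRing (hG : ∀ g h : G, g * h = h * g) : CommRing (IwasawaAlgebra k G) :=
  { (inferInstance : Ring (IwasawaAlgebra k G)) with
    mul_comm := fun a b => ext_apply fun N => by
      change a.1 N * b.1 N = b.1 N * a.1 N
      generalize a.1 N = x
      generalize b.1 N = y
      induction x using MonoidAlgebra.induction_linear with
      | zero => simp
      | add x x' hx hx' => rw [add_mul, mul_add, hx, hx']
      | single q c =>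
        induction y using MonoidAlgebra.induction_linear with
        | zero => simp
        | add y y' hy hy' => rw [add_mul, mul_add, hy, hy']
        | single r d =>
          obtain ⟨g, rfl⟩ := QuotientGroup.mk'_surjective _ q
          obtain ⟨h, rfl⟩ := QuotientGroup.mk'_surjective _ r
          rw [MonoidAlgebra.single_mul_single, MonoidAlgebra.single_mul_single, ← map_mul,
            ← map_mul, hG, mul_comm c] }

end IwasawaAlgebra

/-! ### Finite flat endomorphisms of completed group algebras -/

lemma flat_and_finite_of_bijective {A B : Type*} [CommRing A] [CommRing B] (f : A →+* B)
    {Q : Type*} [Fintype Q] (b : Q → B)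
    (h : Function.Bijective fun a : Q → A => ∑ q, f (a q) * b q) : f.Flat ∧ f.Finite := by
  let := f.toAlgebra
  have e : (Q → A) ≃ₗ[A] B := LinearEquiv.ofBijective (Fintype.linearCombination A b) (by
    convert! h using 1)
  exact ⟨Module.Flat.of_linearEquiv e.symm, Module.Finite.equiv e⟩

namespace IwasawaAlgebra

variable {k : Type*} [Field k] {G G' : Type*} [Group G] [TopologicalSpace G] [Group G']
  [TopologicalSpace G']

section FiniteFlat

variable [IsTopologicalGroup G] [CompactSpace G]

instance (N : OpenNormalSubgroup G) : Finite (G ⧸ N.toSubgroup) :=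
  N.toSubgroup.quotient_finite_of_isOpen N.isOpen'

/-- An open injective endomorphism of a commutative profinite group `G` makes `k[[G]]` a free module
of finite rank over itself; a basis is given by representatives of the cosets of the image. -/
lemma flat_and_finite_map (hG : ∀ g h : G, g * h = h * g) (σ : G →ₜ* G)
    (hσ : Function.Injective σ) (hσ' : IsOpenMap σ) :
    let := commRing (k := k) hG
    (map k σ : IwasawaAlgebra k G →+* IwasawaAlgebra k G).Flat ∧
      (map k σ : IwasawaAlgebra k G →+* IwasawaAlgebra k G).Finite := by
  intro inst
  let H : Subgroup G := (σ : G →* G).range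
  have : Finite (G ⧸ H) := H.quotient_finite_of_isOpen (by
    have := hσ'.isOpen_range
    exact this)
  have := Fintype.ofFinite (G ⧸ H)
  let t : G ⧸ H → G := fun q => q.out
  have hdec : ∀ g : G, ∃ h, t (g : G ⧸ H) * σ h = g := fun g => by
    obtain ⟨⟨_, h, rfl⟩, hn⟩ := QuotientGroup.mk_out_eq_mul H g
    refine ⟨h⁻¹, ?_⟩
    change (g : G ⧸ H).out * _ = g
    rw [hn, map_inv]
    exact mul_inv_cancel_right _ _
  choose r hr using hdec
  have hr' : ∀ (q : G ⧸ H) (h : G), ((t q * σ h : G) : G ⧸ H) = q := fun q h => by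
    have : ((t q * σ h : G) : G ⧸ H) = ((t q : G) : G ⧸ H) :=
      QuotientGroup.mk_mul_of_mem _ ⟨h, rfl⟩
    rw [this]
    exact QuotientGroup.out_eq' q
  have hr'' : ∀ (q : G ⧸ H) (h : G), r (t q * σ h) = h := fun q h => by
    have := hr (t q * σ h)
    rw [hr'] at this
    exact hσ (mul_left_cancel this)
  -- Restriction of a function to the cosets of the image of `σ`.
  let ρ : G ⧸ H → locConst k G →ₗ[k] locConst k G := fun q => (pullback σ).comp (translate (t q))
  have hglue : ∀ f : G ⧸ H → locConst k G, ∃ F : locConst k G, ∀ q, ρ q F = f q := by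
    intro f
    choose N hN using fun q => (f q).2
    have : Nonempty (OpenNormalSubgroup G) := ⟨topNormal G⟩
    obtain ⟨N', hN'⟩ := Finite.exists_ge N
    let N'' : OpenNormalSubgroup G :=
      { toSubgroup := N'.toSubgroup.map (σ : G →* G)
        isOpen' := hσ' _ N'.isOpen'
        isNormal' := ⟨fun n hn g => by rwa [hG g n, mul_inv_cancel_right]⟩ }
    refine ⟨⟨fun g => (f (g : G ⧸ H)).1 (r g), N'', ?_⟩, fun q => Subtype.ext (funext fun h => ?_)⟩
    · rintro g _ ⟨n, hn, rfl⟩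
      have h₁ : g * σ n = t (g : G ⧸ H) * σ (r g * n) := by rw [map_mul, ← mul_assoc, hr]
      change (f ((g * σ n : G) : G ⧸ H)).1 (r (g * σ n)) = _
      rw [h₁, hr', hr'']
      exact hN _ _ n (hN' _ hn)
    · change (f ((t q * σ h : G) : G ⧸ H)).1 (r (t q * σ h)) = _
      rw [hr', hr'']
  have hpair : ∀ (a : G ⧸ H → IwasawaAlgebra k G) (F : locConst k G),
      pairing (∑ q, map k σ (a q) * of k (t q)) F = ∑ q, pairing (a q) (ρ q F) := by
    intro a F
    rw [map_sum, LinearMap.sum_apply]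
    refine Finset.sum_congr rfl fun q _ => ?_
    rw [mul_comm, pairing_of_mul, pairing_map]
    rfl
  refine flat_and_finite_of_bijective _ (fun q => of k (t q)) ⟨fun a b hab => ?_, fun c => ?_⟩
  · classical
    refine funext fun q => pairing_injective (LinearMap.ext fun F => ?_)
    obtain ⟨E, hE⟩ := hglue (Pi.single q F)
    have key : ∀ a : G ⧸ H → IwasawaAlgebra k G,
        pairing (∑ q, map k σ (a q) * of k (t q)) E = pairing (a q) F := fun a => by
      rw [hpair, Finset.sum_eq_single q]
      · rw [hE, Pi.single_eq_same]
      · intro q' _ hq'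
        rw [hE, Pi.single_eq_of_ne hq', map_zero]
      · simp
    rw [← key a, ← key b]
    exact congrArg (fun x => pairing x E) hab
  · -- A linear form on the functions on `G` is a sum of linear forms on those on the cosets.
    classical
    choose E hE using hglue
    have hE_eq : ∀ F : locConst k G, F = E fun q => ρ q F := fun F => by
      refine Subtype.ext (funext fun g => ?_)
      have : ∀ F' : locConst k G, F'.1 g = (ρ (g : G ⧸ H) F').1 (r g) := fun F' => by
        change _ = F'.1 (t (g : G ⧸ H) * σ (r g))
        rw [hr]
      rw [this, this, hE]
    have hE_lin : ∀ F F' : locConst k G, (∀ q, ρ q F = ρ q F') → F = F' := fun F F' h => by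
      rw [hE_eq F, hE_eq F', funext h]
    let s : G ⧸ H → locConst k G →ₗ[k] locConst k G := fun q =>
      { toFun := fun F => E (Pi.single q F)
        map_add' := fun F F' => hE_lin _ _ fun q' => by
          rw [map_add, hE, hE, hE, Pi.single_add, Pi.add_apply]
        map_smul' := fun c F => hE_lin _ _ fun q' => by
          rw [RingHom.id_apply, map_smul, hE, hE, Pi.single_smul, Pi.smul_apply] }
    have hs : ∀ F, ∑ q, s q (ρ q F) = F := fun F => hE_lin _ _ fun q' => by
      rw [map_sum, Finset.sum_eq_single q']
      · exact (hE _ _).trans (Pi.single_eq_same _ _)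
      · intro q _ hq
        exact (hE _ _).trans (Pi.single_eq_of_ne hq.symm _)
      · simp
    choose a ha using fun q => pairing_surjective ((pairing c).comp (s q))
    refine ⟨a, pairing_injective (LinearMap.ext fun F => ?_)⟩
    refine (hpair a F).trans ?_
    simp only [ha, LinearMap.comp_apply]
    rw [← map_sum, hs]

end FiniteFlat

end IwasawaAlgebra

/-! ### Nilpotence of augmentation ideals and smooth modules -/

section Jacobson

variable {A B S : Type*} [CommRing A] [Ring B] [Ring S]

/-- Let `I` be an ideal of a commutative ring `A`, a power of which is killed by `ρ : A → B`. If the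
left ideals of `B` generated by the powers of `I` are two-sided, then they are nilpotent. -/
lemma isNilpotent_mul_of_mul_mem (ρ : A →+* B) {I : Ideal A}
    (hI : ∀ n, ∀ y ∈ I ^ n, ∀ b, ρ y * b ∈ Ideal.span (ρ '' (I ^ n : Ideal A))) {n : ℕ}
    (hn : ∀ y ∈ I ^ n, ρ y = 0) {y : A} (hy : y ∈ I) (b : B) : IsNilpotent (b * ρ y) := by
  have h₁ : ∀ j, ∀ v ∈ Ideal.span (ρ '' (I ^ j : Ideal A)), ∀ b,
      v * b ∈ Ideal.span (ρ '' (I ^ j : Ideal A)) := by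
    intro j v hv b
    induction hv using Submodule.span_induction with
    | mem v hv =>
      obtain ⟨z, hz, rfl⟩ := hv
      exact hI j z hz b
    | zero => rw [zero_mul]; exact zero_mem _
    | add _ _ _ _ h h' => rw [add_mul]; exact add_mem h h'
    | smul c v _ h => rw [smul_eq_mul, mul_assoc]; exact Ideal.mul_mem_left _ _ h
  have h₂ : ∀ j, ∀ v ∈ Ideal.span (ρ '' (I ^ j : Ideal A)),
      v * ρ y ∈ Ideal.span (ρ '' (I ^ (j + 1) : Ideal A)) := by
    intro j v hv
    induction hv using Submodule.span_induction with
    | mem v hv =>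
      obtain ⟨z, hz, rfl⟩ := hv
      rw [← map_mul]
      exact Ideal.subset_span ⟨_, pow_succ I j ▸ Ideal.mul_mem_mul hz hy, rfl⟩
    | zero => rw [zero_mul]; exact zero_mem _
    | add _ _ _ _ h h' => rw [add_mul]; exact add_mem h h'
    | smul c v _ h => rw [smul_eq_mul, mul_assoc]; exact Ideal.mul_mem_left _ _ h
  have h₃ : ∀ j, (b * ρ y) ^ j ∈ Ideal.span (ρ '' (I ^ j : Ideal A)) := by
    intro j
    induction j with
    | zero => exact Ideal.subset_span ⟨1, by simp, by simp⟩
    | succ j ih =>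
      rw [pow_succ (b * ρ y), ← mul_assoc]
      exact h₂ j _ (h₁ j _ ih b)
  refine ⟨n, ?_⟩
  have h : Ideal.span (ρ '' (I ^ n : Ideal A)) = ⊥ := by
    rw [Ideal.span_eq_bot]
    rintro _ ⟨z, hz, rfl⟩
    exact hn z hz
  exact (Submodule.mem_bot B).1 (h ▸ h₃ n)

/-- A form of Nakayama's lemma: if `ι` sends the finitely generated ideal `I` into the Jacobson
radical of `S`, then a power of `I` kills every element which generates an artinian module. -/
lemma exists_pow_smul_eq_zero (ι : A →+* S) {I : Ideal A} (hI : I.FG)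
    (hι : ∀ y ∈ I, ι y ∈ Ring.jacobson S) {M : Type*} [AddCommGroup M] [Module S M] (m : M)
    [IsArtinian S (Submodule.span S {m})] : ∃ n, ∀ a ∈ I ^ n, ι a • m = 0 := by
  let L : ℕ → Submodule S M := fun n => Submodule.span S ((fun a => ι a • m) '' (I ^ n : Ideal A))
  have hanti : Antitone L := fun i j h =>
    Submodule.span_mono (Set.image_mono (Ideal.pow_le_pow_right h))
  have hle : ∀ n, L n ≤ Submodule.span S {m} := fun n => by
    rw [Submodule.span_le]
    rintro _ ⟨a, -, rfl⟩
    exact Submodule.smul_mem _ _ (Submodule.mem_span_singleton_self m)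
  obtain ⟨n, hn⟩ := IsArtinian.monotone_stabilizes (R := S) (M := Submodule.span S {m})
    ⟨fun n => OrderDual.toDual ((L n).comap (Submodule.span S {m}).subtype),
      fun i j h => Submodule.comap_mono (hanti h)⟩
  have hn : L n = L (n + 1) := by
    have h : (L n).comap (Submodule.span S {m}).subtype =
      (L (n + 1)).comap (Submodule.span S {m}).subtype := hn (n + 1) (Nat.le_succ n)
    have := congrArg (Submodule.map (Submodule.span S {m}).subtype) h
    rwa [Submodule.map_comap_subtype, Submodule.map_comap_subtype, inf_eq_right.2 (hle _),
      inf_eq_right.2 (hle _)] at this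
  have hfg : (L n).FG := by
    obtain ⟨T, hT⟩ := hI.pow (n := n)
    classical
    refine ⟨T.image fun a => ι a • m, le_antisymm (Submodule.span_mono ?_) (Submodule.span_le.2 ?_)⟩
    · rw [Finset.coe_image]
      exact Set.image_mono (hT ▸ Submodule.subset_span)
    · rintro _ ⟨a, ha', rfl⟩
      have ha : a ∈ Submodule.span A (T : Set A) := hT.ge ha'
      clear ha'
      change ι a • m ∈ Submodule.span S _
      induction ha using Submodule.span_induction with
      | mem a ha => exact Submodule.subset_span (by rw [Finset.coe_image]; exact ⟨a, ha, rfl⟩)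
      | zero => rw [map_zero, zero_smul]; exact zero_mem _
      | add _ _ _ _ h h' => rw [map_add, add_smul]; exact add_mem h h'
      | smul b a _ h => rw [smul_eq_mul, map_mul, mul_smul]; exact Submodule.smul_mem _ _ h
  have hjac : L n ≤ Ring.jacobson S • L n := by
    conv_lhs => rw [hn]
    rw [Submodule.span_le]
    rintro _ ⟨a, ha, rfl⟩
    change a ∈ I ^ (n + 1) at ha
    change ι a • m ∈ _
    rw [pow_succ'] at ha
    refine Submodule.mul_induction_on ha (fun y hy z hz => ?_) fun y z hy hz => ?_
    · rw [map_mul, mul_smul]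
      exact Submodule.smul_mem_smul (hι y hy) (Submodule.subset_span ⟨z, hz, rfl⟩)
    · rw [map_add, add_smul]
      exact add_mem hy hz
  have hbot := hfg.eq_bot_of_le_jacobson_smul hjac
  refine ⟨n, fun a ha => ?_⟩
  have : ι a • m ∈ L n := Submodule.subset_span ⟨a, ha, rfl⟩
  rwa [hbot, Submodule.mem_bot] at this

end Jacobson

namespace IwasawaAlgebra

variable {k : Type*} [Field k] {G G' : Type*} [Group G] [TopologicalSpace G] [Group G']
  [TopologicalSpace G']

lemma augmentation_surjective : Function.Surjective (augmentation k G) := fun c =>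
  ⟨algebraMap k _ c, AlgHom.commutes _ c⟩

instance : Nontrivial (IwasawaAlgebra k G) := (augmentation_surjective (k := k) (G := G)).nontrivial

/-- If every element of `G` has some `p`-power in the open subgroup `i⁻¹(N)`, the image of the
augmentation ideal in `k[G' / N]` is nilpotent. -/
lemma exists_pow_map_eq_zero {p : ℕ} [Fact p.Prime] [CharP k p] (hG : ∀ g h : G, g * h = h * g)
    (i : G →ₜ* G') (N : OpenNormalSubgroup G') (hN : ∀ g, ∃ e, i g ^ p ^ e ∈ N) {E : Set G}
    (hE : E.Finite) :
    let := commRing (k := k) hG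
    RingHom.ker (augmentation k G) = Ideal.span ((fun g => of k g - 1) '' E) →
      ∃ n, ∀ y ∈ RingHom.ker (augmentation k G) ^ n, (map k i y).1 N = 0 := by
  intro inst hm
  let ρ : IwasawaAlgebra k G →+* MonoidAlgebra k (G' ⧸ N.toSubgroup) :=
    (((Pi.evalAlgHom k _ N).comp (IwasawaAlgebra k G').val).comp (map k i) : _ →ₐ[k] _)
  have : CharP (IwasawaAlgebra k G) p :=
    charP_of_injective_algebraMap (algebraMap k _).injective p
  have hof : ∀ (g : G) (n : ℕ), of k g ^ n = of k (g ^ n) := fun g n => by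
    induction n with
    | zero => rw [pow_zero, pow_zero, of_one]
    | succ n ih => rw [pow_succ, pow_succ, of_mul, ih]
  have hle : RingHom.ker (augmentation k G) ≤ (RingHom.ker ρ).radical := by
    rw [hm, Ideal.span_le]
    rintro _ ⟨g, -, rfl⟩
    obtain ⟨e, he⟩ := hN g
    refine ⟨p ^ e, ?_⟩
    -- In characteristic `p`, `(g - 1) ^ p ^ e = g ^ p ^ e - 1`.
    rw [RingHom.mem_ker, sub_pow_char_pow, one_pow, hof, map_sub, map_one, sub_eq_zero]
    change (map k i (of k (g ^ p ^ e))).1 N = 1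
    rw [map_of, of_apply, map_pow, (QuotientGroup.eq_one_iff (i g ^ p ^ e)).2 he |> fun h =>
      (show QuotientGroup.mk' N.toSubgroup (i g ^ p ^ e) = 1 from h)]
    rfl
  have hfg : (RingHom.ker (augmentation k G)).FG := by
    rw [hm]
    exact Submodule.fg_span (hE.image _)
  obtain ⟨n, hn⟩ := Ideal.exists_pow_le_of_le_radical_of_fg hle hfg
  exact ⟨n, fun y hy => hn hy⟩

/-- The completed group algebra of a commutative pro-`p`-group is a local ring. -/
lemma isLocalRing {p : ℕ} [Fact p.Prime] [CharP k p] (hG : ∀ g h : G, g * h = h * g)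
    (hp : ∀ (N : OpenNormalSubgroup G) (g : G), ∃ e, g ^ p ^ e ∈ N) {E : Set G} (hE : E.Finite) :
    let := commRing (k := k) hG
    RingHom.ker (augmentation k G) = Ideal.span ((fun g => of k g - 1) '' E) →
      IsLocalRing (IwasawaAlgebra k G) := by
  intro inst hm
  have key : ∀ a : IwasawaAlgebra k G, augmentation k G a ≠ 0 → IsUnit a := by
    intro a ha
    refine isUnit_of_forall fun N => ?_
    obtain ⟨n, hn⟩ := exists_pow_map_eq_zero hG (ContinuousMonoidHom.id G) N (hp N) hE hm
    let y := algebraMap k _ (augmentation k G a)⁻¹ * a - 1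
    have hy : y ∈ RingHom.ker (augmentation k G) := by
      rw [RingHom.mem_ker, map_sub, map_mul, AlgHom.commutes, map_one]
      simp [ha]
    have hid : ∀ x : IwasawaAlgebra k G, (map k (ContinuousMonoidHom.id G) x).1 N = x.1 N :=
      fun x => (map_apply_of_le _ x N N le_rfl).trans (x.2 N N le_rfl)
    have hnil : IsNilpotent (y.1 N) := ⟨n, by
      rw [← hn (y ^ n) (Ideal.pow_mem_pow hy n), hid]
      rfl⟩
    have h1 : a = algebraMap k _ (augmentation k G a) * (1 + y) := by
      change a = algebraMap k _ _ * (1 + (algebraMap k _ (augmentation k G a)⁻¹ * a - 1))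
      rw [add_sub_cancel, ← mul_assoc, ← map_mul, mul_inv_cancel₀ ha, map_one, one_mul]
    have h2 : a.1 N = algebraMap k _ (augmentation k G a) * (1 + y.1 N) :=
      congrArg (fun z : IwasawaAlgebra k G => z.1 N) h1
    rw [h2]
    exact ((IsUnit.mk0 _ ha).map _).mul hnil.isUnit_one_add
  refine IsLocalRing.of_isUnit_or_isUnit_one_sub_self fun a => ?_
  by_cases ha : augmentation k G a = 0
  · refine Or.inr (key _ ?_)
    rw [map_sub, map_one, ha, sub_zero]
    exact one_ne_zero
  · exact Or.inl (key a ha)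

/-- The augmentation ideal of `k[[G]]`, for a commutative pro-`p`-subgroup `G` which is normal in
`G'`, lies in the Jacobson radical of `k[[G']]`. -/
lemma map_mem_jacobson {p : ℕ} [Fact p.Prime] [CharP k p] (hG : ∀ g h : G, g * h = h * g)
    (i : G →ₜ* G') (hp : ∀ (N : OpenNormalSubgroup G') (g : G), ∃ e, i g ^ p ^ e ∈ N)
    (hi : ∀ h : G', ∃ c : G →ₜ* G, ∀ g, h * i (c g) = i g * h) {E : Set G} (hE : E.Finite) :
    let := commRing (k := k) hG
    RingHom.ker (augmentation k G) = Ideal.span ((fun g => of k g - 1) '' E) →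
      ∀ y ∈ RingHom.ker (augmentation k G), map k i y ∈ Ring.jacobson (IwasawaAlgebra k G') := by
  intro inst hm y hy
  rw [← Ideal.jacobson_bot, Ideal.mem_jacobson_iff]
  intro s
  have hu : IsUnit (1 + s * map k i y) := by
    refine isUnit_of_forall fun N => ?_
    obtain ⟨n, hn⟩ := exists_pow_map_eq_zero hG i N (hp N) hE hm
    let ρ : IwasawaAlgebra k G →+* MonoidAlgebra k (G' ⧸ N.toSubgroup) :=
      (((Pi.evalAlgHom k _ N).comp (IwasawaAlgebra k G').val).comp (map k i) : _ →ₐ[k] _)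
    refine (isNilpotent_mul_of_mul_mem ρ (fun j z hz b => ?_) hn hy (s.1 N)).isUnit_one_add
    induction b using MonoidAlgebra.induction_linear with
    | zero => rw [mul_zero]; exact zero_mem _
    | add b b' h h' => rw [mul_add]; exact add_mem h h'
    | single q r =>
      obtain ⟨h, rfl⟩ := QuotientGroup.mk'_surjective _ q
      obtain ⟨c, hc⟩ := hi h
      have h₁ : (of k h).1 N * ρ (map k c z) = ρ z * (of k h).1 N := by
        have := congrArg (fun x : IwasawaAlgebra k G' => x.1 N)
          (of_mul_map (k := k) (i.comp c) i h hc z)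
        rw [← map_map] at this
        exact this
      have h₂ : MonoidAlgebra.single (QuotientGroup.mk' N.toSubgroup h) r = r • (of k h).1 N := by
        rw [of_apply, MonoidAlgebra.smul_single, smul_eq_mul, mul_one]
      rw [h₂, mul_smul_comm, ← h₁, ← smul_mul_assoc]
      refine Ideal.mul_mem_left _ _ (Ideal.subset_span ⟨_, ?_, rfl⟩)
      have hcle : (RingHom.ker (augmentation k G)).map (map k c) ≤
          RingHom.ker (augmentation k G) := by
        rw [Ideal.map_le_iff_le_comap]
        intro x hx
        rw [Ideal.mem_comap, RingHom.mem_ker, augmentation_map]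
        exact hx
      exact Ideal.pow_right_mono hcle j (Ideal.map_pow (map k c) _ j ▸ Ideal.mem_map_of_mem _ hz)
  obtain ⟨u, hu⟩ := hu
  refine ⟨((u⁻¹ : _ˣ) : IwasawaAlgebra k G'), ?_⟩
  have : ((u⁻¹ : _ˣ) : IwasawaAlgebra k G') * s * map k i y + ((u⁻¹ : _ˣ) : IwasawaAlgebra k G') =
      ((u⁻¹ : _ˣ) : IwasawaAlgebra k G') * (1 + s * map k i y) := by
    rw [mul_add, mul_one, mul_assoc, add_comm]
  rw [this, ← hu, Units.inv_mul, sub_self]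
  exact zero_mem _

end IwasawaAlgebra

/-! ### The regular sequence which generates the augmentation ideal -/

namespace IwasawaAlgebra

variable {p : ℕ} [Fact p.Prime] {d : ℕ} {G : Type*} [Group G] [TopologicalSpace G]
  (ψ : G ≃ₜ* Multiplicative (Fin d → ℤ_[p]))

/-- The coordinates of `g ∈ G`, for an isomorphism `ψ : G ≃ ℤ_p^d`. -/
def coord (i : Fin d) (g : G) : ℤ_[p] := (ψ g).toAdd i

/-- The element of `G` with given coordinates. -/
def ofCoord (v : Fin d → ℤ_[p]) : G := ψ.symm (Multiplicative.ofAdd v)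

/-- The topological basis of `G` given by `ψ : G ≃ ℤ_p^d`. -/
def gen (i : Fin d) : G := ofCoord ψ (Pi.single i 1)

lemma coord_mul (i : Fin d) (g h : G) : coord ψ i (g * h) = coord ψ i g + coord ψ i h := by
  rw [coord, map_mul]
  rfl

lemma coord_ofCoord (i : Fin d) (v : Fin d → ℤ_[p]) : coord ψ i (ofCoord ψ v) = v i := by
  rw [coord, ofCoord, ContinuousMulEquiv.apply_symm_apply]
  rfl

lemma ofCoord_coord (g : G) : ofCoord ψ (fun i => coord ψ i g) = g :=
  ψ.symm_apply_apply g

lemma ofCoord_add (v w : Fin d → ℤ_[p]) : ofCoord ψ (v + w) = ofCoord ψ v * ofCoord ψ w :=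
  map_mul ψ.symm _ _

lemma coord_one (i : Fin d) : coord ψ i 1 = 0 := by
  have := coord_mul ψ i 1 1
  rwa [mul_one, left_eq_add] at this

lemma coord_inv (i : Fin d) (g : G) : coord ψ i g⁻¹ = -coord ψ i g := by
  rw [eq_neg_iff_add_eq_zero, ← coord_mul, inv_mul_cancel, coord_one]

lemma coord_pow (i : Fin d) (g : G) (n : ℕ) : coord ψ i (g ^ n) = n * coord ψ i g := by
  induction n with
  | zero => simp [coord_one]
  | succ n ih => rw [pow_succ, coord_mul, ih]; push_cast; ring

include ψ in
lemma mul_comm_of_coord (g h : G) : g * h = h * g :=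
  ψ.injective (by rw [map_mul, map_mul, mul_comm])

/-- The subgroup of the elements whose coordinates are divisible by `p ^ n`. -/
def congruence (n : ℕ) : OpenNormalSubgroup G where
  carrier := {g | ∀ i, PadicInt.toZModPow n (coord ψ i g) = 0}
  mul_mem' hg hh i := by rw [coord_mul, map_add, hg, hh, add_zero]
  one_mem' i := by rw [coord_one, map_zero]
  inv_mem' hg i := by rw [coord_inv, map_neg, hg, neg_zero]
  isOpen' := by
    have h : ∀ i, IsOpen {g | PadicInt.toZModPow n (coord ψ i g) = 0} := fun i => by
      have hc : Continuous (coord ψ i) :=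
        (continuous_apply i).comp (continuous_toAdd.comp ψ.continuous)
      have : IsOpen {x : ℤ_[p] | PadicInt.toZModPow n x = 0} := by
        have hp : (p : ℝ) ^ (-n : ℤ) ≠ 0 :=
          zpow_ne_zero _ (Nat.cast_ne_zero.2 (Fact.out : p.Prime).ne_zero)
        convert! IsUltrametricDist.isOpen_closedBall (0 : ℤ_[p]) hp
        ext x
        rw [mem_closedBall_zero_iff, PadicInt.norm_le_pow_iff_mem_span_pow,
          ← PadicInt.ker_toZModPow]
        rfl
      exact this.preimage hc
    have := isOpen_iInter_of_finite h
    convert! this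
    ext g
    exact (Set.mem_iInter (s := fun i => {g | PadicInt.toZModPow n (coord ψ i g) = 0})).symm
  isNormal' := ⟨fun n hn g => by rwa [mul_comm_of_coord ψ g n, mul_inv_cancel_right]⟩

lemma exists_congruence_le (N : OpenNormalSubgroup G) : ∃ n, congruence ψ n ≤ N := by
  have h : IsOpen {v : Fin d → ℤ_[p] | ofCoord ψ v ∈ N} :=
    N.isOpen'.preimage (ψ.symm.continuous.comp continuous_ofAdd)
  have h0 : (0 : Fin d → ℤ_[p]) ∈ {v : Fin d → ℤ_[p] | ofCoord ψ v ∈ N} := by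
    change ofCoord ψ 0 ∈ N
    have : ofCoord ψ 0 = 1 := map_one ψ.symm
    rw [this]
    exact one_mem N
  obtain ⟨ε, hε, hball⟩ := Metric.isOpen_iff.1 h 0 h0
  obtain ⟨n, hn⟩ := PadicInt.exists_pow_neg_lt p hε
  refine ⟨n, fun g hg => ?_⟩
  rw [← ofCoord_coord ψ g]
  refine hball ?_
  rw [mem_ball_zero_iff]
  refine lt_of_le_of_lt ((pi_norm_le_iff_of_nonneg (by positivity)).2 fun i => ?_) hn
  rw [PadicInt.norm_le_pow_iff_mem_span_pow, ← PadicInt.ker_toZModPow]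
  exact hg i

lemma congruence_antitone {m n : ℕ} (h : m ≤ n) : congruence ψ n ≤ congruence ψ m := by
  intro g hg i
  have := hg i
  rw [← RingHom.mem_ker, PadicInt.ker_toZModPow] at this ⊢
  exact Ideal.span_singleton_le_span_singleton.2 (pow_dvd_pow _ h) this

lemma pow_mem_congruence (g : G) (n : ℕ) : g ^ p ^ n ∈ congruence ψ n := fun i => by
  rw [coord_pow, map_mul, map_natCast, ZMod.natCast_self, zero_mul]

include ψ in
lemma exists_pow_mem (N : OpenNormalSubgroup G) (g : G) : ∃ e, g ^ p ^ e ∈ N := by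
  obtain ⟨n, hn⟩ := exists_congruence_le ψ N
  exact ⟨n, hn (pow_mem_congruence ψ g n)⟩

lemma coord_gen_self (i : Fin d) : coord ψ i (gen ψ i) = 1 := by
  rw [gen, coord_ofCoord, Pi.single_eq_same]

lemma coord_gen_of_ne {i j : Fin d} (h : i ≠ j) : coord ψ i (gen ψ j) = 0 := by
  rw [gen, coord_ofCoord, Pi.single_eq_of_ne h]

variable {k : Type*} [Field k]

/-- A locally constant function which is invariant under the elements of a topological basis is
constant. -/
lemma eq_one_of_translate_gen {f : locConst k G} (hf : ∀ i, translate (gen ψ i) f = f) (g : G) :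
    f.1 g = f.1 1 := by
  obtain ⟨N, hN⟩ := f.2
  obtain ⟨n, hn⟩ := exists_congruence_le ψ N
  -- The coordinates of the elements under which `f` is invariant. As `f` is locally constant, it is
  -- enough to see that `T` contains the vectors with coordinates in `ℤ`.
  let T : AddSubgroup (Fin d → ℤ_[p]) :=
    { carrier := {v | ∀ h, f.1 (ofCoord ψ v * h) = f.1 h}
      add_mem' := fun {v w} hv hw h => by rw [ofCoord_add, mul_assoc, hv, hw]
      zero_mem' := fun h => by
        have : ofCoord ψ 0 = 1 := map_one ψ.symm
        rw [this, one_mul]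
      neg_mem' := fun {v} hv h => by
        rw [← hv (ofCoord ψ (-v) * h), ← mul_assoc, ← ofCoord_add, add_neg_cancel]
        have : ofCoord ψ 0 = 1 := map_one ψ.symm
        rw [this, one_mul] }
  let v : Fin d → ℕ := fun i => (PadicInt.toZModPow n (coord ψ i g)).val
  have h₀ : ∀ i, (Pi.single i 1 : Fin d → ℤ_[p]) ∈ T := fun i h =>
    congrFun (congrArg Subtype.val (hf i)) h
  have h₁ : (∑ i, v i • Pi.single i (1 : ℤ_[p]) : Fin d → ℤ_[p]) ∈ T :=
    sum_mem fun i _ => nsmul_mem (h₀ i) _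
  have hsum : ∀ i, (∑ i, v i • Pi.single i (1 : ℤ_[p]) : Fin d → ℤ_[p]) i = v i := fun i => by
    rw [Finset.sum_apply, Finset.sum_eq_single i]
    · simp
    · intro j _ hj
      rw [Pi.smul_apply, Pi.single_eq_of_ne hj.symm, smul_zero]
    · simp
  have h₂ : (fun i => coord ψ i g) - (∑ i, v i • Pi.single i (1 : ℤ_[p])) ∈ T := by
    intro h
    rw [mul_comm_of_coord ψ]
    refine hN _ _ (hn fun i => ?_)
    have : NeZero (p ^ n) := ⟨pow_ne_zero _ (Fact.out : p.Prime).ne_zero⟩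
    rw [coord_ofCoord, Pi.sub_apply, hsum, map_sub, map_natCast, ZMod.natCast_zmod_val, sub_self]
  have h₃ := add_mem h₂ h₁
  rw [sub_add_cancel] at h₃
  have := h₃ 1
  rwa [ofCoord_coord, mul_one] at this

lemma sum_range_mul_of_periodic {M : Type*} [AddCommMonoid M] (h : ℕ → M) (m : ℕ)
    (hm : ∀ t, h (m + t) = h t) (q : ℕ) :
    ∑ t ∈ Finset.range (m * q), h t = q • ∑ t ∈ Finset.range m, h t := by
  have hmq : ∀ q t, h (m * q + t) = h t := by
    intro q
    induction q with
    | zero => simp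
    | succ q ih => intro t; rw [mul_add, mul_one, add_assoc, ih, hm]
  induction q with
  | zero => simp
  | succ q ih =>
    rw [mul_add, mul_one, Finset.sum_range_add, ih, succ_nsmul]
    simp only [hmq]

/-- In characteristic `p`, every locally constant function `f` is of the form `F(e_j g) - F(g)`;
moreover `F` inherits the invariance of `f` under the `e_i` for `i ≠ j`. -/
lemma exists_translate_gen_sub_eq [CharP k p] (j : Fin d) (f : locConst k G) :
    ∃ F : locConst k G, translate (gen ψ j) F - F = f ∧
      ∀ i, i ≠ j → translate (gen ψ i) f = f → translate (gen ψ i) F = F := by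
  obtain ⟨N, hN⟩ := f.2
  obtain ⟨n, hn⟩ := exists_congruence_le ψ N
  have hf := hN.mono hn
  have hpos : NeZero (p ^ (n + 1)) := ⟨pow_ne_zero _ (Fact.out : p.Prime).ne_zero⟩
  have hone : Fact (1 < p ^ (n + 1)) :=
    ⟨Nat.one_lt_pow (Nat.succ_ne_zero n) (Fact.out : p.Prime).one_lt⟩
  let e := gen ψ j
  -- The sum of `f` over the `v` translates which precede `g`, `v` being the `j`-th coordinate of
  -- `g` modulo `p ^ (n + 1)`; the sum over a full period `p ^ (n + 1)` is `p` times something.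
  let v : G → ℕ := fun g => (PadicInt.toZModPow (n + 1) (coord ψ j g)).val
  let h : G → ℕ → k := fun g t => f.1 (e⁻¹ ^ (t + 1) * g)
  let F₀ : G → k := fun g => ∑ t ∈ Finset.range (v g), h g t
  have hv : ∀ g m, m ∈ congruence ψ (n + 1) → v (g * m) = v g := fun g m hm => by
    change (PadicInt.toZModPow (n + 1) (coord ψ j (g * m))).val = _
    rw [coord_mul, map_add, hm j, add_zero]
  have hh : ∀ g m, m ∈ congruence ψ (n + 1) → ∀ t, h (g * m) t = h g t := fun g m hm t => by
    change f.1 _ = f.1 _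
    rw [← mul_assoc]
    exact hf _ _ (congruence_antitone ψ (Nat.le_succ n) hm)
  let F : locConst k G := ⟨F₀, congruence ψ (n + 1), fun g m hm => by
    change ∑ t ∈ Finset.range (v (g * m)), h (g * m) t = _
    rw [hv g m hm]
    exact Finset.sum_congr rfl fun t _ => hh g m hm t⟩
  refine ⟨F, Subtype.ext (funext fun g => ?_), fun i hi hfi => Subtype.ext (funext fun g => ?_)⟩
  · change F₀ (e * g) - F₀ g = f.1 g
    have h0 : h (e * g) 0 = f.1 g := by
      change f.1 (e⁻¹ ^ (0 + 1) * (e * g)) = _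
      rw [zero_add, pow_one, inv_mul_cancel_left]
    have hs : ∀ t, h (e * g) (t + 1) = h g t := fun t => by
      change f.1 (e⁻¹ ^ (t + 1 + 1) * (e * g)) = f.1 (e⁻¹ ^ (t + 1) * g)
      rw [pow_succ e⁻¹ (t + 1), mul_assoc, inv_mul_cancel_left]
    have hsum : ∑ t ∈ Finset.range (v g + 1), h (e * g) t = F₀ g + f.1 g := by
      rw [Finset.sum_range_succ', h0]
      exact congrArg (· + f.1 g) (Finset.sum_congr rfl fun t _ => hs t)
    have hve : v (e * g) = (v g + 1) % p ^ (n + 1) := by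
      change (PadicInt.toZModPow (n + 1) (coord ψ j (e * g))).val = _
      rw [coord_mul, coord_gen_self, map_add, map_one, ZMod.val_add, ZMod.val_one, add_comm]
    rw [sub_eq_iff_eq_add']
    rcases (Nat.lt_or_ge (v g + 1) (p ^ (n + 1))) with hlt | hge
    · rw [Nat.mod_eq_of_lt hlt] at hve
      change ∑ t ∈ Finset.range (v (e * g)), h (e * g) t = _
      rw [hve, hsum]
    · have hvg : v g + 1 = p ^ (n + 1) := le_antisymm (ZMod.val_lt _) hge
      have hz : F₀ (e * g) = 0 := by
        change ∑ t ∈ Finset.range (v (e * g)), h (e * g) t = _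
        rw [hve, hvg, Nat.mod_self, Finset.range_zero, Finset.sum_empty]
      rw [hz, ← hsum, hvg, pow_succ, sum_range_mul_of_periodic, nsmul_eq_mul, CharP.cast_eq_zero,
        zero_mul]
      intro t
      change f.1 _ = f.1 _
      rw [add_assoc, pow_add, mul_assoc, mul_comm_of_coord ψ]
      exact hf _ _ (pow_mem_congruence ψ _ n)
  · have hfi' : ∀ g, f.1 (gen ψ i * g) = f.1 g := fun g => congrFun (congrArg Subtype.val hfi) g
    have hv' : v (gen ψ i * g) = v g := by
      change (PadicInt.toZModPow (n + 1) (coord ψ j (gen ψ i * g))).val = _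
      rw [coord_mul, coord_gen_of_ne ψ hi.symm, zero_add]
    change ∑ t ∈ Finset.range (v (gen ψ i * g)), h (gen ψ i * g) t = _
    rw [hv']
    refine Finset.sum_congr rfl fun t _ => ?_
    change f.1 (e⁻¹ ^ (t + 1) * (gen ψ i * g)) = f.1 _
    rw [← mul_assoc, mul_comm_of_coord ψ _ (gen ψ i), mul_assoc, hfi']

end IwasawaAlgebra

/-- A linear form on `K` which vanishes on the kernel of `δ` is of the form `l' ∘ δ`. -/
lemma exists_dual_apply_eq {k V W : Type*} [Field k] [AddCommGroup V] [Module k V]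
    [AddCommGroup W] [Module k W] (K : Submodule k V) (δ : V →ₗ[k] W) (l : Module.Dual k V)
    (h : ∀ v ∈ K, δ v = 0 → l v = 0) : ∃ l' : Module.Dual k W, ∀ v ∈ K, l' (δ v) = l v := by
  have hmem : l.comp K.subtype ∈ LinearMap.range (δ.comp K.subtype).dualMap := by
    rw [LinearMap.range_dualMap_eq_dualAnnihilator_ker, Submodule.mem_dualAnnihilator]
    exact fun v hv => h v v.2 hv
  obtain ⟨l', hl'⟩ := hmem
  exact ⟨l', fun v hv => DFunLike.congr_fun hl' (⟨v, hv⟩ : K)⟩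

namespace IwasawaAlgebra

variable {p : ℕ} [Fact p.Prime] {d : ℕ} {G : Type*} [Group G] [TopologicalSpace G]
  (ψ : G ≃ₜ* Multiplicative (Fin d → ℤ_[p])) (k : Type*) [Field k]

/-- The elements `e_j - 1` of `k[[G]]`, for the topological basis `e_0, …, e_{d - 1}` of `G` given
by `ψ : G ≃ ℤ_p^d`; the value for `j ≥ d` is irrelevant. -/
def var (j : ℕ) : IwasawaAlgebra k G := if h : j < d then of k (gen ψ ⟨j, h⟩) - 1 else 0

/-- The locally constant functions which are invariant under `e_i` for `i < j`. -/
def invariants (j : ℕ) : Submodule k (locConst k G) :=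
  ⨅ i : {i : Fin d // (i : ℕ) < j}, LinearMap.ker (translate (gen ψ i.1) - LinearMap.id)

variable {k}

lemma mem_invariants {j : ℕ} {f : locConst k G} :
    f ∈ invariants ψ k j ↔ ∀ i : Fin d, (i : ℕ) < j → translate (gen ψ i) f = f := by
  rw [invariants, Submodule.mem_iInf, Subtype.forall]
  simp only [LinearMap.mem_ker, LinearMap.sub_apply, LinearMap.id_apply, sub_eq_zero]

lemma pairing_var_mul {j : ℕ} (hj : j < d) (a : IwasawaAlgebra k G) (f : locConst k G) :
    pairing (var ψ k j * a) f = pairing a (translate (gen ψ ⟨j, hj⟩) f - f) := by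
  rw [var, dif_pos hj, sub_mul, one_mul, map_sub, LinearMap.sub_apply, pairing_of_mul, map_sub]

variable [IsTopologicalGroup G] [CompactSpace G]

/-- The ideal generated by `e_i - 1` for `i < j` is the annihilator of the functions which are
invariant under `e_i` for `i < j`. -/
lemma mem_initialIdeal_iff {j : ℕ} (hj : j ≤ d) (a : IwasawaAlgebra k G) :
    let := commRing (k := k) (mul_comm_of_coord ψ)
    a ∈ initialIdeal (var ψ k) j ↔ ∀ f ∈ invariants ψ k j, pairing a f = 0 := by
  intro inst
  constructor
  · intro ha f hf
    rw [mem_invariants] at hf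
    induction ha using Submodule.span_induction with
    | mem x hx =>
      obtain ⟨i, hi, rfl⟩ := hx
      have := pairing_var_mul ψ (hi.trans_le hj) 1 f
      rwa [mul_one, hf ⟨i, hi.trans_le hj⟩ hi, sub_self, map_zero] at this
    | zero => rw [map_zero, LinearMap.zero_apply]
    | add x y _ _ hx hy => rw [map_add, LinearMap.add_apply, hx, hy, add_zero]
    | smul c x hx ih =>
      clear ih
      induction hx using Submodule.span_induction generalizing c with
      | mem x hx =>
        obtain ⟨i, hi, rfl⟩ := hx
        rw [smul_eq_mul, mul_comm, pairing_var_mul ψ (hi.trans_le hj),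
          hf ⟨i, hi.trans_le hj⟩ hi, sub_self, map_zero]
      | zero => rw [smul_zero, map_zero, LinearMap.zero_apply]
      | add x y _ _ hx hy => rw [smul_add, map_add, LinearMap.add_apply, hx, hy, add_zero]
      | smul b x _ ih => rw [smul_smul, ih]
  · intro ha
    induction j generalizing a with
    | zero =>
      have : a = 0 := pairing_injective (LinearMap.ext fun f => by
        rw [ha f ((mem_invariants ψ).2 fun i hi => absurd hi (Nat.not_lt_zero _)), map_zero,
          LinearMap.zero_apply])
      rw [this]
      exact zero_mem _
    | succ j ih =>
      -- On the invariants of the `e_i` with `i < j`, the linear form given by `a` factors through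
      -- `e_j - 1`.
      obtain ⟨l, hl⟩ := exists_dual_apply_eq (invariants ψ k j)
        (translate (gen ψ ⟨j, hj⟩) - LinearMap.id) (pairing a) fun f hf hδ => by
          refine ha f ((mem_invariants ψ).2 fun i hi => ?_)
          rcases Nat.lt_succ_iff_lt_or_eq.1 hi with h | h
          · exact (mem_invariants ψ).1 hf i h
          · obtain rfl : i = ⟨j, hj⟩ := Fin.ext h
            exact sub_eq_zero.1 hδ
      obtain ⟨b, rfl⟩ := pairing_surjective l
      have h : a - var ψ k j * b ∈ initialIdeal (var ψ k) j := by
        refine ih (by omega) _ fun f hf => ?_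
        rw [map_sub, LinearMap.sub_apply, pairing_var_mul ψ hj, sub_eq_zero]
        exact (hl f hf).symm
      have e : a = (a - var ψ k j * b) + b * var ψ k j := by rw [mul_comm b, sub_add_cancel]
      rw [e]
      exact add_mem (initialIdeal_mono _ (Nat.le_succ j) h)
        (Ideal.mul_mem_left _ _ (mem_initialIdeal _ (Nat.lt_succ_self j)))

/-- Regularity is dual to the surjectivity of `e_j - 1` on the functions which are invariant under
the `e_i` for `i < j`. -/
lemma isRegularUpTo_var [CharP k p] :
    let := commRing (k := k) (mul_comm_of_coord ψ)
    IsRegularUpTo (var ψ k) d := by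
  intro inst j hj a ha
  have ha := (mem_initialIdeal_iff ψ hj.le _).1 ha
  refine (mem_initialIdeal_iff ψ hj.le a).2 fun f hf => ?_
  obtain ⟨F, hF, hF'⟩ := exists_translate_gen_sub_eq ψ ⟨j, hj⟩ f
  rw [← hF, ← pairing_var_mul ψ hj]
  refine ha F ((mem_invariants ψ).2 fun i hi => hF' i ?_ ((mem_invariants ψ).1 hf i hi))
  rintro rfl
  exact lt_irrefl _ hi

lemma initialIdeal_var :
    let := commRing (k := k) (mul_comm_of_coord ψ)
    initialIdeal (var ψ k) d = RingHom.ker (augmentation k G) := by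
  intro inst
  ext a
  refine (mem_initialIdeal_iff ψ le_rfl a).trans ?_
  rw [RingHom.mem_ker]
  constructor
  · intro h
    let f : locConst k G := ⟨fun _ => 1, topNormal G, fun _ _ _ => rfl⟩
    have := h f ((mem_invariants ψ).2 fun i _ => rfl)
    rwa [pairing_const a f 1 fun _ => rfl, mul_one] at this
  · intro h f hf
    rw [pairing_const a f (f.1 1) (eq_one_of_translate_gen ψ fun i =>
      (mem_invariants ψ).1 hf i i.2), h, zero_mul]

lemma ker_augmentation_eq_span :
    let := commRing (k := k) (mul_comm_of_coord ψ)
    RingHom.ker (augmentation k G) = Ideal.span ((fun g => of k g - 1) '' Set.range (gen ψ)) := by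
  intro inst
  refine (initialIdeal_var (k := k) ψ).symm.trans ?_
  rw [initialIdeal]
  congr 1
  ext a
  constructor
  · rintro ⟨j, hj, rfl⟩
    have hj : j < d := hj
    exact ⟨_, ⟨⟨j, hj⟩, rfl⟩, (dif_pos hj : var ψ k j = _).symm⟩
  · rintro ⟨_, ⟨j, rfl⟩, rfl⟩
    exact ⟨j, j.2, dif_pos j.2⟩

end IwasawaAlgebra

/-! ### The groups `U` and `H̃` -/

section GL2

open Matrix

variable {p : ℕ} [Fact p.Prime] {F : Type*} [NormedField F] [NormedAlgebra ℚ_[p] F]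
  [FiniteDimensional ℚ_[p] F]

variable (p F) in
/-- `O_F` has a basis over `ℤ_p`, which is a basis of `F` over `ℚ_p`. -/
lemma exists_basis_integers : ∃ b : Module.Basis (Fin (Module.finrank ℚ_[p] F)) ℚ_[p] F,
    ∀ x, x ∈ integers p F ↔ ∀ i, ‖b.repr x i‖ ≤ 1 := by
  let : Algebra ℤ_[p] F := ((algebraMap ℚ_[p] F).comp PadicInt.Coe.ringHom).toAlgebra
  have : IsScalarTower ℤ_[p] ℚ_[p] F := IsScalarTower.of_algebraMap_eq fun _ => rfl
  have : Module.IsTorsionFree ℤ_[p] F := Module.IsTorsionFree.trans_faithfulSMul ℤ_[p] ℚ_[p] F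
  let C := integralClosure ℤ_[p] F
  have : Module.Free ℤ_[p] C := IsIntegralClosure.module_free ℤ_[p] ℚ_[p] F C
  have : Module.Finite ℤ_[p] C := IsIntegralClosure.finite ℤ_[p] ℚ_[p] F C
  have : IsLocalization (Algebra.algebraMapSubmonoid C (nonZeroDivisors ℤ_[p])) F :=
    IsIntegralClosure.isLocalization ℤ_[p] ℚ_[p] F C
  let b₀ : Module.Basis (Fin (Module.finrank ℚ_[p] F)) ℤ_[p] C :=
    Module.finBasisOfFinrankEq _ _ (IsIntegralClosure.rank ℤ_[p] ℚ_[p] F C)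
  refine ⟨b₀.localizationLocalization ℚ_[p] (nonZeroDivisors ℤ_[p]) F, fun x => ⟨fun hx i => ?_,
    fun hx => ?_⟩⟩
  · have := b₀.localizationLocalization_repr_algebraMap ℚ_[p] (nonZeroDivisors ℤ_[p]) F
      (⟨x, hx⟩ : C) i
    refine (congrArg norm this).trans_le ?_
    exact PadicInt.norm_le_one _
  · rw [← (b₀.localizationLocalization ℚ_[p] (nonZeroDivisors ℤ_[p]) F).sum_repr x]
    refine sum_mem fun i _ => ?_
    rw [Algebra.smul_def, Module.Basis.localizationLocalization_apply]
    refine (integers p F).mul_mem ?_ (b₀ i).2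
    exact RingHom.isIntegralElem_map (f := (algebraMap ℚ_[p] F).comp PadicInt.Coe.ringHom)
      (x := (⟨_, hx i⟩ : ℤ_[p]))

variable (p F) in
/-- The topological group `U` is isomorphic to `O_F`, and so to `ℤ_p^d`. -/
lemma nonempty_groupU_equiv :
    Nonempty (groupU p F ≃ₜ* Multiplicative (Fin (Module.finrank ℚ_[p] F) → ℤ_[p])) := by
  obtain ⟨b, hb⟩ := exists_basis_integers p F
  have h01 : ∀ x : F, (GeneralLinearGroup.upperRightHom x :
      GL (Fin 2) F) 0 1 = x := fun x => by simp
  have hmem : ∀ g : groupU p F, g.1 0 1 ∈ integers p F ∧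
      g.1 = GeneralLinearGroup.upperRightHom (g.1 0 1) := by
    rintro ⟨_, x, hx, rfl⟩
    exact ⟨by simpa using hx, congrArg (GeneralLinearGroup.upperRightHom (R := F)) (h01 x).symm⟩
  have hmem' : ∀ v : Fin (Module.finrank ℚ_[p] F) → ℤ_[p],
      ∑ i, (v i : ℚ_[p]) • b i ∈ integers p F := fun v => by
    rw [hb]
    intro i
    rw [b.repr_sum_self]
    exact PadicInt.norm_le_one _
  refine ⟨⟨⟨⟨fun g => Multiplicative.ofAdd fun i => ⟨b.repr (g.1 0 1) i, (hb _).1 (hmem g).1 i⟩,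
    fun v => ⟨GeneralLinearGroup.upperRightHom (∑ i, (v.toAdd i : ℚ_[p]) • b i),
      _, hmem' v.toAdd, rfl⟩, fun g => ?_, fun v => ?_⟩, fun g h => ?_⟩, ?_, ?_⟩⟩
  · ext1
    refine Eq.trans ?_ (hmem g).2.symm
    change GeneralLinearGroup.upperRightHom (∑ i, (b.repr (g.1 0 1) i) • b i) = _
    rw [b.sum_repr]
  · refine Multiplicative.toAdd.injective (funext fun i => PadicInt.ext ?_)
    change b.repr (GeneralLinearGroup.upperRightHom
      (∑ i, (v.toAdd i : ℚ_[p]) • b i) 0 1) i = v.toAdd i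
    rw [h01, b.repr_sum_self]
  · refine Multiplicative.toAdd.injective (funext fun i => PadicInt.ext ?_)
    have : (g * h).1 0 1 = g.1 0 1 + h.1 0 1 := by
      obtain ⟨_, x, _, rfl⟩ := g
      obtain ⟨_, y, _, rfl⟩ := h
      refine (congrArg (fun g : GL (Fin 2) F => g 0 1)
        (AddChar.map_add_eq_mul GeneralLinearGroup.upperRightHom x.toAdd y.toAdd).symm).trans ?_
      exact (h01 _).trans (congrArg₂ (· + ·) (h01 x.toAdd) (h01 y.toAdd)).symm
    change b.repr ((g * h).1 0 1) i = b.repr (g.1 0 1) i + b.repr (h.1 0 1) i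
    rw [this, map_add, Finsupp.add_apply]
  · refine continuous_ofAdd.comp (continuous_pi fun i => Continuous.subtype_mk ?_ _)
    have h₁ : Continuous fun x : F => b.repr x i :=
      (continuous_apply i).comp b.equivFunL.continuous
    have h₂ : Continuous fun g : groupU p F => g.1 0 1 :=
      (Units.continuous_val.comp continuous_subtype_val).matrix_elem 0 1
    exact h₁.comp h₂
  · refine Continuous.subtype_mk (GeneralLinearGroup.continuous_upperRightHom.comp ?_) _
    refine (continuous_finsetSum _ fun i _ => Continuous.smul ?_
      continuous_const)
    exact continuous_subtype_val.comp ((continuous_apply i).comp continuous_toAdd)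

lemma integers_mem_nhds_zero : (integers p F : Set F) ∈ nhds (0 : F) := by
  obtain ⟨b, hb⟩ := exists_basis_integers p F
  have h : ∀ i, {x : F | ‖b.repr x i‖ ≤ 1} ∈ nhds (0 : F) := fun i => by
    have h₁ : Continuous fun x : F => b.repr x i :=
      (continuous_apply i).comp b.equivFunL.continuous
    refine (h₁.norm.tendsto' 0 0 (by simp)).eventually (Iic_mem_nhds one_pos)
  filter_upwards [Filter.iInter_mem.2 h] with x hx
  exact (hb x).2 fun i => Set.mem_iInter.1 hx i

instance : CompactSpace (groupU p F) :=
  (nonempty_groupU_equiv p F).some.symm.toHomeomorph.compactSpace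

variable (ϖ : integers p F) (hϖ : ϖ ≠ 0)

omit [FiniteDimensional ℚ_[p] F] in
lemma conjHom_injective {S : Subgroup (GL (Fin 2) F)} (g : GL (Fin 2) F)
    (h : ∀ x ∈ S, g * x * g⁻¹ ∈ S) : Function.Injective (conjHom g h) := fun _ _ hxy =>
  Subtype.ext (MulAut.conj g |>.injective (congrArg Subtype.val hxy))

/-- The image of `U` under conjugation by `α` contains the matrices `(1 b; 0 1)` with
`b ∈ ϖ O_F`, so it is open. -/
lemma isOpenMap_conjHom_alpha :
    IsOpenMap (conjHom (alpha ϖ hϖ) fun _ => alpha_conj_mem_groupU ϖ hϖ) := by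
  set σ := conjHom (alpha ϖ hϖ) fun _ => alpha_conj_mem_groupU ϖ hϖ with hσ
  have hϖ' : (ϖ : F) ≠ 0 := by simpa using hϖ
  refine (Topology.IsOpenEmbedding.isOpenMap ⟨(σ.continuous_toFun.isClosedEmbedding
    (conjHom_injective _ _)).isEmbedding, ?_⟩)
  refine Subgroup.isOpen_of_mem_nhds (σ : groupU p F →* groupU p F).range (g := 1) ?_
  have h₂ : Continuous fun g : groupU p F => (ϖ : F)⁻¹ * g.1 0 1 :=
    continuous_const.mul ((Units.continuous_val.comp continuous_subtype_val).matrix_elem 0 1)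
  have h₃ : {g : groupU p F | (ϖ : F)⁻¹ * g.1 0 1 ∈ integers p F} ∈ nhds (1 : groupU p F) := by
    refine h₂.continuousAt.preimage_mem_nhds ?_
    simpa using integers_mem_nhds_zero
  filter_upwards [h₃] with g hg
  refine ⟨⟨_, Multiplicative.ofAdd ((ϖ : F)⁻¹ * g.1 0 1), hg, rfl⟩, Subtype.ext ?_⟩
  obtain ⟨_, x, hx, rfl⟩ := g
  change alpha ϖ hϖ * _ * (alpha ϖ hϖ)⁻¹ = _
  rw [mul_inv_eq_iff_eq_mul]
  ext i j
  fin_cases i <;> fin_cases j <;> simp [alpha, diagHom, hϖ']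

omit [FiniteDimensional ℚ_[p] F] in
/-- `U` is normal in `H̃`. -/
lemma conj_mem_groupU {h : GL (Fin 2) F} (hh : h ∈ groupHU p F) :
    ∀ x ∈ groupU p F, h * x * h⁻¹ ∈ groupU p F := by
  refine Subgroup.le_normalizer_iff.1 (sup_le ?_ Subgroup.le_normalizer) h hh
  rw [Subgroup.le_normalizer_iff]
  rintro _ ⟨a, rfl⟩ _ ⟨b, hb, rfl⟩
  refine ⟨Multiplicative.ofAdd ((a : integers p F) * b.toAdd), (integers p F).mul_mem
    (a : integers p F).2 hb, ?_⟩
  rw [eq_mul_inv_iff_mul_eq]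
  ext i j
  fin_cases i <;> fin_cases j <;> simp [diagHom]

end GL2

/-! ### Smooth modules -/

section Smooth

/-- If `f` sends a finitely generated ideal `I` of `A` into the Jacobson radical of `B`, then
each element of a smooth `B[X]_φ`-module is killed by a power of `I`. -/
lemma IsSmooth.exists_pow_smul_eq_zero {k A B : Type*} [Field k] [CommRing A] [Algebra k A]
    [Ring B] [Algebra k B] {φ : A →ₐ[k] A} {φ' : B →ₐ[k] B} (f : A →ₐ[k] B)
    (hf : ∀ a, f (φ a) = φ' (f a)) {M : ModuleCat.{w} (TwistedPoly φ')} (hM : IsSmooth φ' M)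
    {I : Ideal A} (hI : I.FG) (hfI : ∀ y ∈ I, f y ∈ Ring.jacobson B)
    (m : (ModuleCat.restrictScalars (TwistedPoly.map f hf)).obj M) :
    ∃ n, ∀ a ∈ I ^ n, TwistedPoly.C φ a • m = 0 := by
  let m' : (ModuleCat.restrictScalars (TwistedPoly.C φ')).obj M := m
  have := hM (Submodule.span _ {m'}) (Submodule.fg_span_singleton m')
  obtain ⟨n, hn⟩ := PhiModule.exists_pow_smul_eq_zero (f : A →+* B) hI hfI m'
  exact ⟨n, fun a ha => (congrArg (fun r : TwistedPoly φ' => r • (show M from m))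
    (TwistedPoly.map_C f hf a)).trans (hn a ha)⟩

variable {p : ℕ} [Fact p.Prime] {F : Type*} [NormedField F] [NormedAlgebra ℚ_[p] F]
  {k : Type*} [Field k] {d : ℕ}

/-- The augmentation ideal of `k[[U]]` maps into the Jacobson radical of `k[[H̃]]`, because `U` is
a normal pro-`p` subgroup of `H̃`. -/
lemma map_inclHU_mem_jacobson [CompactSpace (groupU p F)] [CharP k p]
    (ψ : groupU p F ≃ₜ* Multiplicative (Fin d → ℤ_[p])) :
    let := IwasawaAlgebra.commRing (k := k) (IwasawaAlgebra.mul_comm_of_coord ψ)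
    ∀ y ∈ RingHom.ker (IwasawaAlgebra.augmentation k (groupU p F)),
      inclIwasawa k p F y ∈ Ring.jacobson (IwasawaAlgebra k (groupHU p F)) := by
  refine IwasawaAlgebra.map_mem_jacobson (IwasawaAlgebra.mul_comm_of_coord ψ) (inclHU p F)
    (fun N g => ?_) (fun h => ⟨conjHom h⁻¹.1 (conj_mem_groupU h⁻¹.2), fun g => Subtype.ext ?_⟩)
    (Set.finite_range _) (IwasawaAlgebra.ker_augmentation_eq_span ψ)
  · exact IwasawaAlgebra.exists_pow_mem ψ (comapOpenNormal (inclHU p F) N) g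
  · change h.1 * (h⁻¹.1 * g.1 * h⁻¹.1⁻¹) = g.1 * h.1
    simp [mul_assoc]

end Smooth

end PhiModule

end

theorem mainTheorem6 {p : ℕ} [Fact p.Prime] {F : Type u} [NormedField F] [NormedAlgebra ℚ_[p] F]
    [FiniteDimensional ℚ_[p] F] {k : Type v} [Field k] [CharP k p]
    (ϖ : PhiModule.integers p F) (hϖ : Irreducible ϖ)
    (M : ModuleCat.{max u v} (PhiModule.TwistedPoly (PhiModule.phiHU k ϖ hϖ.ne_zero)))
    (hsmooth : PhiModule.IsSmooth (PhiModule.phiHU k ϖ hϖ.ne_zero) M)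
    (hfp : Module.FinitePresentation (PhiModule.TwistedPoly (PhiModule.phiU k ϖ hϖ.ne_zero))
      (PhiModule.restrictU k ϖ hϖ.ne_zero M)) :
    (∀ i : ℕ, Module.Finite k[X]
      (PhiModule.tor (PhiModule.phiU k ϖ hϖ.ne_zero)
        (PhiModule.IwasawaAlgebra.augmentation k (PhiModule.groupU p F)) i
        (PhiModule.restrictU k ϖ hϖ.ne_zero M))) ∧
    (∀ i : ℕ, Module.finrank ℚ_[p] F < i → Subsingleton
      (PhiModule.tor (PhiModule.phiU k ϖ hϖ.ne_zero)
        (PhiModule.IwasawaAlgebra.augmentation k (PhiModule.groupU p F)) i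
        (PhiModule.restrictU k ϖ hϖ.ne_zero M))) ∧
    PhiModule.eulerChar (PhiModule.phiU k ϖ hϖ.ne_zero)
      (PhiModule.IwasawaAlgebra.augmentation k (PhiModule.groupU p F))
      (PhiModule.restrictU k ϖ hϖ.ne_zero M) = 0 := by
  obtain ⟨ψ⟩ := PhiModule.nonempty_groupU_equiv p F
  let := PhiModule.IwasawaAlgebra.commRing (k := k)
    (PhiModule.IwasawaAlgebra.mul_comm_of_coord ψ)
  have hspan := PhiModule.IwasawaAlgebra.ker_augmentation_eq_span (k := k) ψ
  have hfg : (RingHom.ker (PhiModule.IwasawaAlgebra.augmentation k (PhiModule.groupU p F))).FG :=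
    Submodule.fg_def.2 ⟨_, (Set.finite_range (PhiModule.IwasawaAlgebra.gen ψ)).image _, hspan.symm⟩
  have hlocal : IsLocalRing (PhiModule.IwasawaAlgebra k (PhiModule.groupU p F)) :=
    PhiModule.IwasawaAlgebra.isLocalRing (PhiModule.IwasawaAlgebra.mul_comm_of_coord ψ)
      (PhiModule.IwasawaAlgebra.exists_pow_mem ψ) (Set.finite_range _) hspan
  have hφ := PhiModule.IwasawaAlgebra.flat_and_finite_map (k := k)
    (PhiModule.IwasawaAlgebra.mul_comm_of_coord ψ) _
    (PhiModule.conjHom_injective (PhiModule.alpha ϖ hϖ.ne_zero) fun _ =>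
      PhiModule.alpha_conj_mem_groupU ϖ hϖ.ne_zero)
    (PhiModule.isOpenMap_conjHom_alpha ϖ hϖ.ne_zero)
  exact PhiModule.tor_and_eulerChar_of_torsion (φ := PhiModule.phiU k ϖ hϖ.ne_zero)
    (ε := PhiModule.IwasawaAlgebra.augmentation k (PhiModule.groupU p F)) hφ.1 hφ.2
    (PhiModule.augmentation_phiU k ϖ hϖ.ne_zero) Module.finrank_pos
    (PhiModule.IwasawaAlgebra.isRegularUpTo_var ψ) (PhiModule.IwasawaAlgebra.initialIdeal_var ψ)
    (PhiModule.restrictU k ϖ hϖ.ne_zero M)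
    (hsmooth.exists_pow_smul_eq_zero (PhiModule.inclIwasawa k p F)
      (PhiModule.inclIwasawa_phi k ϖ hϖ.ne_zero) hfg (PhiModule.map_inclHU_mem_jacobson ψ))
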